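/- \textbf{Corollary (Restoration of universality for $\lambda=0^+$).} Let $n,d\to\infty$ with $n/d\to\alpha>1$, and let $\Delta\ge 0$, $p\in[0,1]$. For each $d$ let $\theta_0,\mu\in\mathbb{R}^d$ be deterministic vectors such that the limits $$\rho=\lim \tfrac1d\|\theta_0\|_2^2,\qquad \gamma=\lim\tfrac1d\|\mu\|_2^2,\qquad \pi=\lim\tfrac1d\,\mu^\top\theta_0$$ exist and are finite ($\pi$ may or may not vanish). The training set consists of $n$ i.i.d. pairs $(x^\nu,y^\nu)$, where $$x^\nu\sim p\,\mathcal N\!\left(\tfrac{\mu}{\sqrt d},I_d\right)+(1-p)\,\mathcal N\!\left(-\tfrac{\mu}{\sqrt d},I_d\right),\qquad y^\nu\mid x^\nu\sim\mathcal N\!\left(\tfrac{\theta_0^\top x^\nu}{\sqrt d},\Delta\right).$$ For $\lambda>0$ let $\hat\theta_\lambda$ be the unique minimizer over $\theta\in\mathbb{R}^d$ of $\sum_{\nu=1}^n\big(y^\nu-\theta^\top x^\nu/\sqrt d\big)^2+\lambda\|\theta\|_2^2$, and put $$\varepsilon_{\rm tr}(\lambda)=\frac1n\sum_{\nu=1}^n\Big(y^\nu-\tfrac{\hat\theta_\lambda^\top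 x^\nu}{\sqrt d}\Big)^2,\qquad \varepsilon_{\rm gen}(\lambda)=\mathbb E_{(x,y)}\Big(y-\tfrac{\hat\theta_\lambda^\top x}{\sqrt d}\Big)^2,$$ where $(x,y)$ is a fresh pair, independent of the training set and with the same law. Then, in the limit $n,d\to\infty$ with vanishing regularization, $$\varepsilon_{\rm gen}\to\frac{\Delta\,\alpha}{\alpha-1},\qquad \varepsilon_{\rm tr}\to\frac{\Delta(\alpha-1)}{\alpha}$$ in probability, in the following sense: for every $\delta>0$ there is $\lambda_0>0$ such that $$\mathbb P\Big(\exists\,\lambda\in(0,\lambda_0]:\ \big|\varepsilon_{\rm gen}(\lambda)-\tfrac{\Delta\alpha}{\alpha-1}\big|\ge\delta\Big)\to0,$$ and likewise for $\varepsilon_{\rm tr}$ and $\Delta(\alpha-1)/\alpha$. (In particular this gives the value both when $n,d\to\infty$ first and $\lambda\to0^+$ afterwards, and when $\lambda\to0^+$ first.) The same two limits, in the same sense, hold for the centered isotropic Gaussian model with the same teacher, in which $x^\nu\sim\mathcal N(0,I_d)$; so the errors of the mixture are the Gaussian ones whatever the correlation between $\theta_0$ and $\mu$. -/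

import Mathlib

open MeasureTheory ProbabilityTheory Filter Topology
open scoped NNReal ENNReal

namespace IsotropicGMM

/-- A training sample: `n` pairs `(x, y)` of an input `x ∈ ℝ^d` and a real label `y`. -/
abbrev Sample (n d : ℕ) : Type := Fin n → EuclideanSpace ℝ (Fin d) × ℝ

/-- The linear prediction `θᵀ x / √d`. -/
noncomputable def predict {d : ℕ} (θ x : EuclideanSpace ℝ (Fin d)) : ℝ :=
  inner ℝ θ x / √(d : ℝ)

/-- The input law `p · N(μ/√d, I) + (1 - p) · N(-μ/√d, I)` of the two-cluster mixture
(`0 ≤ p ≤ 1`). -/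
noncomputable def twoClusterLaw {d : ℕ} (p : ℝ) (μ : EuclideanSpace ℝ (Fin d)) :
    Measure (EuclideanSpace ℝ (Fin d)) :=
  ENNReal.ofReal p • multivariateGaussian ((√(d : ℝ))⁻¹ • μ) 1 +
    ENNReal.ofReal (1 - p) • multivariateGaussian (-((√(d : ℝ))⁻¹ • μ)) 1

/-- The input law `N(0, I)` of the centered isotropic Gaussian model. -/
noncomputable def gaussianLaw (d : ℕ) : Measure (EuclideanSpace ℝ (Fin d)) :=
  multivariateGaussian 0 1

/-- The joint law of `(x, y)` when `x` has law `Q` and, given `x`, the label `y` has law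
`N(θ₀ᵀ x / √d, Δ)`; that is, `y = θ₀ᵀ x / √d + ξ` with `ξ ∼ N(0, Δ)` independent of `x`. -/
noncomputable def teacherLaw {d : ℕ} (Q : Measure (EuclideanSpace ℝ (Fin d)))
    (θ₀ : EuclideanSpace ℝ (Fin d)) (Δ : ℝ≥0) : Measure (EuclideanSpace ℝ (Fin d) × ℝ) :=
  (Q.prod (gaussianReal 0 Δ)).map (fun z => (z.1, predict θ₀ z.1 + z.2))

/-- The law of `n` independent training pairs with law `P`. -/
noncomputable def sampleLaw {d : ℕ} (n : ℕ) (P : Measure (EuclideanSpace ℝ (Fin d) × ℝ)) :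
    Measure (Sample n d) :=
  Measure.pi (fun _ : Fin n => P)

/-- The ridge objective `∑ (y - θᵀ x / √d)² + lam ‖θ‖²`. -/
noncomputable def ridgeRisk {n d : ℕ} (lam : ℝ) (S : Sample n d)
    (θ : EuclideanSpace ℝ (Fin d)) : ℝ :=
  ∑ i, ((S i).2 - predict θ (S i).1) ^ 2 + lam * ‖θ‖ ^ 2

/-- The ridge estimator: the minimizer of the ridge objective. For `lam > 0` it exists and is
unique, see `ridgeEstimator_spec` and `eq_ridgeEstimator`. -/
noncomputable def ridgeEstimator {n d : ℕ} (lam : ℝ) (S : Sample n d) :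
    EuclideanSpace ℝ (Fin d) :=
  Classical.epsilon (fun θ => ∀ θ', ridgeRisk lam S θ ≤ ridgeRisk lam S θ')

/-- The training error `(1/n) ∑ (y - θᵀ x / √d)²`. -/
noncomputable def trainError {n d : ℕ} (S : Sample n d) (θ : EuclideanSpace ℝ (Fin d)) : ℝ :=
  (∑ i, ((S i).2 - predict θ (S i).1) ^ 2) / n

/-- The generalization error: the mean of `(y - θᵀ x / √d)²` over a fresh pair of law `P`. -/
noncomputable def genError {d : ℕ} (P : Measure (EuclideanSpace ℝ (Fin d) × ℝ))
    (θ : EuclideanSpace ℝ (Fin d)) : ℝ :=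
  ∫ z, (z.2 - predict θ z.1) ^ 2 ∂P

/-- `err k S θ` is a performance measure of the weights `θ` trained on `S`. The statement: at the
ridge estimator, as `k → ∞` and the regularization vanishes, it tends in probability to `c`. For
every `δ > 0` there is `lam₀ > 0` such that, with probability tending to one as `k → ∞`, the error
is within `δ` of `c` simultaneously for all `lam ∈ (0, lam₀]`. -/
def VanishingRegLimit (n d : ℕ → ℕ)
    (P : ∀ k, Measure (EuclideanSpace ℝ (Fin (d k)) × ℝ))
    (err : ∀ k, Sample (n k) (d k) → EuclideanSpace ℝ (Fin (d k)) → ℝ) (c : ℝ) : Prop :=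
  ∀ δ : ℝ, 0 < δ → ∃ lam₀ : ℝ, 0 < lam₀ ∧
    Tendsto (fun k => sampleLaw (n k) (P k)
      {S | ∃ lam : ℝ, 0 < lam ∧ lam ≤ lam₀ ∧ δ ≤ |err k S (ridgeEstimator lam S) - c|})
      atTop (𝓝 0)

theorem predict_continuous {d : ℕ} (x : EuclideanSpace ℝ (Fin d)) :
    Continuous (fun θ => predict θ x) := by
  unfold predict
  fun_prop

theorem exists_ridge_minimizer {n d : ℕ} {lam : ℝ} (hlam : 0 < lam) (S : Sample n d) :
    ∃ θ, ∀ θ', ridgeRisk lam S θ ≤ ridgeRisk lam S θ' := by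
  apply Continuous.exists_forall_le
  · unfold ridgeRisk
    have := fun i => predict_continuous (S i).1
    fun_prop
  · have h1 : Tendsto (fun θ : EuclideanSpace ℝ (Fin d) => lam * ‖θ‖ ^ 2)
        (cocompact _) atTop :=
      ((tendsto_pow_atTop two_ne_zero).comp
        (tendsto_norm_cocompact_atTop (E := EuclideanSpace ℝ (Fin d)))).const_mul_atTop hlam
    refine tendsto_atTop_mono (fun θ => ?_) h1
    unfold ridgeRisk
    have : 0 ≤ ∑ i, ((S i).2 - predict θ (S i).1) ^ 2 :=
      Finset.sum_nonneg fun i _ => sq_nonneg _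
    linarith

theorem ridgeEstimator_spec {n d : ℕ} {lam : ℝ} (hlam : 0 < lam) (S : Sample n d)
    (θ : EuclideanSpace ℝ (Fin d)) :
    ridgeRisk lam S (ridgeEstimator lam S) ≤ ridgeRisk lam S θ :=
  Classical.epsilon_spec (exists_ridge_minimizer hlam S) θ

theorem eq_ridgeEstimator {n d : ℕ} {lam : ℝ} (hlam : 0 < lam) (S : Sample n d)
    (a : EuclideanSpace ℝ (Fin d)) (ha : ∀ θ, ridgeRisk lam S a ≤ ridgeRisk lam S θ) :
    a = ridgeEstimator lam S := by
  set b := ridgeEstimator lam S with hb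
  have hbm := ridgeEstimator_spec hlam S a
  have ham := ha ((1 / 2 : ℝ) • (a + b))
  have hsum : ∑ i, ((S i).2 - predict ((1 / 2 : ℝ) • (a + b)) (S i).1) ^ 2 ≤
      (1 / 2) * ∑ i, ((S i).2 - predict a (S i).1) ^ 2 +
      (1 / 2) * ∑ i, ((S i).2 - predict b (S i).1) ^ 2 := by
    rw [Finset.mul_sum, Finset.mul_sum, ← Finset.sum_add_distrib]
    refine Finset.sum_le_sum fun i _ => ?_
    have h : predict ((1 / 2 : ℝ) • (a + b)) (S i).1 =
        (1 / 2) * (predict a (S i).1 + predict b (S i).1) := by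
      unfold predict
      rw [real_inner_smul_left, inner_add_left]
      ring
    rw [h]
    nlinarith [sq_nonneg (predict a (S i).1 - predict b (S i).1)]
  have hpar := parallelogram_law_with_norm ℝ a b
  have hn : ‖(1 / 2 : ℝ) • (a + b)‖ ^ 2 = (1 / 4) * ‖a + b‖ ^ 2 := by
    rw [norm_smul, mul_pow]
    norm_num
  rw [← hb] at hbm
  unfold ridgeRisk at hbm ham
  rw [hn] at ham
  have h0 : lam * ‖a - b‖ ^ 2 ≤ 0 := by
    have h4 : lam * ‖a + b‖ ^ 2 + lam * ‖a - b‖ ^ 2 =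
        2 * (lam * ‖a‖ ^ 2) + 2 * (lam * ‖b‖ ^ 2) := by
      linear_combination lam * hpar
    nlinarith
  have h1 : ‖a - b‖ ^ 2 ≤ 0 := by
    by_contra hc
    push Not at hc
    nlinarith [mul_pos hlam hc]
  have h2 : ‖a - b‖ = 0 := by
    have := sq_nonneg ‖a - b‖
    exact pow_eq_zero_iff two_ne_zero |>.mp (le_antisymm h1 this)
  exact sub_eq_zero.mp (norm_eq_zero.mp h2)

end IsotropicGMM

/-! Let `X` be the matrix with rows `xᵛ / √d`, let `R = (Xᵀ X + lam)⁻¹`, and let `ξ` be the label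
noise. The ridge error is `R Xᵀ ξ - lam R θ₀`: a noise part and a bias. Since `α > 1`, moments of
`θ₀ᵀ R θ₀ / d` stay bounded uniformly in `lam`, so the bias disappears with `lam`, and with it any
influence of the correlation between `θ₀` and `μ`. The noise part has squared norm close to `Δ (tr R
- lam tr R²)`, and `tr R / d` is close to `1 / (α - 1)`, whence a generalization error `Δ (1 + 1 /
(α - 1))`. The extra term `(μᵀ (θ - θ₀) / d)²` due to the cluster means is negligible, because `μᵀ R
Xᵀ ξ` has variance `O(d)` for fixed `lam`. The residual is nearly the projection of `ξ` to a space
of dimension `n - d`, whence the training error `Δ (1 - 1 / α)`.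

The law of a mixture sample is a convex combination, over the cluster assignments, of laws of
shifted Gaussian samples (`pi_mixture_le`). For a fixed assignment `X = G / √d + N` with `N`
deterministic and of Frobenius norm bounded independently of the assignment; Cauchy-Schwarz controls
everything `N` contributes.

All the random matrix theory is Gaussian integration by parts in the entries of `G`, applied to `1 -
lam R = Xᵀ X R` times a weight (`integral_mul_gram_resolvent`). With the deviation of `tr R` as its
own weight it gives concentration of `tr R / d` at the root of `lam m² + (n/d - 1 + lam) m = 1`
(`integral_sq_stieltjes_sub_le`); with an entry of `R` it gives `E tr R² = O(d)`
(`integral_stieltjesSq_le`); with a power of `uᵀ R u` it gives moments of that quadratic form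
(`integral_quadForm_pow_le`). The coefficient `n/d - 1`, bounded away from zero, makes the constants
independent of `lam`; no bound on the smallest eigenvalue is needed.

Uniformity over `(0, lam₀]` comes from monotonicity of the ridge path. The distance to the solution
at `lam₀` grows as the regularization decreases, and its value at `lam` is bounded by the bias at
`lam₀` and a quadratic form in the noise of trace at most `tr R_lam - tr R_lam₀`, which is small
because both traces are near the same limit. So finitely many conditions at the two ends
(`IsTypical`) control the whole interval `[lam, lam₀]`. Their failure probability is bounded
independently of `lam`, and `lam` is sent to zero by continuity of the measure along increasing
unions (`measure_exists_reg_le`). -/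

namespace IsotropicGMM

/-! ### Gaussian integration by parts -/

theorem integral_id_mul_gaussianReal (v : ℝ≥0) {f f' : ℝ → ℝ}
    (hf : ∀ x, HasDerivAt f (f' x) x) (h₀ : Integrable f (gaussianReal 0 v))
    (h₁ : Integrable (fun x => x * f x) (gaussianReal 0 v))
    (h₂ : Integrable f' (gaussianReal 0 v)) :
    ∫ x, x * f x ∂(gaussianReal 0 v) = v * ∫ x, f' x ∂(gaussianReal 0 v) := by
  -- The degenerate law is the Dirac mass at zero, where both sides vanish; otherwise the law has a
  -- density and ordinary integration by parts applies.
  by_cases hv : v = 0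
  · subst hv
    simp [gaussianReal_zero_var]
  have hv' : (v : ℝ) ≠ 0 := by exact_mod_cast hv
  have key : ∀ g : ℝ → ℝ, Integrable g (gaussianReal 0 v) →
      Integrable (fun x => g x * gaussianPDFReal 0 v x) := by
    intro g hg
    rw [gaussianReal_of_var_ne_zero 0 hv,
      integrable_withDensity_iff_integrable_smul' (measurable_gaussianPDF 0 v)
        (ae_of_all _ fun _ => gaussianPDF_lt_top)] at hg
    refine hg.congr (ae_of_all _ fun x => ?_)
    simp [toReal_gaussianPDF, mul_comm]
  have hpdf : ∀ x, HasDerivAt (gaussianPDFReal 0 v) (-(x / v) * gaussianPDFReal 0 v x) x := by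
    intro x
    have h1 : HasDerivAt (fun x : ℝ => -(x - 0) ^ 2 / (2 * (v : ℝ))) (-(x / v)) x := by
      have := ((((hasDerivAt_id x).sub_const 0).pow 2).neg).div_const (2 * (v : ℝ))
      refine this.congr_deriv ?_
      simp only [id]
      field_simp
      ring
    have h2 := (h1.exp).const_mul ((√(2 * Real.pi * v))⁻¹)
    refine (h2.congr_of_eventuallyEq (Eventually.of_forall fun y => ?_)).congr_deriv ?_
    · simp [gaussianPDFReal]
    · simp only [gaussianPDFReal]
      ring
  have h := integral_mul_deriv_eq_deriv_mul_of_integrable (u := f) (u' := f')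
    (v := gaussianPDFReal 0 v) (v' := fun x => -(x / v) * gaussianPDFReal 0 v x)
    (fun x _ => hf x) (fun x _ => hpdf x)
    (((key _ h₁).const_mul (-(v : ℝ)⁻¹)).congr (ae_of_all _ fun x => by
      simp only [Pi.mul_apply]; field_simp)) (key _ h₂) (key _ h₀)
  rw [integral_gaussianReal_eq_integral_smul hv, integral_gaussianReal_eq_integral_smul hv]
  simp only [smul_eq_mul]
  have e1 : ∫ x, f x * (-(x / v) * gaussianPDFReal 0 v x) =
      -(v : ℝ)⁻¹ * ∫ x, gaussianPDFReal 0 v x * (x * f x) := by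
    rw [← integral_const_mul]
    congr 1; ext x; field_simp
  have e2 : ∫ x, gaussianPDFReal 0 v x * f' x = ∫ x, f' x * gaussianPDFReal 0 v x := by
    congr 1; ext x; ring
  rw [e1] at h
  rw [e2]
  rw [← neg_eq_iff_eq_neg, neg_mul, neg_neg, inv_mul_eq_iff_eq_mul₀ hv'] at h
  exact h

/-- Resampling one coordinate by an independent copy leaves a product law unchanged. This allows
Fubini in one coordinate without splitting the index type. -/
theorem map_update_pi {ι : Type*} [Fintype ι] [DecidableEq ι] {X : ι → Type*}
    [∀ i, MeasurableSpace (X i)] (μ : ∀ i, Measure (X i)) [∀ i, IsProbabilityMeasure (μ i)]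
    (i : ι) :
    ((Measure.pi μ).prod (μ i)).map
      (fun p : (∀ i, X i) × X i => Function.update p.1 i p.2) = Measure.pi μ := by
  have hm : Measurable (fun p : (∀ i, X i) × X i => Function.update p.1 i p.2) := by
    refine measurable_pi_lambda _ fun j => ?_
    by_cases h : j = i
    · subst h; simpa using measurable_snd
    · simp only [Function.update_of_ne h]; exact (measurable_pi_apply j).comp measurable_fst
  symm
  refine Measure.pi_eq fun s hs => ?_
  rw [Measure.map_apply hm (MeasurableSet.univ_pi hs)]
  have : (fun p : (∀ i, X i) × X i => Function.update p.1 i p.2) ⁻¹' (Set.univ.pi s) =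
      (Set.univ.pi (Function.update s i Set.univ)) ×ˢ s i := by
    ext p
    simp only [Set.mem_preimage, Set.mem_pi, Set.mem_univ, forall_const, Set.mem_prod]
    constructor
    · intro h
      refine ⟨fun j => ?_, by simpa using h i⟩
      by_cases hj : j = i
      · subst hj; simp
      · simpa [Function.update_of_ne hj] using h j
    · rintro ⟨h, h'⟩ j
      by_cases hj : j = i
      · subst hj; simpa using h'
      · simpa [Function.update_of_ne hj] using h j
  rw [this, Measure.prod_prod, Measure.pi_pi, ← Finset.mul_prod_erase _ _ (Finset.mem_univ i),
    ← Finset.mul_prod_erase (a := i) _ (fun j => μ j (s j)) (Finset.mem_univ i)]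
  simp only [Function.update_self, measure_univ, one_mul]
  rw [mul_comm]
  congr 1
  refine Finset.prod_congr rfl fun j hj => ?_
  rw [Function.update_of_ne (Finset.ne_of_mem_erase hj)]

/-- The law of independent centered Gaussian coordinates with variance `v`. -/
noncomputable abbrev gaussianPi (ι : Type*) [Fintype ι] (v : ℝ≥0) : Measure (ι → ℝ) :=
  Measure.pi fun _ => gaussianReal 0 v

/-- After resampling the `i`-th coordinate, Fubini reduces the claim to the one-dimensional formula
on almost every section, where the three integrability conditions are inherited. -/
theorem integral_eval_mul_gaussianPi {ι : Type*} [Fintype ι] [DecidableEq ι] (v : ℝ≥0) (i : ι)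
    {f f' : (ι → ℝ) → ℝ}
    (hf : ∀ x t, HasDerivAt (fun t => f (Function.update x i t)) (f' (Function.update x i t)) t)
    (h₀ : Integrable f (gaussianPi ι v))
    (h₁ : Integrable (fun x => x i * f x) (gaussianPi ι v))
    (h₂ : Integrable f' (gaussianPi ι v)) :
    ∫ x, x i * f x ∂(gaussianPi ι v) = v * ∫ x, f' x ∂(gaussianPi ι v) := by
  have hmap : ((gaussianPi ι v).prod (gaussianReal 0 v)).map
      (fun p : (ι → ℝ) × ℝ => Function.update p.1 i p.2) = gaussianPi ι v :=
    map_update_pi (fun _ : ι => gaussianReal 0 v) i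
  have hm : Measurable (fun p : (ι → ℝ) × ℝ => Function.update p.1 i p.2) := by
    refine measurable_pi_lambda _ fun j => ?_
    by_cases h : j = i
    · subst h; simpa using measurable_snd
    · simp only [Function.update_of_ne h]; exact (measurable_pi_apply j).comp measurable_fst
  have hi : ∀ g : (ι → ℝ) → ℝ, Integrable g (gaussianPi ι v) →
      Integrable (fun p : (ι → ℝ) × ℝ => g (Function.update p.1 i p.2))
        ((gaussianPi ι v).prod (gaussianReal 0 v)) := by
    intro g hg
    rw [← hmap] at hg
    exact hg.comp_measurable hm
  have he : ∀ g : (ι → ℝ) → ℝ, Integrable g (gaussianPi ι v) →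
      ∫ x, g x ∂(gaussianPi ι v) =
        ∫ x, ∫ t, g (Function.update x i t) ∂(gaussianReal 0 v) ∂(gaussianPi ι v) := by
    intro g hg
    rw [← integral_prod _ (hi g hg)]
    conv_lhs => rw [← hmap]
    rw [integral_map hm.aemeasurable]
    rw [hmap]; exact hg.aestronglyMeasurable
  rw [he _ h₁, he _ h₂, ← integral_const_mul]
  refine integral_congr_ae ?_
  filter_upwards [(hi _ h₀).prod_right_ae, (hi _ h₁).prod_right_ae, (hi _ h₂).prod_right_ae]
    with x a0 a1 a2
  simp only [Function.update_self] at a1 ⊢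
  exact integral_id_mul_gaussianReal v (hf x) a0 a1 a2

theorem integrable_norm_pow_gaussianPi {ι : Type*} [Fintype ι] (v : ℝ≥0) (k : ℕ) :
    Integrable (fun x : ι → ℝ => ‖x‖ ^ k) (gaussianPi ι v) := by
  have h1 : ∀ i, Integrable (fun x : ι → ℝ => |x i| ^ k) (gaussianPi ι v) := by
    intro i
    have : MemLp id (k : ℝ≥0∞) (gaussianReal 0 v) := IsGaussian.memLp_id _ _ (by simp)
    exact integrable_comp_eval (μ := fun _ : ι => gaussianReal 0 v) (i := i)
      (f := fun t : ℝ => |t| ^ k) (by simpa using this.integrable_norm_pow')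
  refine ((integrable_const 1).add (integrable_finsetSum Finset.univ fun i _ => h1 i)).mono'
    (by fun_prop) (ae_of_all _ fun x => ?_)
  have h0 : 0 ≤ ∑ i, |x i| ^ k := Finset.sum_nonneg fun i _ => by positivity
  simp only [Pi.add_apply, norm_pow, norm_norm]
  cases isEmpty_or_nonempty ι with
  | inl h =>
    have : x = 0 := Subsingleton.elim _ _
    have h2 : ‖x‖ ^ k ≤ 1 := pow_le_one₀ (norm_nonneg _) (by simp [this])
    linarith
  | inr h =>
    obtain ⟨i, hi⟩ := Finite.exists_max fun i => |x i|
    have h2 : ‖x‖ ≤ |x i| := (pi_norm_le_iff_of_nonneg (abs_nonneg _)).2 hi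
    have h3 : |x i| ^ k ≤ ∑ i, |x i| ^ k :=
      Finset.single_le_sum (f := fun i => |x i| ^ k) (fun i _ => by positivity) (Finset.mem_univ i)
    have h4 : ‖x‖ ^ k ≤ |x i| ^ k := by gcongr
    linarith

theorem integrable_gaussianPi_of_le {ι : Type*} [Fintype ι] (v : ℝ≥0) {f : (ι → ℝ) → ℝ}
    (hf : Continuous f) (C : ℝ) (k : ℕ) (h : ∀ x, |f x| ≤ C * (1 + ‖x‖ ^ k)) :
    Integrable f (gaussianPi ι v) :=
  (((integrable_const 1).add (integrable_norm_pow_gaussianPi v k)).const_mul C).mono'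
    hf.aestronglyMeasurable (ae_of_all _ fun x => by simpa using h x)

theorem integrable_gaussianPi_of_bounded {ι : Type*} [Fintype ι] (v : ℝ≥0) {f : (ι → ℝ) → ℝ}
    (hf : Continuous f) (C : ℝ) (h : ∀ x, |f x| ≤ C) : Integrable f (gaussianPi ι v) :=
  (integrable_const C).mono' hf.aestronglyMeasurable (ae_of_all _ fun x => by simpa using h x)

/-- Gaussian integration by parts for bounded functions with a bounded derivative. -/
theorem integral_eval_mul_gaussianPi_of_bounded {ι : Type*} [Fintype ι] [DecidableEq ι]
    (v : ℝ≥0) (i : ι) {f f' : (ι → ℝ) → ℝ}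
    (hf : ∀ x t, HasDerivAt (fun t => f (Function.update x i t)) (f' (Function.update x i t)) t)
    (hc : Continuous f) (hc' : Continuous f') (C C' : ℝ) (hC : ∀ x, |f x| ≤ C)
    (hC' : ∀ x, |f' x| ≤ C') :
    ∫ x, x i * f x ∂(gaussianPi ι v) = v * ∫ x, f' x ∂(gaussianPi ι v) := by
  refine integral_eval_mul_gaussianPi v i hf (integrable_gaussianPi_of_bounded v hc C hC)
    (integrable_gaussianPi_of_le v (by fun_prop) C 1 fun x => ?_)
    (integrable_gaussianPi_of_bounded v hc' C' hC')
  rw [abs_mul, pow_one, mul_comm]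
  have h1 : |x i| ≤ ‖x‖ := norm_le_pi_norm x i
  have h0 : 0 ≤ C := (abs_nonneg _).trans (hC x)
  calc |f x| * |x i| ≤ C * ‖x‖ := by gcongr; exact hC x
    _ ≤ C * (1 + ‖x‖) := by gcongr; linarith

end IsotropicGMM

namespace IsotropicGMM

open Matrix

/-! ### The resolvent of a Gram matrix -/

section Resolvent

set_option linter.unusedSectionVars false

variable {ι κ : Type*} [Fintype ι] [Fintype κ] [DecidableEq ι] [DecidableEq κ]

/-- The resolvent `(Xᵀ X + lam)⁻¹`. -/
noncomputable def resolvent (lam : ℝ) (X : Matrix ι κ ℝ) : Matrix κ κ ℝ :=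
  (Xᵀ * X + lam • (1 : Matrix κ κ ℝ))⁻¹

theorem isHermitian_gram (X : Matrix ι κ ℝ) : (Xᵀ * X).IsHermitian := by
  simpa using isHermitian_conjTranspose_mul_self X

/-- The eigenvalues of `Xᵀ X`. -/
noncomputable def gramEigenvalues (X : Matrix ι κ ℝ) : κ → ℝ := (isHermitian_gram X).eigenvalues

/-- The function `f` applied to the symmetric matrix `Xᵀ X`. -/
noncomputable def gramFn (X : Matrix ι κ ℝ) (f : ℝ → ℝ) : Matrix κ κ ℝ :=
  ((isHermitian_gram X).eigenvectorUnitary : Matrix κ κ ℝ) *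
    diagonal (fun i => f (gramEigenvalues X i)) *
      ((isHermitian_gram X).eigenvectorUnitary : Matrix κ κ ℝ)ᵀ

theorem gramEigenvalues_nonneg (X : Matrix ι κ ℝ) (i : κ) : 0 ≤ gramEigenvalues X i := by
  have h : (Xᵀ * X).PosSemidef := by
    simpa using posSemidef_conjTranspose_mul_self X
  exact h.eigenvalues_nonneg i

theorem eigenvectorUnitary_transpose_mul (X : Matrix ι κ ℝ) :
    ((isHermitian_gram X).eigenvectorUnitary : Matrix κ κ ℝ)ᵀ *
      ((isHermitian_gram X).eigenvectorUnitary : Matrix κ κ ℝ) = 1 := by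
  simpa [star_eq_conjTranspose] using
    Unitary.coe_star_mul_self (isHermitian_gram X).eigenvectorUnitary

theorem gramFn_mul (X : Matrix ι κ ℝ) (f g : ℝ → ℝ) :
    gramFn X f * gramFn X g = gramFn X (fun a => f a * g a) := by
  have h := eigenvectorUnitary_transpose_mul X
  unfold gramFn
  set U := ((isHermitian_gram X).eigenvectorUnitary : Matrix κ κ ℝ)
  calc _ = U * diagonal (fun i => f (gramEigenvalues X i)) * (Uᵀ * U) *
        diagonal (fun i => g (gramEigenvalues X i)) * Uᵀ := by simp only [Matrix.mul_assoc]
    _ = _ := by rw [h, Matrix.mul_one, Matrix.mul_assoc U, diagonal_mul_diagonal]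

theorem gramFn_add (X : Matrix ι κ ℝ) (f g : ℝ → ℝ) :
    gramFn X f + gramFn X g = gramFn X (fun a => f a + g a) := by
  unfold gramFn
  rw [← Matrix.add_mul, ← Matrix.mul_add, diagonal_add]

theorem gramFn_sub (X : Matrix ι κ ℝ) (f g : ℝ → ℝ) :
    gramFn X f - gramFn X g = gramFn X (fun a => f a - g a) := by
  unfold gramFn
  rw [← Matrix.sub_mul, ← Matrix.mul_sub, diagonal_sub]

theorem gramFn_smul (X : Matrix ι κ ℝ) (c : ℝ) (f : ℝ → ℝ) :
    c • gramFn X f = gramFn X (fun a => c * f a) := by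
  unfold gramFn
  rw [← Matrix.smul_mul, ← Matrix.mul_smul, ← diagonal_smul]
  rfl

theorem gramFn_one (X : Matrix ι κ ℝ) : gramFn X (fun _ => 1) = 1 := by
  have h := mul_eq_one_comm.1 (eigenvectorUnitary_transpose_mul X)
  unfold gramFn
  rw [diagonal_one, Matrix.mul_one, h]

theorem gramFn_id (X : Matrix ι κ ℝ) : gramFn X (fun a => a) = Xᵀ * X := by
  conv_rhs => rw [(isHermitian_gram X).spectral_theorem, Unitary.conjStarAlgAut_apply]
  rfl

/-- The eigenvalues of `Xᵀ X` are nonnegative, so identities between matrices built from `Xᵀ X`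
reduce to scalar identities on `0 ≤ a`, where `a + lam` cannot vanish. -/
theorem gramFn_congr (X : Matrix ι κ ℝ) {f g : ℝ → ℝ} (h : ∀ a, 0 ≤ a → f a = g a) :
    gramFn X f = gramFn X g := by
  unfold gramFn
  congr; ext i
  exact h _ (gramEigenvalues_nonneg X i)

theorem gramFn_transpose (X : Matrix ι κ ℝ) (f : ℝ → ℝ) : (gramFn X f)ᵀ = gramFn X f := by
  unfold gramFn
  simp [Matrix.mul_assoc]

theorem trace_gramFn (X : Matrix ι κ ℝ) (f : ℝ → ℝ) :
    (gramFn X f).trace = ∑ i, f (gramEigenvalues X i) := by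
  unfold gramFn
  rw [Matrix.mul_assoc, trace_mul_comm, Matrix.mul_assoc, eigenvectorUnitary_transpose_mul,
    Matrix.mul_one, trace_diagonal]

theorem trace_gramFn_mono (X : Matrix ι κ ℝ) {f g : ℝ → ℝ} (h : ∀ a, 0 ≤ a → f a ≤ g a) :
    (gramFn X f).trace ≤ (gramFn X g).trace := by
  rw [trace_gramFn, trace_gramFn]
  exact Finset.sum_le_sum fun i _ => h _ (gramEigenvalues_nonneg X i)

/-- In the eigenbasis the weights are squares, so pointwise inequalities between functions on `0 ≤
a` become inequalities between quadratic forms. -/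
theorem dotProduct_gramFn (X : Matrix ι κ ℝ) (f : ℝ → ℝ) (v : κ → ℝ) :
    v ⬝ᵥ (gramFn X f *ᵥ v) = ∑ i, f (gramEigenvalues X i) *
      ((((isHermitian_gram X).eigenvectorUnitary : Matrix κ κ ℝ)ᵀ *ᵥ v) i) ^ 2 := by
  unfold gramFn
  rw [← Matrix.mulVec_mulVec, ← Matrix.mulVec_mulVec, dotProduct_mulVec, ← mulVec_transpose]
  simp only [dotProduct, mulVec_diagonal]
  exact Finset.sum_congr rfl fun i _ => by ring

theorem dotProduct_gramFn_mono (X : Matrix ι κ ℝ) {f g : ℝ → ℝ} (h : ∀ a, 0 ≤ a → f a ≤ g a)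
    (v : κ → ℝ) : v ⬝ᵥ (gramFn X f *ᵥ v) ≤ v ⬝ᵥ (gramFn X g *ᵥ v) := by
  rw [dotProduct_gramFn, dotProduct_gramFn]
  refine Finset.sum_le_sum fun i _ => ?_
  gcongr
  exact h _ (gramEigenvalues_nonneg X i)

theorem gramFn_apply_self_mono (X : Matrix ι κ ℝ) {f g : ℝ → ℝ} (h : ∀ a, 0 ≤ a → f a ≤ g a)
    (j : κ) : gramFn X f j j ≤ gramFn X g j j := by
  simpa using dotProduct_gramFn_mono X h (Pi.single j 1)

theorem gramFn_const (X : Matrix ι κ ℝ) (c : ℝ) : gramFn X (fun _ => c) = c • 1 := by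
  rw [← gramFn_one X, gramFn_smul]; simp

theorem resolvent_eq_gramFn {lam : ℝ} (hlam : 0 < lam) (X : Matrix ι κ ℝ) :
    resolvent lam X = gramFn X (fun a => (a + lam)⁻¹) := by
  unfold resolvent
  refine inv_eq_right_inv ?_
  rw [← gramFn_id, ← gramFn_const X lam, gramFn_add, gramFn_mul, ← gramFn_one X]
  refine gramFn_congr X fun a ha => ?_
  have : a + lam ≠ 0 := by positivity
  field_simp

theorem gram_mul_resolvent {lam : ℝ} (hlam : 0 < lam) (X : Matrix ι κ ℝ) :
    Xᵀ * X * resolvent lam X = 1 - lam • resolvent lam X := by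
  rw [resolvent_eq_gramFn hlam, ← gramFn_id, gramFn_mul, ← gramFn_one X, gramFn_smul, gramFn_sub]
  refine gramFn_congr X fun a ha => ?_
  have : a + lam ≠ 0 := by positivity
  field_simp
  ring

theorem resolvent_transpose {lam : ℝ} (hlam : 0 < lam) (X : Matrix ι κ ℝ) :
    (resolvent lam X)ᵀ = resolvent lam X := by
  rw [resolvent_eq_gramFn hlam, gramFn_transpose]

theorem resolvent_apply_comm {lam : ℝ} (hlam : 0 < lam) (X : Matrix ι κ ℝ) (i j : κ) :
    resolvent lam X i j = resolvent lam X j i := by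
  conv_lhs => rw [← resolvent_transpose hlam, transpose_apply]

theorem isUnit_det_gram_add {lam : ℝ} (hlam : 0 < lam) (X : Matrix ι κ ℝ) :
    IsUnit (Xᵀ * X + lam • (1 : Matrix κ κ ℝ)).det := by
  have h : (Xᵀ * X).PosSemidef := by
    simpa using posSemidef_conjTranspose_mul_self X
  have h1 : (lam • (1 : Matrix κ κ ℝ)).PosDef := PosDef.one.smul hlam
  exact (h1.posSemidef_add h).det_pos.ne'.isUnit

theorem continuous_resolvent {lam : ℝ} (hlam : 0 < lam) :
    Continuous (fun X : Matrix ι κ ℝ => resolvent lam X) := by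
  have hA : Continuous (fun X : Matrix ι κ ℝ => Xᵀ * X + lam • (1 : Matrix κ κ ℝ)) := by fun_prop
  -- Cramer's formula: the adjugate and the determinant are continuous, and the determinant does not
  -- vanish.
  have h : (fun X : Matrix ι κ ℝ => resolvent lam X) = fun X : Matrix ι κ ℝ =>
      (Xᵀ * X + lam • (1 : Matrix κ κ ℝ)).det⁻¹ • (Xᵀ * X + lam • (1 : Matrix κ κ ℝ)).adjugate := by
    ext1 X
    rw [resolvent, Matrix.inv_def, Ring.inverse_eq_inv']
  rw [h]
  exact (hA.matrix_det.inv₀ fun X => (isUnit_det_gram_add hlam X).ne_zero).smul hA.matrix_adjugate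

theorem hasDerivAt_resolvent {lam : ℝ} (hlam : 0 < lam) {Y : ℝ → Matrix ι κ ℝ}
    {Y' : Matrix ι κ ℝ} {t : ℝ} (hY : ∀ ν j, HasDerivAt (fun s => Y s ν j) (Y' ν j) t) (k l : κ) :
    HasDerivAt (fun s => resolvent lam (Y s) k l)
      (-(resolvent lam (Y t) * (Y'ᵀ * Y t + (Y t)ᵀ * Y') * resolvent lam (Y t)) k l) t := by
  have hA : ∀ p q, HasDerivAt (fun s => ((Y s)ᵀ * Y s) p q) ((Y'ᵀ * Y t + (Y t)ᵀ * Y') p q) t := by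
    intro p q
    simp only [Matrix.add_apply, mul_apply, transpose_apply]
    rw [← Finset.sum_add_distrib]
    exact HasDerivAt.fun_sum fun ν _ => (hY ν p).fun_mul (hY ν q)
  have hYc : ContinuousAt Y t :=
    continuousAt_pi.2 fun ν => continuousAt_pi.2 fun j => (hY ν j).continuousAt
  have hR : ∀ p q, ContinuousAt (fun s => resolvent lam (Y s) p q) t := fun p q =>
    continuousAt_pi.1 (continuousAt_pi.1 ((continuous_resolvent hlam).continuousAt.comp hYc) p) q
  -- The resolvent identity. It turns difference quotients of the resolvent into those of the Gram
  -- matrix, so continuity of the resolvent is enough to pass to the limit.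
  have hdiff : ∀ s, resolvent lam (Y s) - resolvent lam (Y t) =
      -(resolvent lam (Y s) * ((Y s)ᵀ * Y s - (Y t)ᵀ * Y t) * resolvent lam (Y t)) := by
    intro s
    have h1 : resolvent lam (Y s) * ((Y s)ᵀ * Y s + lam • (1 : Matrix κ κ ℝ)) = 1 :=
      nonsing_inv_mul _ (isUnit_det_gram_add hlam _)
    have h2 : ((Y t)ᵀ * Y t + lam • (1 : Matrix κ κ ℝ)) * resolvent lam (Y t) = 1 :=
      mul_nonsing_inv _ (isUnit_det_gram_add hlam _)
    have h3 : (Y s)ᵀ * Y s - (Y t)ᵀ * Y t = ((Y s)ᵀ * Y s + lam • (1 : Matrix κ κ ℝ)) -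
      ((Y t)ᵀ * Y t + lam • (1 : Matrix κ κ ℝ)) := by abel
    rw [h3, Matrix.mul_sub, Matrix.sub_mul, h1, Matrix.one_mul, Matrix.mul_assoc, h2,
      Matrix.mul_one]
    abel
  rw [hasDerivAt_iff_tendsto_slope]
  have hslope : ∀ s, slope (fun s => resolvent lam (Y s) k l) t s =
      -∑ q, (∑ p, resolvent lam (Y s) k p * slope (fun s => ((Y s)ᵀ * Y s) p q) t s) *
        resolvent lam (Y t) q l := by
    intro s
    have h := congrFun (congrFun (hdiff s) k) l
    simp only [slope_def_field]
    simp only [Matrix.sub_apply, Matrix.neg_apply, Matrix.mul_apply (M := _ * _)] at h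
    rw [h, neg_div, Finset.sum_div]
    congr 1
    refine Finset.sum_congr rfl fun q _ => ?_
    rw [mul_div_right_comm, Matrix.mul_apply, Finset.sum_div]
    congr 1
    exact Finset.sum_congr rfl fun p _ => by rw [Matrix.sub_apply, mul_div_assoc]
  rw [funext hslope]
  have htgt : (resolvent lam (Y t) * (Y'ᵀ * Y t + (Y t)ᵀ * Y') * resolvent lam (Y t)) k l =
      ∑ q, (∑ p, resolvent lam (Y t) k p * (Y'ᵀ * Y t + (Y t)ᵀ * Y') p q) *
        resolvent lam (Y t) q l := by
    rw [Matrix.mul_apply]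
    rfl
  rw [htgt]
  refine (tendsto_finsetSum _ fun q _ => (tendsto_finsetSum _ fun p _ => ?_).mul_const _).neg
  exact ((hR k p).tendsto.mono_left nhdsWithin_le_nhds).mul
    (hasDerivAt_iff_tendsto_slope.1 (hA p q))

/-- The derivative of the resolvent in the direction of a single entry of `X`. -/
theorem hasDerivAt_resolvent_single {lam : ℝ} (hlam : 0 < lam) {Y : ℝ → Matrix ι κ ℝ}
    {σ : ℝ} {ν : ι} {i : κ} {t : ℝ}
    (hY : ∀ ν' j, HasDerivAt (fun s => Y s ν' j) (Matrix.single ν i σ ν' j) t) (k l : κ) :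
    HasDerivAt (fun s => resolvent lam (Y s) k l)
      (-σ * (resolvent lam (Y t) k i * (Y t * resolvent lam (Y t)) ν l +
        (Y t * resolvent lam (Y t)) ν k * resolvent lam (Y t) i l)) t := by
  refine (hasDerivAt_resolvent hlam hY k l).congr_deriv ?_
  set R := resolvent lam (Y t) with hR
  have hRt : Rᵀ = R := resolvent_transpose hlam _
  have h1 : R * ((Matrix.single ν i σ)ᵀ * Y t + (Y t)ᵀ * Matrix.single ν i σ) * R =
      R * Matrix.single i ν σ * (Y t * R) + (Y t * R)ᵀ * (Matrix.single ν i σ * R) := by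
    rw [transpose_single, transpose_mul, hRt]
    simp only [Matrix.mul_add, Matrix.add_mul, Matrix.mul_assoc]
  rw [h1, Matrix.add_apply, mul_apply (M := R * _), mul_apply (M := (Y t * R)ᵀ)]
  rw [Finset.sum_eq_single ν (fun b _ hb => by rw [mul_single_apply_of_ne _ _ _ _ _ hb, zero_mul])
      (by simp),
    Finset.sum_eq_single ν (fun b _ hb => by rw [single_mul_apply_of_ne _ _ _ _ _ hb, mul_zero])
      (by simp), mul_single_apply_same, single_mul_apply_same, transpose_apply]
  ring

/-- The product rule for row `ν` of `X R`, differentiated in an entry of that same row. These are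
the terms that integration by parts produces; summed over `ν` they become functions of `R` and its
trace. -/
theorem hasDerivAt_mul_resolvent_single {lam : ℝ} (hlam : 0 < lam) {Y : ℝ → Matrix ι κ ℝ}
    {σ : ℝ} {ν : ι} {i : κ} {t : ℝ}
    (hY : ∀ ν' j, HasDerivAt (fun s => Y s ν' j) (Matrix.single ν i σ ν' j) t) (j : κ) :
    HasDerivAt (fun s => (Y s * resolvent lam (Y s)) ν j)
      (σ * (resolvent lam (Y t) i j -
        (Y t * resolvent lam (Y t)) ν i * (Y t * resolvent lam (Y t)) ν j -
        (Y t * resolvent lam (Y t) * (Y t)ᵀ) ν ν * resolvent lam (Y t) i j)) t := by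
  have h := HasDerivAt.fun_sum (u := Finset.univ) fun k _ =>
    (hY ν k).mul (hasDerivAt_resolvent_single hlam hY k j)
  refine (h.congr_of_eventuallyEq (Eventually.of_forall fun s => ?_)).congr_deriv ?_
  · simp [mul_apply]
  · set R := resolvent lam (Y t) with hR
    rw [Finset.sum_add_distrib]
    have e1 : ∑ k, Matrix.single ν i σ ν k * R k j = σ * R i j := by
      rw [Finset.sum_eq_single i (by intro b _ hb; simp [hb.symm]) (by simp)]
      simp
    have e2 : ∑ k, Y t ν k * (-σ * (R k i * (Y t * R) ν j + (Y t * R) ν k * R i j)) =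
        -σ * ((∑ k, Y t ν k * R k i) * (Y t * R) ν j + (∑ k, (Y t * R) ν k * Y t ν k) * R i j) := by
      rw [Finset.sum_mul, Finset.sum_mul, ← Finset.sum_add_distrib, Finset.mul_sum]
      exact Finset.sum_congr rfl fun k _ => by ring
    rw [e1, e2, ← Matrix.mul_apply]
    have e3 : ∑ k, (Y t * R) ν k * Y t ν k = (Y t * R * (Y t)ᵀ) ν ν := by
      rw [Matrix.mul_apply (M := Y t * R)]; rfl
    rw [e3]
    ring

end Resolvent

end IsotropicGMM

namespace IsotropicGMM

open Matrix

section Bounds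

set_option linter.unusedSectionVars false

variable {ι κ : Type*} [Fintype ι] [Fintype κ] [DecidableEq ι] [DecidableEq κ]
  {lam : ℝ} (hlam : 0 < lam) (X : Matrix ι κ ℝ)

/-! ### Bounds and trace identities for the resolvent -/

theorem mul_gramFn_transpose_mul (f g : ℝ → ℝ) :
    (X * gramFn X f)ᵀ * (X * gramFn X g) = gramFn X (fun a => f a * a * g a) := by
  rw [transpose_mul, gramFn_transpose]
  calc gramFn X f * Xᵀ * (X * gramFn X g) = gramFn X f * (Xᵀ * X) * gramFn X g := by
        simp only [Matrix.mul_assoc]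
    _ = _ := by rw [← gramFn_id, gramFn_mul, gramFn_mul]

include hlam in
theorem resolvent_sq_eq_gramFn :
    resolvent lam X * resolvent lam X = gramFn X (fun a => (a + lam)⁻¹ * (a + lam)⁻¹) := by
  rw [resolvent_eq_gramFn hlam, gramFn_mul]

include hlam in
theorem resolvent_cube_eq_gramFn :
    resolvent lam X * resolvent lam X * resolvent lam X =
      gramFn X (fun a => (a + lam)⁻¹ * (a + lam)⁻¹ * (a + lam)⁻¹) := by
  rw [resolvent_eq_gramFn hlam, gramFn_mul, gramFn_mul]

include hlam in
theorem abs_resolvent_apply_le (i j : κ) : |resolvent lam X i j| ≤ lam⁻¹ := by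
  -- Since `R` is symmetric, this diagonal entry is the squared norm of column `j` and dominates the
  -- square of each entry of the column.
  have h : (resolvent lam X * resolvent lam X) j j ≤ lam⁻¹ ^ 2 := by
    have := gramFn_apply_self_mono X (f := fun a => (a + lam)⁻¹ * (a + lam)⁻¹)
      (g := fun _ => lam⁻¹ ^ 2) (fun a ha => by
        rw [pow_two]
        have : (a + lam)⁻¹ ≤ lam⁻¹ := by gcongr; linarith
        have : 0 ≤ (a + lam)⁻¹ := by positivity
        gcongr) j
    rw [resolvent_sq_eq_gramFn hlam]
    simpa [gramFn_const] using this
  rw [Matrix.mul_apply] at h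
  have h2 : resolvent lam X i j ^ 2 ≤ ∑ k, resolvent lam X j k * resolvent lam X k j := by
    have : ∀ k, resolvent lam X j k * resolvent lam X k j = resolvent lam X k j ^ 2 := fun k => by
      rw [resolvent_apply_comm hlam X j k, pow_two]
    simp only [this]
    exact Finset.single_le_sum (f := fun k => resolvent lam X k j ^ 2)
      (fun k _ => sq_nonneg _) (Finset.mem_univ i)
  exact abs_le_of_sq_le_sq (h2.trans h) (by positivity)

include hlam in
theorem mul_resolvent_transpose_mul :
    (X * resolvent lam X)ᵀ * (X * resolvent lam X) =
      resolvent lam X - lam • (resolvent lam X * resolvent lam X) := by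
  rw [resolvent_eq_gramFn hlam, mul_gramFn_transpose_mul, gramFn_mul, gramFn_smul, gramFn_sub]
  refine gramFn_congr X fun a ha => ?_
  have : a + lam ≠ 0 := by positivity
  field_simp
  ring

include hlam in
theorem mul_resolvent_transpose_mul_sq :
    (X * resolvent lam X)ᵀ * (X * (resolvent lam X * resolvent lam X)) =
      resolvent lam X * resolvent lam X -
        lam • (resolvent lam X * resolvent lam X * resolvent lam X) := by
  rw [resolvent_eq_gramFn hlam, gramFn_mul, mul_gramFn_transpose_mul, gramFn_mul, gramFn_smul,
    gramFn_sub]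
  refine gramFn_congr X fun a ha => ?_
  have : a + lam ≠ 0 := by positivity
  field_simp
  ring

include hlam in
theorem sq_mul_resolvent_apply_le (ν : ι) (j : κ) :
    (X * resolvent lam X) ν j ^ 2 ≤ lam⁻¹ := by
  have h : ((X * resolvent lam X)ᵀ * (X * resolvent lam X)) j j ≤ lam⁻¹ := by
    have := gramFn_apply_self_mono X (f := fun a => (a + lam)⁻¹ * a * (a + lam)⁻¹)
      (g := fun _ => lam⁻¹) (fun a ha => by
        have h1 : (a + lam)⁻¹ ≤ lam⁻¹ := by gcongr; linarith
        have h2 : (a + lam)⁻¹ * a ≤ 1 := by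
          rw [inv_mul_le_iff₀ (by positivity)]; linarith
        calc (a + lam)⁻¹ * a * (a + lam)⁻¹ ≤ 1 * lam⁻¹ := by
              gcongr
          _ = _ := one_mul _) j
    rw [resolvent_eq_gramFn hlam, mul_gramFn_transpose_mul]
    simpa [gramFn_const] using this
  rw [Matrix.mul_apply] at h
  refine le_trans ?_ h
  simp only [transpose_apply, ← pow_two]
  exact Finset.single_le_sum (f := fun k => (X * resolvent lam X) k j ^ 2)
      (fun k _ => sq_nonneg _) (Finset.mem_univ ν)

include hlam in
theorem abs_mul_resolvent_apply_le (ν : ι) (j : κ) :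
    |(X * resolvent lam X) ν j| ≤ √(lam⁻¹) :=
  Real.abs_le_sqrt (sq_mul_resolvent_apply_le hlam X ν j)

include hlam in
theorem hat_sq : (X * resolvent lam X * Xᵀ) * (X * resolvent lam X * Xᵀ) =
    X * resolvent lam X * Xᵀ - lam • ((X * resolvent lam X) * (X * resolvent lam X)ᵀ) := by
  have h := gram_mul_resolvent hlam X
  calc (X * resolvent lam X * Xᵀ) * (X * resolvent lam X * Xᵀ)
      = X * resolvent lam X * (Xᵀ * X * resolvent lam X) * Xᵀ := by simp only [Matrix.mul_assoc]
    _ = _ := by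
      rw [h, Matrix.mul_sub, Matrix.sub_mul, Matrix.mul_one, transpose_mul,
        resolvent_transpose hlam]
      simp only [Matrix.mul_smul, Matrix.smul_mul, Matrix.mul_assoc]

include hlam in
theorem hat_transpose : (X * resolvent lam X * Xᵀ)ᵀ = X * resolvent lam X * Xᵀ := by
  rw [transpose_mul, transpose_mul, transpose_transpose, resolvent_transpose hlam,
    Matrix.mul_assoc]

include hlam in
-- The hat matrix `B` satisfies `B² = B - lam (X R)(X R)ᵀ`, so `B ν ν ^ 2 ≤ (B²) ν ν ≤ B ν ν`, which
-- forces `B ν ν` into `[0, 1]`.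
theorem abs_hat_apply_self_le (ν : ι) : |(X * resolvent lam X * Xᵀ) ν ν| ≤ 1 := by
  set B := X * resolvent lam X * Xᵀ with hB
  have h := congrFun (congrFun (hat_sq hlam X) ν) ν
  rw [← hB, Matrix.sub_apply, Matrix.smul_apply, Matrix.mul_apply, Matrix.mul_apply] at h
  have h1 : B ν ν ^ 2 ≤ ∑ k, B ν k * B k ν := by
    have : ∀ k, B ν k * B k ν = B ν k ^ 2 := fun k => by
      have hk : B k ν = B ν k := congrFun (congrFun (hat_transpose hlam X) ν) k
      rw [hk, pow_two]
    simp only [this]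
    exact Finset.single_le_sum (f := fun k => B ν k ^ 2) (fun k _ => sq_nonneg _)
      (Finset.mem_univ ν)
  have h2 : 0 ≤ lam • ∑ j, (X * resolvent lam X) ν j * (X * resolvent lam X)ᵀ j ν := by
    refine smul_nonneg hlam.le (Finset.sum_nonneg fun j _ => ?_)
    rw [transpose_apply]; exact mul_self_nonneg _
  have h3 : B ν ν ^ 2 ≤ B ν ν := by linarith
  rw [abs_le]; constructor <;> nlinarith

include hlam in
theorem sum_hat_apply_self : ∑ ν, (X * resolvent lam X * Xᵀ) ν ν =
    Fintype.card κ - lam * (resolvent lam X).trace := by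
  have : ∑ ν, (X * resolvent lam X * Xᵀ) ν ν = (X * resolvent lam X * Xᵀ).trace := rfl
  rw [this, trace_mul_comm, ← Matrix.mul_assoc, gram_mul_resolvent hlam, trace_sub, trace_one,
    trace_smul, smul_eq_mul]

end Bounds

/-! ### Bounded continuous integrands -/

/-- `f` is continuous and bounded. -/
def IsBddCont {E : Type*} [TopologicalSpace E] (f : E → ℝ) : Prop :=
  Continuous f ∧ ∃ C, ∀ x, |f x| ≤ C

namespace IsBddCont

variable {E : Type*} [TopologicalSpace E] {f g : E → ℝ}

theorem const (c : ℝ) : IsBddCont (fun _ : E => c) := ⟨continuous_const, |c|, fun _ => le_rfl⟩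

theorem add (hf : IsBddCont f) (hg : IsBddCont g) : IsBddCont (fun x => f x + g x) := by
  obtain ⟨hf, C, hC⟩ := hf
  obtain ⟨hg, D, hD⟩ := hg
  exact ⟨hf.add hg, C + D, fun x => (abs_add_le _ _).trans (add_le_add (hC x) (hD x))⟩

theorem mul (hf : IsBddCont f) (hg : IsBddCont g) : IsBddCont (fun x => f x * g x) := by
  obtain ⟨hf, C, hC⟩ := hf
  obtain ⟨hg, D, hD⟩ := hg
  refine ⟨hf.mul hg, C * D, fun x => ?_⟩
  rw [abs_mul]
  exact mul_le_mul (hC x) (hD x) (abs_nonneg _) ((abs_nonneg _).trans (hC x))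

theorem const_mul (c : ℝ) (hf : IsBddCont f) : IsBddCont (fun x => c * f x) := (const c).mul hf

theorem neg (hf : IsBddCont f) : IsBddCont (fun x => -f x) := by
  simpa using hf.const_mul (-1)

theorem sub (hf : IsBddCont f) (hg : IsBddCont g) : IsBddCont (fun x => f x - g x) := by
  simpa [sub_eq_add_neg] using hf.add hg.neg

theorem pow (hf : IsBddCont f) (k : ℕ) : IsBddCont (fun x => f x ^ k) := by
  induction k with
  | zero => simpa using const 1
  | succ k ih => simpa [pow_succ] using ih.mul hf

theorem sum {α : Type*} (s : Finset α) {F : α → E → ℝ} (h : ∀ a ∈ s, IsBddCont (F a)) :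
    IsBddCont (fun x => ∑ a ∈ s, F a x) := by
  classical
  induction s using Finset.induction_on with
  | empty => simpa using const 0
  | insert a s ha ih =>
    simp only [Finset.sum_insert ha]
    exact (h a (Finset.mem_insert_self _ _)).add
      (ih fun b hb => h b (Finset.mem_insert_of_mem hb))

/-- The entrywise resolvent bounds in powers of `lam⁻¹` enter only through integrability; their size
never reaches an estimate. -/
theorem integrable [MeasurableSpace E] [OpensMeasurableSpace E] [SecondCountableTopology E]
    {P : Measure E} [IsFiniteMeasure P] (hf : IsBddCont f) : Integrable f P := by
  obtain ⟨hf, C, hC⟩ := hf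
  exact (integrable_const C).mono' hf.aestronglyMeasurable (ae_of_all _ fun x => by simpa using hC x)

end IsBddCont

/-! ### The Stein identity for the resolvent -/

section Stein

set_option linter.unusedSectionVars false

variable {ι κ : Type*} [Fintype ι] [Fintype κ] [DecidableEq ι] [DecidableEq κ]

/-- The matrix `σ G + N`. -/
def signalPlusNoise (σ : ℝ) (N : Matrix ι κ ℝ) (G : ι × κ → ℝ) : Matrix ι κ ℝ :=
  of fun ν j => σ * G (ν, j) + N ν j

theorem continuous_signalPlusNoise (σ : ℝ) (N : Matrix ι κ ℝ) :
    Continuous (signalPlusNoise σ N) := by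
  refine continuous_pi fun ν => continuous_pi fun j => ?_
  simp only [signalPlusNoise, of_apply]
  fun_prop

theorem hasDerivAt_signalPlusNoise (σ : ℝ) (N : Matrix ι κ ℝ) (G : ι × κ → ℝ) (ν : ι) (i : κ)
    (t : ℝ) (ν' : ι) (j : κ) :
    HasDerivAt (fun s => signalPlusNoise σ N (Function.update G (ν, i) s) ν' j)
      (Matrix.single ν i σ ν' j) t := by
  simp only [signalPlusNoise, of_apply]
  by_cases h : ν' = ν ∧ j = i
  · obtain ⟨rfl, rfl⟩ := h
    simpa using ((hasDerivAt_id t).const_mul σ).add_const (N ν' j)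
  · have h1 : (ν', j) ≠ (ν, i) := fun h' => h ⟨congrArg Prod.fst h', congrArg Prod.snd h'⟩
    rw [single_apply_of_ne _ _ _ _ _ (fun h' => h ⟨h'.1.symm, h'.2.symm⟩)]
    simp only [Function.update_of_ne h1]
    exact hasDerivAt_const _ _

variable {lam : ℝ} (hlam : 0 < lam) (σ : ℝ) (N : Matrix ι κ ℝ)

include hlam

theorem isBddCont_resolvent (i j : κ) :
    IsBddCont (fun G => resolvent lam (signalPlusNoise σ N G) i j) :=
  ⟨((continuous_resolvent hlam).comp (continuous_signalPlusNoise σ N)).matrix_elem i j, lam⁻¹,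
    fun _ => abs_resolvent_apply_le hlam _ i j⟩

theorem isBddCont_mul_resolvent (ν : ι) (j : κ) :
    IsBddCont (fun G => (signalPlusNoise σ N G * resolvent lam (signalPlusNoise σ N G)) ν j) :=
  ⟨((continuous_signalPlusNoise σ N).matrix_mul
      ((continuous_resolvent hlam).comp (continuous_signalPlusNoise σ N))).matrix_elem ν j,
    √(lam⁻¹), fun _ => abs_mul_resolvent_apply_le hlam _ ν j⟩

theorem isBddCont_hat (ν : ι) :
    IsBddCont (fun G => (signalPlusNoise σ N G * resolvent lam (signalPlusNoise σ N G) *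
      (signalPlusNoise σ N G)ᵀ) ν ν) :=
  ⟨(((continuous_signalPlusNoise σ N).matrix_mul
      ((continuous_resolvent hlam).comp (continuous_signalPlusNoise σ N))).matrix_mul
        (continuous_signalPlusNoise σ N).matrix_transpose).matrix_elem ν ν,
    1, fun _ => abs_hat_apply_self_le hlam _ ν⟩

/-- Gaussian integration by parts for an entry of `Xᵀ X (Xᵀ X + lam)⁻¹`, `X = σ G + N`, weighted
by a function `φ` of `G` with partial derivatives `D`. -/
theorem integral_mul_gram_resolvent (i j : κ) {φ : (ι × κ → ℝ) → ℝ} {D : ι → (ι × κ → ℝ) → ℝ}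
    (hφ : IsBddCont φ) (hD : ∀ ν, IsBddCont (D ν))
    (hd : ∀ ν G t, HasDerivAt (fun s => φ (Function.update G (ν, i) s))
      (D ν (Function.update G (ν, i) t)) t) :
    ∫ G, φ G * ((1 - lam • resolvent lam (signalPlusNoise σ N G)) i j) ∂(gaussianPi (ι × κ) 1) =
      ∫ G, (σ ^ 2 * (φ G * (Fintype.card ι * resolvent lam (signalPlusNoise σ N G) i j -
          (resolvent lam (signalPlusNoise σ N G) - lam • (resolvent lam (signalPlusNoise σ N G) *
            resolvent lam (signalPlusNoise σ N G))) i j -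
          (Fintype.card κ - lam * (resolvent lam (signalPlusNoise σ N G)).trace) *
            resolvent lam (signalPlusNoise σ N G) i j)) +
        φ G * (Nᵀ * (signalPlusNoise σ N G * resolvent lam (signalPlusNoise σ N G))) i j +
        σ * ∑ ν, (signalPlusNoise σ N G * resolvent lam (signalPlusNoise σ N G)) ν j * D ν G)
          ∂(gaussianPi (ι × κ) 1) := by
  set X := signalPlusNoise σ N with hX
  set R := fun G => resolvent lam (X G) with hR
  have hRb : ∀ i j, IsBddCont (fun G => R G i j) := isBddCont_resolvent hlam σ N
  have hXRb : ∀ ν j, IsBddCont (fun G => (X G * R G) ν j) := isBddCont_mul_resolvent hlam σ N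
  have hHb : ∀ ν, IsBddCont (fun G => (X G * R G * (X G)ᵀ) ν ν) := isBddCont_hat hlam σ N
  -- Integration by parts in the single variable `G (ν, i)`, with integrand `φ` times the entry `(ν,
  -- j)` of `X R`.
  have hstein : ∀ ν, ∫ G, G (ν, i) * (φ G * (X G * R G) ν j) ∂(gaussianPi (ι × κ) 1) =
      ∫ G, (D ν G * (X G * R G) ν j + φ G * (σ * (R G i j - (X G * R G) ν i * (X G * R G) ν j -
        (X G * R G * (X G)ᵀ) ν ν * R G i j))) ∂(gaussianPi (ι × κ) 1) := by
    intro ν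
    have hb : IsBddCont (fun G => φ G * (X G * R G) ν j) := hφ.mul (hXRb ν j)
    have hb' : IsBddCont (fun G => D ν G * (X G * R G) ν j + φ G * (σ * (R G i j -
        (X G * R G) ν i * (X G * R G) ν j - (X G * R G * (X G)ᵀ) ν ν * R G i j))) :=
      ((hD ν).mul (hXRb ν j)).add (hφ.mul ((((hRb i j).sub ((hXRb ν i).mul (hXRb ν j))).sub
        ((hHb ν).mul (hRb i j))).const_mul σ))
    obtain ⟨hc, C, hC⟩ := hb
    obtain ⟨hc', C', hC'⟩ := hb'
    have := integral_eval_mul_gaussianPi_of_bounded 1 (ν, i) (fun G t => ?_) hc hc' C C' hC hC'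
    · simpa using this
    · exact (hd ν G t).fun_mul (hasDerivAt_mul_resolvent_single hlam
        (hasDerivAt_signalPlusNoise σ N G ν i t) j)
  -- By `Xᵀ X R = 1 - lam R`, the left side is a sum of `X ν i * (X R) ν j`; the factor `X ν i`
  -- splits into its Gaussian part and its mean.
  have hexp : ∀ G, φ G * ((1 - lam • R G) i j) =
      σ * ∑ ν, G (ν, i) * (φ G * (X G * R G) ν j) +
        φ G * (Nᵀ * (X G * R G)) i j := by
    intro G
    have h1 : (1 - lam • R G) i j = ∑ ν, (σ * G (ν, i) + N ν i) * (X G * R G) ν j := by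
      rw [← gram_mul_resolvent hlam, Matrix.mul_assoc, Matrix.mul_apply]
      rfl
    rw [h1, Matrix.mul_apply, Finset.mul_sum, Finset.mul_sum, Finset.mul_sum,
      ← Finset.sum_add_distrib]
    refine Finset.sum_congr rfl fun ν _ => ?_
    rw [transpose_apply]
    ring
  have hint : ∀ ν, Integrable (fun G : ι × κ → ℝ => G (ν, i) * (φ G * (X G * R G) ν j))
      (gaussianPi (ι × κ) 1) := by
    intro ν
    obtain ⟨hc, C, hC⟩ := hφ.mul (hXRb ν j)
    refine integrable_gaussianPi_of_le 1 (by fun_prop) C 1 fun G => ?_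
    rw [abs_mul, pow_one, mul_comm]
    have h1 : |G (ν, i)| ≤ ‖G‖ := norm_le_pi_norm G (ν, i)
    have h0 : 0 ≤ C := (abs_nonneg _).trans (hC G)
    calc |φ G * (X G * R G) ν j| * |G (ν, i)| ≤ C * ‖G‖ := by gcongr; exact hC G
      _ ≤ C * (1 + ‖G‖) := by gcongr; linarith
  have hNb : IsBddCont (fun G => φ G * (Nᵀ * (X G * R G)) i j) := by
    simp only [Matrix.mul_apply (M := Nᵀ)]
    exact hφ.mul (IsBddCont.sum _ fun ν _ => (hXRb ν j).const_mul _)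
  have hSb : ∀ ν, IsBddCont (fun G => D ν G * (X G * R G) ν j + φ G * (σ * (R G i j -
        (X G * R G) ν i * (X G * R G) ν j - (X G * R G * (X G)ᵀ) ν ν * R G i j))) := fun ν =>
      ((hD ν).mul (hXRb ν j)).add (hφ.mul ((((hRb i j).sub ((hXRb ν i).mul (hXRb ν j))).sub
        ((hHb ν).mul (hRb i j))).const_mul σ))
  calc ∫ G, φ G * ((1 - lam • R G) i j) ∂(gaussianPi (ι × κ) 1)
      = σ * ∑ ν, ∫ G, G (ν, i) * (φ G * (X G * R G) ν j) ∂(gaussianPi (ι × κ) 1) +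
        ∫ G, φ G * (Nᵀ * (X G * R G)) i j ∂(gaussianPi (ι × κ) 1) := by
        rw [integral_congr_ae (ae_of_all _ hexp),
          integral_add ((integrable_finsetSum _ fun ν _ => hint ν).const_mul σ) hNb.integrable,
          integral_const_mul, integral_finsetSum _ fun ν _ => hint ν]
    _ = ∫ G, (σ * ∑ ν, (D ν G * (X G * R G) ν j + φ G * (σ * (R G i j -
        (X G * R G) ν i * (X G * R G) ν j - (X G * R G * (X G)ᵀ) ν ν * R G i j))) +
        φ G * (Nᵀ * (X G * R G)) i j) ∂(gaussianPi (ι × κ) 1) := by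
        rw [integral_add ((IsBddCont.sum _ fun ν _ => hSb ν).const_mul σ).integrable
          hNb.integrable, integral_const_mul,
          integral_finsetSum _ fun ν _ => (hSb ν).integrable]
        simp only [hstein]
    _ = _ := by
        refine integral_congr_ae (ae_of_all _ fun G => ?_)
        simp only
        have h1 : ∑ ν, (X G * R G) ν i * (X G * R G) ν j = (R G - lam • (R G * R G)) i j := by
          rw [← mul_resolvent_transpose_mul hlam, Matrix.mul_apply]
          rfl
        have h2 : ∑ ν, (X G * R G * (X G)ᵀ) ν ν = Fintype.card κ - lam * (R G).trace :=
          sum_hat_apply_self hlam (X G)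
        -- Summation over rows closes the expression: the constant term counts rows, the products
        -- give `(X R)ᵀ (X R) = R - lam R²`, and the diagonal of the hat matrix gives `card κ - lam
        -- tr R`.
        have h3 : ∑ ν, (D ν G * (X G * R G) ν j + φ G * (σ * (R G i j -
            (X G * R G) ν i * (X G * R G) ν j - (X G * R G * (X G)ᵀ) ν ν * R G i j))) =
            ∑ ν, (X G * R G) ν j * D ν G + φ G * σ * (Fintype.card ι * R G i j -
              ∑ ν, (X G * R G) ν i * (X G * R G) ν j -
              (∑ ν, (X G * R G * (X G)ᵀ) ν ν) * R G i j) := by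
          rw [Finset.sum_add_distrib, ← Finset.mul_sum, ← Finset.mul_sum,
            Finset.sum_sub_distrib, Finset.sum_sub_distrib, Finset.sum_const, Finset.card_univ,
            nsmul_eq_mul, Finset.sum_mul]
          congr 1
          · exact Finset.sum_congr rfl fun ν _ => mul_comm _ _
          · ring
        rw [h3, h1, h2]
        ring

end Stein

end IsotropicGMM

namespace IsotropicGMM

open Matrix

/-! ### Stein identities for the trace, for quadratic forms and for the squared resolvent -/

section SteinConsequences

set_option linter.unusedSectionVars false

variable {ι κ : Type*} [Fintype ι] [Fintype κ] [DecidableEq ι] [DecidableEq κ]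
  {lam : ℝ} (hlam : 0 < lam) (σ : ℝ) (N : Matrix ι κ ℝ)

include hlam

theorem isBddCont_trace_resolvent :
    IsBddCont (fun G => (resolvent lam (signalPlusNoise σ N G)).trace) :=
  IsBddCont.sum _ fun i _ => isBddCont_resolvent hlam σ N i i

theorem isBddCont_resolvent_sq (i j : κ) :
    IsBddCont (fun G => (resolvent lam (signalPlusNoise σ N G) *
      resolvent lam (signalPlusNoise σ N G)) i j) := by
  simp only [Matrix.mul_apply]
  exact IsBddCont.sum _ fun k _ =>
    (isBddCont_resolvent hlam σ N i k).mul (isBddCont_resolvent hlam σ N k j)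

theorem isBddCont_trace_resolvent_sq :
    IsBddCont (fun G => (resolvent lam (signalPlusNoise σ N G) *
      resolvent lam (signalPlusNoise σ N G)).trace) :=
  IsBddCont.sum _ fun i _ => isBddCont_resolvent_sq hlam σ N i i

theorem isBddCont_trace_resolvent_cube :
    IsBddCont (fun G => (resolvent lam (signalPlusNoise σ N G) *
      resolvent lam (signalPlusNoise σ N G) * resolvent lam (signalPlusNoise σ N G)).trace) := by
  refine IsBddCont.sum _ fun i _ => ?_
  simp only [diag_apply, Matrix.mul_apply (M := _ * _)]
  exact IsBddCont.sum _ fun k _ =>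
    (isBddCont_resolvent_sq hlam σ N i k).mul (isBddCont_resolvent hlam σ N k i)

theorem isBddCont_mul_resolvent_sq (ν : ι) (j : κ) :
    IsBddCont (fun G => (signalPlusNoise σ N G * (resolvent lam (signalPlusNoise σ N G) *
      resolvent lam (signalPlusNoise σ N G))) ν j) := by
  simp only [← Matrix.mul_assoc]
  simp only [Matrix.mul_apply (M := _ * _)]
  exact IsBddCont.sum _ fun k _ =>
    (isBddCont_mul_resolvent hlam σ N ν k).mul (isBddCont_resolvent hlam σ N k j)

theorem isBddCont_transpose_mul_mul_resolvent (i j : κ) :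
    IsBddCont (fun G => (Nᵀ * (signalPlusNoise σ N G *
      resolvent lam (signalPlusNoise σ N G))) i j) := by
  simp only [Matrix.mul_apply (M := Nᵀ)]
  exact IsBddCont.sum _ fun k _ => (isBddCont_mul_resolvent hlam σ N k j).const_mul _

theorem isBddCont_trace_transpose_mul_mul_resolvent_sq :
    IsBddCont (fun G => (Nᵀ * (signalPlusNoise σ N G * (resolvent lam (signalPlusNoise σ N G) *
      resolvent lam (signalPlusNoise σ N G)))).trace) := by
  refine IsBddCont.sum _ fun i _ => ?_
  simp only [diag_apply, Matrix.mul_apply (M := Nᵀ)]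
  exact IsBddCont.sum _ fun k _ => (isBddCont_mul_resolvent_sq hlam σ N k i).const_mul _

theorem isBddCont_trace_transpose_mul_mul_resolvent :
    IsBddCont (fun G => (Nᵀ * (signalPlusNoise σ N G *
      resolvent lam (signalPlusNoise σ N G))).trace) :=
  IsBddCont.sum _ fun i _ => isBddCont_transpose_mul_mul_resolvent hlam σ N i i

theorem isBddCont_one_sub_resolvent (i j : κ) :
    IsBddCont (fun G => ((1 : Matrix κ κ ℝ) - lam • resolvent lam (signalPlusNoise σ N G)) i j) := by
  simp only [Matrix.sub_apply, Matrix.smul_apply, smul_eq_mul]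
  exact (IsBddCont.const _).sub ((isBddCont_resolvent hlam σ N i j).const_mul _)

theorem isBddCont_resolvent_sub (i j : κ) :
    IsBddCont (fun G => (resolvent lam (signalPlusNoise σ N G) -
      lam • (resolvent lam (signalPlusNoise σ N G) *
        resolvent lam (signalPlusNoise σ N G))) i j) := by
  simp only [Matrix.sub_apply, Matrix.smul_apply, smul_eq_mul]
  exact (isBddCont_resolvent hlam σ N i j).sub ((isBddCont_resolvent_sq hlam σ N i j).const_mul _)

/-- A linear combination of the identities `integral_mul_gram_resolvent`. -/
theorem integral_sum_mul_gram_resolvent {α : Type*} (s : Finset α) (e e' : α → κ)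
    {φ : α → (ι × κ → ℝ) → ℝ} {D : α → ι → (ι × κ → ℝ) → ℝ}
    (hφ : ∀ a, IsBddCont (φ a)) (hD : ∀ a ν, IsBddCont (D a ν))
    (hd : ∀ a ν G t, HasDerivAt (fun s => φ a (Function.update G (ν, e a) s))
      (D a ν (Function.update G (ν, e a) t)) t) :
    ∫ G, ∑ a ∈ s, φ a G * ((1 - lam • resolvent lam (signalPlusNoise σ N G)) (e a) (e' a))
        ∂(gaussianPi (ι × κ) 1) =
      ∫ G, (σ ^ 2 * (∑ a ∈ s, φ a G *
          (Fintype.card ι * resolvent lam (signalPlusNoise σ N G) (e a) (e' a) -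
          (resolvent lam (signalPlusNoise σ N G) - lam • (resolvent lam (signalPlusNoise σ N G) *
            resolvent lam (signalPlusNoise σ N G))) (e a) (e' a) -
          (Fintype.card κ - lam * (resolvent lam (signalPlusNoise σ N G)).trace) *
            resolvent lam (signalPlusNoise σ N G) (e a) (e' a))) +
        ∑ a ∈ s, φ a G *
          (Nᵀ * (signalPlusNoise σ N G * resolvent lam (signalPlusNoise σ N G))) (e a) (e' a) +
        σ * ∑ a ∈ s, ∑ ν, (signalPlusNoise σ N G *
          resolvent lam (signalPlusNoise σ N G)) ν (e' a) * D a ν G)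
          ∂(gaussianPi (ι × κ) 1) := by
  rw [integral_finsetSum _ fun a _ =>
    ((hφ a).mul (isBddCont_one_sub_resolvent hlam σ N (e a) (e' a))).integrable,
    Finset.sum_congr rfl fun a _ =>
      integral_mul_gram_resolvent hlam σ N (e a) (e' a) (hφ a) (hD a) (hd a),
    ← integral_finsetSum]
  · refine integral_congr_ae (ae_of_all _ fun G => ?_)
    simp only
    rw [Finset.sum_add_distrib, Finset.sum_add_distrib, ← Finset.mul_sum, ← Finset.mul_sum]
  · intro a _
    refine IsBddCont.integrable ?_
    refine ((((hφ a).mul (((isBddCont_resolvent hlam σ N _ _).const_mul _).sub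
      (isBddCont_resolvent_sub hlam σ N _ _) |>.sub ?_)).const_mul _).add
      ((hφ a).mul (isBddCont_transpose_mul_mul_resolvent hlam σ N _ _))).add ?_
    · exact ((IsBddCont.const _).sub ((isBddCont_trace_resolvent hlam σ N).const_mul _)).mul
        (isBddCont_resolvent hlam σ N _ _)
    · exact (IsBddCont.sum _ fun ν _ => (isBddCont_mul_resolvent hlam σ N ν _).mul
        (hD a ν)).const_mul _

/-- The weight is the deviation `tr R - c` itself, so that the identity controls a second moment
directly. Its derivative `-2 σ (X R²) ν i` only produces the last, lower-order term. -/
theorem integral_trace_stein (c : ℝ) :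
    ∫ G, ((resolvent lam (signalPlusNoise σ N G)).trace - c) *
        (Fintype.card κ - lam * (resolvent lam (signalPlusNoise σ N G)).trace)
        ∂(gaussianPi (ι × κ) 1) =
      ∫ G, (σ ^ 2 * (((resolvent lam (signalPlusNoise σ N G)).trace - c) *
          (Fintype.card ι * (resolvent lam (signalPlusNoise σ N G)).trace -
          ((resolvent lam (signalPlusNoise σ N G)).trace -
            lam * (resolvent lam (signalPlusNoise σ N G) *
              resolvent lam (signalPlusNoise σ N G)).trace) -
          (Fintype.card κ - lam * (resolvent lam (signalPlusNoise σ N G)).trace) *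
            (resolvent lam (signalPlusNoise σ N G)).trace)) +
        ((resolvent lam (signalPlusNoise σ N G)).trace - c) *
          (Nᵀ * (signalPlusNoise σ N G * resolvent lam (signalPlusNoise σ N G))).trace -
        2 * σ ^ 2 * ((resolvent lam (signalPlusNoise σ N G) *
          resolvent lam (signalPlusNoise σ N G)).trace -
          lam * (resolvent lam (signalPlusNoise σ N G) *
            resolvent lam (signalPlusNoise σ N G) *
              resolvent lam (signalPlusNoise σ N G)).trace))
          ∂(gaussianPi (ι × κ) 1) := by
  have h := integral_sum_mul_gram_resolvent hlam σ N Finset.univ id id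
    (φ := fun _ G => (resolvent lam (signalPlusNoise σ N G)).trace - c)
    (D := fun i ν G => -2 * σ * (signalPlusNoise σ N G * (resolvent lam (signalPlusNoise σ N G) *
      resolvent lam (signalPlusNoise σ N G))) ν i)
    (fun _ => (isBddCont_trace_resolvent hlam σ N).sub (IsBddCont.const c))
    (fun i ν => (isBddCont_mul_resolvent_sq hlam σ N ν i).const_mul _)
    (fun i ν G t => ?_)
  · refine Eq.trans (integral_congr_ae (ae_of_all _ fun G => ?_))
      (h.trans (integral_congr_ae (ae_of_all _ fun G => ?_)))
    · simp only [id, ← Finset.mul_sum]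
      congr 1
      have : ∑ i, ((1 : Matrix κ κ ℝ) - lam • resolvent lam (signalPlusNoise σ N G)) i i =
        (1 - lam • resolvent lam (signalPlusNoise σ N G)).trace := rfl
      rw [this, trace_sub, trace_one, trace_smul, smul_eq_mul]
    · simp only [id, ← Finset.mul_sum]
      set R := resolvent lam (signalPlusNoise σ N G) with hR
      set X := signalPlusNoise σ N G with hX
      have e1 : ∑ i, ∑ ν, (X * R) ν i * (-2 * σ * (X * (R * R)) ν i) =
          -2 * σ * ((R * R).trace - lam * (R * R * R).trace) := by
        have := congrArg trace (mul_resolvent_transpose_mul_sq hlam X)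
        rw [trace_sub, trace_smul, smul_eq_mul, ← hR] at this
        rw [← this, trace, Finset.mul_sum]
        refine Finset.sum_congr rfl fun i _ => ?_
        rw [diag_apply, Matrix.mul_apply (M := (X * R)ᵀ), Finset.mul_sum]
        exact Finset.sum_congr rfl fun ν _ => by rw [transpose_apply]; ring
      have e2 : ∑ i, (Fintype.card ι * R i i - (R - lam • (R * R)) i i -
          (Fintype.card κ - lam * R.trace) * R i i) =
          Fintype.card ι * R.trace - (R.trace - lam * (R * R).trace) -
            (Fintype.card κ - lam * R.trace) * R.trace := by
        rw [Finset.sum_sub_distrib, Finset.sum_sub_distrib, ← Finset.mul_sum, ← Finset.mul_sum]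
        have : ∑ i, (R - lam • (R * R)) i i = (R - lam • (R * R)).trace := rfl
        rw [this, trace_sub, trace_smul, smul_eq_mul]
        rfl
      rw [e1, e2]
      simp only [Matrix.trace, diag_apply]
      ring
  · have h1 := HasDerivAt.fun_sum (u := Finset.univ) fun k _ => hasDerivAt_resolvent_single hlam
      (hasDerivAt_signalPlusNoise σ N G ν i t) k k
    refine (h1.sub_const c).congr_deriv ?_
    simp only [id]
    set Y := signalPlusNoise σ N (Function.update G (ν, i) t)
    rw [← Matrix.mul_assoc, Matrix.mul_apply (M := Y * _), Finset.mul_sum]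
    refine Finset.sum_congr rfl fun k _ => ?_
    rw [resolvent_apply_comm hlam Y i k]
    ring

/-- The weights `u i u j (uᵀ R u)^p` give a relation between consecutive moments of `uᵀ R u`.
Differentiating the power costs a term `2 σ² p`, of relative size `p / d` when `σ² = 1 / d`. -/
theorem integral_quadForm_stein (u : κ → ℝ) (p : ℕ) :
    ∫ G, (u ⬝ᵥ (resolvent lam (signalPlusNoise σ N G) *ᵥ u)) ^ p *
        (u ⬝ᵥ u - lam * (u ⬝ᵥ (resolvent lam (signalPlusNoise σ N G) *ᵥ u)))
        ∂(gaussianPi (ι × κ) 1) =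
      ∫ G, (σ ^ 2 * ((u ⬝ᵥ (resolvent lam (signalPlusNoise σ N G) *ᵥ u)) ^ p *
          (Fintype.card ι * (u ⬝ᵥ (resolvent lam (signalPlusNoise σ N G) *ᵥ u)) -
          ((signalPlusNoise σ N G * resolvent lam (signalPlusNoise σ N G)) *ᵥ u) ⬝ᵥ
            ((signalPlusNoise σ N G * resolvent lam (signalPlusNoise σ N G)) *ᵥ u) -
          (Fintype.card κ - lam * (resolvent lam (signalPlusNoise σ N G)).trace) *
            (u ⬝ᵥ (resolvent lam (signalPlusNoise σ N G) *ᵥ u)))) +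
        (u ⬝ᵥ (resolvent lam (signalPlusNoise σ N G) *ᵥ u)) ^ p *
          ((N *ᵥ u) ⬝ᵥ
            ((signalPlusNoise σ N G * resolvent lam (signalPlusNoise σ N G)) *ᵥ u)) -
        2 * σ ^ 2 * p * ((u ⬝ᵥ (resolvent lam (signalPlusNoise σ N G) *ᵥ u)) ^ p *
          (((signalPlusNoise σ N G * resolvent lam (signalPlusNoise σ N G)) *ᵥ u) ⬝ᵥ
            ((signalPlusNoise σ N G * resolvent lam (signalPlusNoise σ N G)) *ᵥ u))))
          ∂(gaussianPi (ι × κ) 1) := by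
  have hh : IsBddCont (fun G => u ⬝ᵥ (resolvent lam (signalPlusNoise σ N G) *ᵥ u)) := by
    simp only [dotProduct, mulVec]
    exact IsBddCont.sum _ fun i _ => (IsBddCont.sum _ fun j _ =>
      (isBddCont_resolvent hlam σ N i j).mul (IsBddCont.const _)).const_mul _
  have hv : ∀ ν, IsBddCont (fun G => ((signalPlusNoise σ N G *
      resolvent lam (signalPlusNoise σ N G)) *ᵥ u) ν) := by
    intro ν
    simp only [dotProduct, mulVec]
    exact IsBddCont.sum _ fun j _ => (isBddCont_mul_resolvent hlam σ N ν j).mul (IsBddCont.const _)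
  have hw : ∀ i, IsBddCont (fun G => (resolvent lam (signalPlusNoise σ N G) *ᵥ u) i) := by
    intro i
    simp only [dotProduct, mulVec]
    exact IsBddCont.sum _ fun j _ => (isBddCont_resolvent hlam σ N i j).mul (IsBddCont.const _)
  have hbil : ∀ M : Matrix κ κ ℝ, ∑ a : κ × κ, u a.1 * u a.2 * M a.1 a.2 = u ⬝ᵥ (M *ᵥ u) := by
    intro M
    rw [Fintype.sum_prod_type]
    simp only [dotProduct, mulVec, Finset.mul_sum]
    exact Finset.sum_congr rfl fun i _ => Finset.sum_congr rfl fun j _ => by ring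
  have h := integral_sum_mul_gram_resolvent hlam σ N (Finset.univ : Finset (κ × κ)) Prod.fst Prod.snd
    (φ := fun a G => u a.1 * u a.2 * (u ⬝ᵥ (resolvent lam (signalPlusNoise σ N G) *ᵥ u)) ^ p)
    (D := fun a ν G => u a.1 * u a.2 *
      (p * (u ⬝ᵥ (resolvent lam (signalPlusNoise σ N G) *ᵥ u)) ^ (p - 1) *
        (-2 * σ * ((resolvent lam (signalPlusNoise σ N G) *ᵥ u) a.1 *
          ((signalPlusNoise σ N G * resolvent lam (signalPlusNoise σ N G)) *ᵥ u) ν))))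
    (fun a => (hh.pow p).const_mul _)
    (fun a ν => (((hh.pow (p - 1)).const_mul _).mul
      (((hw a.1).mul (hv ν)).const_mul _)).const_mul _)
    (fun a ν G t => ?_)
  · refine Eq.trans (integral_congr_ae (ae_of_all _ fun G => ?_))
      (h.trans (integral_congr_ae (ae_of_all _ fun G => ?_)))
    · simp only
      set R := resolvent lam (signalPlusNoise σ N G) with hR
      have := hbil (1 - lam • R)
      rw [Matrix.sub_mulVec, Matrix.one_mulVec, dotProduct_sub, smul_mulVec, dotProduct_smul,
        smul_eq_mul] at this
      rw [← this, Finset.mul_sum]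
      exact Finset.sum_congr rfl fun a _ => by ring
    · simp only
      set R := resolvent lam (signalPlusNoise σ N G) with hR
      set X := signalPlusNoise σ N G with hX
      set w := u ⬝ᵥ (R *ᵥ u) with hw
      have e0 : u ⬝ᵥ ((R - lam • (R * R)) *ᵥ u) = ((X * R) *ᵥ u) ⬝ᵥ ((X * R) *ᵥ u) := by
        rw [← mul_resolvent_transpose_mul hlam X, ← mulVec_mulVec, dotProduct_mulVec u,
          vecMul_transpose]
      have e1 : ∑ a : κ × κ, u a.1 * u a.2 * w ^ p * (Fintype.card ι * R a.1 a.2 -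
          (R - lam • (R * R)) a.1 a.2 - (Fintype.card κ - lam * R.trace) * R a.1 a.2) =
          w ^ p * (Fintype.card ι * w - ((X * R) *ᵥ u) ⬝ᵥ ((X * R) *ᵥ u) -
            (Fintype.card κ - lam * R.trace) * w) := by
        rw [← e0, hw, ← hbil R, ← hbil, Finset.mul_sum, Finset.mul_sum, ← Finset.sum_sub_distrib,
          ← Finset.sum_sub_distrib, Finset.mul_sum]
        exact Finset.sum_congr rfl fun a _ => by ring
      have e2 : ∑ a : κ × κ, u a.1 * u a.2 * w ^ p * (Nᵀ * (X * R)) a.1 a.2 =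
          w ^ p * ((N *ᵥ u) ⬝ᵥ ((X * R) *ᵥ u)) := by
        have := hbil (Nᵀ * (X * R))
        rw [← mulVec_mulVec, dotProduct_mulVec, vecMul_transpose] at this
        rw [← this, Finset.mul_sum]
        exact Finset.sum_congr rfl fun a _ => by ring
      have e3 : ∑ a : κ × κ, ∑ ν, (X * R) ν a.2 * (u a.1 * u a.2 * (p * w ^ (p - 1) *
          (-2 * σ * ((R *ᵥ u) a.1 * ((X * R) *ᵥ u) ν)))) =
          -2 * σ * p * (w ^ p * (((X * R) *ᵥ u) ⬝ᵥ ((X * R) *ᵥ u))) := by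
        rw [Finset.sum_comm]
        have : ∀ ν, ∑ a : κ × κ, (X * R) ν a.2 * (u a.1 * u a.2 * (p * w ^ (p - 1) *
          (-2 * σ * ((R *ᵥ u) a.1 * ((X * R) *ᵥ u) ν)))) =
            (p * w ^ (p - 1) * (-2 * σ)) * w * (((X * R) *ᵥ u) ν * ((X * R) *ᵥ u) ν) := by
          intro ν
          have hx : ((X * R) *ᵥ u) ν = ∑ j, (X * R) ν j * u j := rfl
          have hx' : w = ∑ i, u i * (R *ᵥ u) i := rfl
          generalize hy : ((X * R) *ᵥ u) ν = y at hx ⊢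
          rw [Fintype.sum_prod_type]
          calc _ = (p * w ^ (p - 1) * (-2 * σ)) * y *
                ((∑ i, u i * (R *ᵥ u) i) * ∑ j, (X * R) ν j * u j) := by
                rw [Finset.sum_mul_sum, Finset.mul_sum]
                refine Finset.sum_congr rfl fun i _ => ?_
                rw [Finset.mul_sum]
                exact Finset.sum_congr rfl fun j _ => by ring
            _ = _ := by rw [← hx, ← hx']; ring
        simp only [this]
        rw [← Finset.mul_sum]
        -- For `p = 0` the truncated exponent `p - 1` is harmless because of the factor `p`.
        rcases p with _ | p
        · simp
        · simp only [dotProduct, Nat.add_sub_cancel]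
          ring
      rw [e1, e2, e3]
      ring
  · have h1 : HasDerivAt (fun s => u ⬝ᵥ (resolvent lam
        (signalPlusNoise σ N (Function.update G (ν, a.1) s)) *ᵥ u))
        (∑ k, u k * ∑ l, (-σ * (resolvent lam (signalPlusNoise σ N (Function.update G (ν, a.1) t)) k a.1 *
          (signalPlusNoise σ N (Function.update G (ν, a.1) t) *
            resolvent lam (signalPlusNoise σ N (Function.update G (ν, a.1) t))) ν l +
          (signalPlusNoise σ N (Function.update G (ν, a.1) t) *
            resolvent lam (signalPlusNoise σ N (Function.update G (ν, a.1) t))) ν k *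
          resolvent lam (signalPlusNoise σ N (Function.update G (ν, a.1) t)) a.1 l)) * u l) t :=
      HasDerivAt.fun_sum fun k _ => (HasDerivAt.fun_sum fun l _ =>
        (hasDerivAt_resolvent_single hlam
          (hasDerivAt_signalPlusNoise σ N G ν a.1 t) k l).mul_const (u l)).const_mul (u k)
    refine ((h1.fun_pow p).const_mul (u a.1 * u a.2)).congr_deriv ?_
    congr 2
    set Y := signalPlusNoise σ N (Function.update G (ν, a.1) t)
    have hx : ((Y * resolvent lam Y) *ᵥ u) ν = ∑ j, (Y * resolvent lam Y) ν j * u j := rfl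
    have hy : (resolvent lam Y *ᵥ u) a.1 = ∑ j, resolvent lam Y a.1 j * u j := rfl
    have hy' : (resolvent lam Y *ᵥ u) a.1 = ∑ k, u k * resolvent lam Y k a.1 := by
      rw [hy]
      exact Finset.sum_congr rfl fun k _ => by rw [resolvent_apply_comm hlam Y k]; ring
    calc _ = -σ * ((∑ k, u k * resolvent lam Y k a.1) * (∑ l, (Y * resolvent lam Y) ν l * u l) +
          (∑ k, (Y * resolvent lam Y) ν k * u k) * (∑ l, resolvent lam Y a.1 l * u l)) := by
          rw [Finset.sum_mul_sum, Finset.sum_mul_sum, ← Finset.sum_add_distrib, Finset.mul_sum]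
          refine Finset.sum_congr rfl fun k _ => ?_
          rw [← Finset.sum_add_distrib, Finset.mul_sum, Finset.mul_sum]
          exact Finset.sum_congr rfl fun l _ => by ring
      _ = _ := by rw [← hx, ← hy, ← hy']; ring

/-- The weights are the entries of `R`, which turns the trace of `Xᵀ X R` into that of `Xᵀ X R²` and
makes `tr R²` appear with the coefficient `card ι - card κ` to leading order. -/
theorem integral_trace_sq_stein :
    ∫ G, ((resolvent lam (signalPlusNoise σ N G)).trace -
        lam * (resolvent lam (signalPlusNoise σ N G) *
          resolvent lam (signalPlusNoise σ N G)).trace)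
        ∂(gaussianPi (ι × κ) 1) =
      ∫ G, (σ ^ 2 * (Fintype.card ι * (resolvent lam (signalPlusNoise σ N G) *
            resolvent lam (signalPlusNoise σ N G)).trace -
          2 * ((resolvent lam (signalPlusNoise σ N G) *
            resolvent lam (signalPlusNoise σ N G)).trace -
            lam * (resolvent lam (signalPlusNoise σ N G) * resolvent lam (signalPlusNoise σ N G) *
              resolvent lam (signalPlusNoise σ N G)).trace) -
          (Fintype.card κ - lam * (resolvent lam (signalPlusNoise σ N G)).trace) *
            (resolvent lam (signalPlusNoise σ N G) *
              resolvent lam (signalPlusNoise σ N G)).trace -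
          (resolvent lam (signalPlusNoise σ N G)).trace *
            ((resolvent lam (signalPlusNoise σ N G)).trace -
              lam * (resolvent lam (signalPlusNoise σ N G) *
                resolvent lam (signalPlusNoise σ N G)).trace)) +
          (Nᵀ * (signalPlusNoise σ N G * (resolvent lam (signalPlusNoise σ N G) *
            resolvent lam (signalPlusNoise σ N G)))).trace)
          ∂(gaussianPi (ι × κ) 1) := by
  have h := integral_sum_mul_gram_resolvent hlam σ N (Finset.univ : Finset (κ × κ)) Prod.fst Prod.snd
    (φ := fun a G => resolvent lam (signalPlusNoise σ N G) a.1 a.2)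
    (D := fun a ν G => -σ * (resolvent lam (signalPlusNoise σ N G) a.1 a.1 *
      (signalPlusNoise σ N G * resolvent lam (signalPlusNoise σ N G)) ν a.2 +
      (signalPlusNoise σ N G * resolvent lam (signalPlusNoise σ N G)) ν a.1 *
        resolvent lam (signalPlusNoise σ N G) a.1 a.2))
    (fun a => isBddCont_resolvent hlam σ N _ _)
    (fun a ν => (((isBddCont_resolvent hlam σ N _ _).mul (isBddCont_mul_resolvent hlam σ N _ _)).add
      ((isBddCont_mul_resolvent hlam σ N _ _).mul (isBddCont_resolvent hlam σ N _ _))).const_mul _)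
    (fun a ν G t => hasDerivAt_resolvent_single hlam
      (hasDerivAt_signalPlusNoise σ N G ν a.1 t) a.1 a.2)
  refine Eq.trans (integral_congr_ae (ae_of_all _ fun G => ?_))
      (h.trans (integral_congr_ae (ae_of_all _ fun G => ?_)))
  all_goals
    simp only
    set X := signalPlusNoise σ N G with hX
    set R := resolvent lam X with hR
    have hsum : ∀ M : Matrix κ κ ℝ, ∑ a : κ × κ, R a.1 a.2 * M a.1 a.2 = (M * R).trace := by
      intro M
      rw [Fintype.sum_prod_type]
      refine Finset.sum_congr rfl fun i _ => ?_
      rw [diag_apply, Matrix.mul_apply]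
      exact Finset.sum_congr rfl fun j _ => by rw [hR, resolvent_apply_comm hlam X i j, mul_comm]
  · rw [hsum, Matrix.sub_mul, Matrix.one_mul, smul_mul, trace_sub, trace_smul, smul_eq_mul]
  · have e1 : ∑ a : κ × κ, R a.1 a.2 * (Fintype.card ι * R a.1 a.2 -
        (R - lam • (R * R)) a.1 a.2 - (Fintype.card κ - lam * R.trace) * R a.1 a.2) =
        Fintype.card ι * (R * R).trace - ((R * R).trace - lam * (R * R * R).trace) -
          (Fintype.card κ - lam * R.trace) * (R * R).trace := by
      have e := hsum (R - lam • (R * R))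
      rw [Matrix.sub_mul, smul_mul, trace_sub, trace_smul, smul_eq_mul] at e
      rw [← e, ← hsum R, Finset.mul_sum, Finset.mul_sum, ← Finset.sum_sub_distrib,
        ← Finset.sum_sub_distrib]
      exact Finset.sum_congr rfl fun a _ => by ring
    have e2 : ∑ a : κ × κ, ∑ ν, (X * R) ν a.2 * (-σ * (R a.1 a.1 * (X * R) ν a.2 +
        (X * R) ν a.1 * R a.1 a.2)) =
        -σ * (R.trace * (R.trace - lam * (R * R).trace) +
          ((R * R).trace - lam * (R * R * R).trace)) := by
      have q1 := congrArg trace (mul_resolvent_transpose_mul hlam X)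
      rw [trace_sub, trace_smul, smul_eq_mul, ← hR] at q1
      have q2 := congrArg trace (mul_resolvent_transpose_mul_sq hlam X)
      rw [trace_sub, trace_smul, smul_eq_mul, ← hR, ← Matrix.mul_assoc X R R,
        ← Matrix.mul_assoc] at q2
      rw [← q1, ← q2, ← hsum]
      have q3 : ∀ i j, ((X * R)ᵀ * (X * R)) i j = ∑ ν, (X * R) ν i * (X * R) ν j :=
        fun i j => by rw [Matrix.mul_apply]; rfl
      have q4 : R.trace * ((X * R)ᵀ * (X * R)).trace =
          ∑ a : κ × κ, R a.1 a.1 * ((X * R)ᵀ * (X * R)) a.2 a.2 := by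
        rw [Fintype.sum_prod_type, trace, trace, Finset.sum_mul_sum]
        rfl
      rw [q4, ← Finset.sum_add_distrib, Finset.mul_sum]
      refine Finset.sum_congr rfl fun a _ => ?_
      rw [q3, q3, Finset.mul_sum, Finset.mul_sum, ← Finset.sum_add_distrib, Finset.mul_sum]
      exact Finset.sum_congr rfl fun ν _ => by ring
    rw [e1, e2, hsum, Matrix.mul_assoc Nᵀ, Matrix.mul_assoc X]
    ring

end SteinConsequences

end IsotropicGMM

namespace IsotropicGMM

open Matrix

section MomentBounds

set_option linter.unusedSectionVars false

variable {ι κ : Type*} [Fintype ι] [Fintype κ] [DecidableEq ι] [DecidableEq κ]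

/-! ### Cauchy-Schwarz for matrices -/

theorem trace_transpose_mul_eq_sum (M Y : Matrix ι κ ℝ) :
    (Mᵀ * Y).trace = ∑ a : ι × κ, M a.1 a.2 * Y a.1 a.2 := by
  rw [Fintype.sum_prod_type, Finset.sum_comm]
  rfl

theorem trace_transpose_mul_sq_le (M Y : Matrix ι κ ℝ) :
    (Mᵀ * Y).trace ^ 2 ≤ (Mᵀ * M).trace * (Yᵀ * Y).trace := by
  simp only [trace_transpose_mul_eq_sum, ← pow_two]
  exact Finset.sum_mul_sq_le_sq_mul_sq _ _ _

theorem dotProduct_sq_le (v w : ι → ℝ) : (v ⬝ᵥ w) ^ 2 ≤ (v ⬝ᵥ v) * (w ⬝ᵥ w) := by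
  simp only [dotProduct, ← pow_two]
  exact Finset.sum_mul_sq_le_sq_mul_sq _ _ _

theorem mulVec_dotProduct_self_le (M : Matrix ι κ ℝ) (u : κ → ℝ) :
    (M *ᵥ u) ⬝ᵥ (M *ᵥ u) ≤ (Mᵀ * M).trace * (u ⬝ᵥ u) := by
  rw [trace_transpose_mul_eq_sum, Fintype.sum_prod_type, Finset.sum_mul]
  refine Finset.sum_le_sum fun ν _ => ?_
  rw [← pow_two]
  exact dotProduct_sq_le (M ν) u

variable {lam : ℝ} (hlam : 0 < lam) (X : Matrix ι κ ℝ)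

/-! ### Trace inequalities -/

include hlam

theorem trace_resolvent_nonneg : 0 ≤ (resolvent lam X).trace := by
  rw [resolvent_eq_gramFn hlam, trace_gramFn]
  refine Finset.sum_nonneg fun i _ => ?_
  have := gramEigenvalues_nonneg X i
  positivity

theorem trace_resolvent_sq_nonneg : 0 ≤ (resolvent lam X * resolvent lam X).trace := by
  rw [resolvent_sq_eq_gramFn hlam, trace_gramFn]
  refine Finset.sum_nonneg fun i _ => ?_
  have := gramEigenvalues_nonneg X i
  positivity

theorem trace_resolvent_cube_nonneg :
    0 ≤ (resolvent lam X * resolvent lam X * resolvent lam X).trace := by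
  rw [resolvent_cube_eq_gramFn hlam, trace_gramFn]
  refine Finset.sum_nonneg fun i _ => ?_
  have := gramEigenvalues_nonneg X i
  positivity

theorem lam_mul_trace_resolvent_sq_le :
    lam * (resolvent lam X * resolvent lam X).trace ≤ (resolvent lam X).trace := by
  rw [resolvent_sq_eq_gramFn hlam, resolvent_eq_gramFn hlam, ← smul_eq_mul, ← trace_smul,
    gramFn_smul]
  refine trace_gramFn_mono X fun a ha => ?_
  have h1 : lam * (a + lam)⁻¹ ≤ 1 := by
    rw [mul_inv_le_iff₀ (by positivity)]; linarith
  have h2 : 0 ≤ (a + lam)⁻¹ := by positivity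
  nlinarith

omit [DecidableEq ι] hlam in
theorem sum_mul_le_sum_mul_sum (x y : κ → ℝ) (hx : ∀ i, 0 ≤ x i) (hy : ∀ i, 0 ≤ y i) :
    ∑ i, x i * y i ≤ (∑ i, x i) * ∑ i, y i := by
  rw [Finset.mul_sum]
  refine Finset.sum_le_sum fun i hi => ?_
  exact mul_le_mul_of_nonneg_right (Finset.single_le_sum (fun j _ => hx j) hi) (hy i)

/-- Crude, but sufficient: `tr R²` is compared with `(tr R)²` only in a term that carries an
additional factor `1 / d`. -/
theorem trace_resolvent_sq_le :
    (resolvent lam X * resolvent lam X).trace ≤ (resolvent lam X).trace ^ 2 := by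
  rw [resolvent_sq_eq_gramFn hlam, resolvent_eq_gramFn hlam, trace_gramFn, trace_gramFn, pow_two]
  have h : ∀ i, 0 ≤ (gramEigenvalues X i + lam)⁻¹ := fun i => by
    have := gramEigenvalues_nonneg X i
    positivity
  exact sum_mul_le_sum_mul_sum _ _ h h

/-- In eigenvalues the left side is at most the sum of `(a + lam)⁻³`, which the product of the two
traces dominates. The loss is affordable since the resulting mean term is absorbed by Young's
inequality. -/
theorem trace_mul_resolvent_sq_transpose_mul_le :
    ((X * (resolvent lam X * resolvent lam X))ᵀ *
      (X * (resolvent lam X * resolvent lam X))).trace ≤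
      (resolvent lam X).trace * (resolvent lam X * resolvent lam X).trace := by
  have h : ∀ i, 0 ≤ (gramEigenvalues X i + lam)⁻¹ := fun i => by
    have := gramEigenvalues_nonneg X i
    positivity
  rw [resolvent_sq_eq_gramFn hlam, mul_gramFn_transpose_mul, resolvent_eq_gramFn hlam,
    trace_gramFn, trace_gramFn, trace_gramFn]
  refine le_trans (Finset.sum_le_sum fun i _ => ?_)
    (sum_mul_le_sum_mul_sum _ _ h fun i => mul_nonneg (h i) (h i))
  set a := gramEigenvalues X i
  have ha : 0 ≤ a := gramEigenvalues_nonneg X i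
  have h1 : a * (a + lam)⁻¹ ≤ 1 := by
    rw [mul_inv_le_iff₀ (by positivity)]; linarith
  calc (a + lam)⁻¹ * (a + lam)⁻¹ * a * ((a + lam)⁻¹ * (a + lam)⁻¹)
      = (a * (a + lam)⁻¹) * ((a + lam)⁻¹ * ((a + lam)⁻¹ * (a + lam)⁻¹)) := by ring
    _ ≤ 1 * ((a + lam)⁻¹ * ((a + lam)⁻¹ * (a + lam)⁻¹)) := by
        have := h i
        gcongr
    _ = _ := one_mul _

theorem trace_mul_resolvent_transpose_mul_le :
    ((X * resolvent lam X)ᵀ * (X * resolvent lam X)).trace ≤ (resolvent lam X).trace := by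
  rw [mul_resolvent_transpose_mul hlam, trace_sub, trace_smul, smul_eq_mul]
  have := trace_resolvent_sq_nonneg hlam X
  have := mul_nonneg hlam.le this
  linarith

theorem mulVec_mul_resolvent_dotProduct_self_le (u : κ → ℝ) :
    ((X * resolvent lam X) *ᵥ u) ⬝ᵥ ((X * resolvent lam X) *ᵥ u) ≤
      u ⬝ᵥ (resolvent lam X *ᵥ u) := by
  have h : ((X * resolvent lam X) *ᵥ u) ⬝ᵥ ((X * resolvent lam X) *ᵥ u) =
      u ⬝ᵥ (((X * resolvent lam X)ᵀ * (X * resolvent lam X)) *ᵥ u) := by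
    rw [← mulVec_mulVec u (X * resolvent lam X)ᵀ, dotProduct_mulVec u, vecMul_transpose]
  rw [h, resolvent_eq_gramFn hlam, mul_gramFn_transpose_mul]
  refine dotProduct_gramFn_mono X (fun a ha => ?_) u
  have h1 : a * (a + lam)⁻¹ ≤ 1 := by
    rw [mul_inv_le_iff₀ (by positivity)]; linarith
  have h2 : 0 ≤ (a + lam)⁻¹ := by positivity
  nlinarith

theorem quadForm_resolvent_nonneg (u : κ → ℝ) : 0 ≤ u ⬝ᵥ (resolvent lam X *ᵥ u) :=
  le_trans (by simpa [dotProduct] using Finset.sum_nonneg fun i _ => mul_self_nonneg _)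
    (mulVec_mul_resolvent_dotProduct_self_le hlam X u)

variable (N : Matrix ι κ ℝ) {K : ℝ} (hK : 0 ≤ K) (hN : (Nᵀ * N).trace ≤ K ^ 2)

include hK hN

/-- The Frobenius norm of `N` is bounded by `K`, so when `tr R` is of order `d` the cluster means
contribute only `O(√d)` to a trace of order `d`. This is why they do not change the limit of `tr R /
d`. -/
theorem abs_trace_transpose_mul_mul_resolvent_le :
    |(Nᵀ * (X * resolvent lam X)).trace| ≤ K * √((resolvent lam X).trace) := by
  have h0 := trace_resolvent_nonneg hlam X
  refine abs_le_of_sq_le_sq ?_ (by positivity)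
  rw [mul_pow, Real.sq_sqrt h0]
  refine (trace_transpose_mul_sq_le N _).trans ?_
  have h1 : 0 ≤ ((X * resolvent lam X)ᵀ * (X * resolvent lam X)).trace := by
    rw [trace_transpose_mul_eq_sum]; exact Finset.sum_nonneg fun _ _ => mul_self_nonneg _
  exact mul_le_mul hN (trace_mul_resolvent_transpose_mul_le hlam X) h1 (by positivity)

theorem abs_trace_transpose_mul_mul_resolvent_sq_le :
    |(Nᵀ * (X * (resolvent lam X * resolvent lam X))).trace| ≤
      K * √((resolvent lam X).trace * (resolvent lam X * resolvent lam X).trace) := by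
  have h0 := mul_nonneg (trace_resolvent_nonneg hlam X) (trace_resolvent_sq_nonneg hlam X)
  refine abs_le_of_sq_le_sq ?_ (by positivity)
  rw [mul_pow, Real.sq_sqrt h0]
  refine (trace_transpose_mul_sq_le N _).trans ?_
  have h1 : 0 ≤ ((X * (resolvent lam X * resolvent lam X))ᵀ *
      (X * (resolvent lam X * resolvent lam X))).trace := by
    rw [trace_transpose_mul_eq_sum]; exact Finset.sum_nonneg fun _ _ => mul_self_nonneg _
  exact mul_le_mul hN (trace_mul_resolvent_sq_transpose_mul_le hlam X) h1 (by positivity)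

theorem sq_mulVec_dotProduct_mul_resolvent_le (u : κ → ℝ) :
    ((N *ᵥ u) ⬝ᵥ ((X * resolvent lam X) *ᵥ u)) ^ 2 ≤
      K ^ 2 * (u ⬝ᵥ u) * (u ⬝ᵥ (resolvent lam X *ᵥ u)) := by
  refine (dotProduct_sq_le _ _).trans ?_
  have h0 : 0 ≤ u ⬝ᵥ u := by
    simpa [dotProduct] using Finset.sum_nonneg fun i _ => mul_self_nonneg _
  refine mul_le_mul ((mulVec_dotProduct_self_le N u).trans (by gcongr))
    (mulVec_mul_resolvent_dotProduct_self_le hlam X u) ?_ (by positivity)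
  simpa [dotProduct] using Finset.sum_nonneg fun i _ => mul_self_nonneg _

end MomentBounds

/-! ### Moment bounds for the resolvent of a Gaussian matrix -/

section GaussianMoments

set_option linter.unusedSectionVars false

variable {ι κ : Type*} [Fintype ι] [Fintype κ] [DecidableEq ι] [DecidableEq κ]
  {lam : ℝ} (hlam : 0 < lam) (N : Matrix ι κ ℝ) {K : ℝ} (hK : 0 ≤ K)
  (hN : (Nᵀ * N).trace ≤ K ^ 2)

/-- The matrix `G / √d + N` with `d` columns. -/
noncomputable def design (N : Matrix ι κ ℝ) (G : ι × κ → ℝ) : Matrix ι κ ℝ :=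
  signalPlusNoise (√(Fintype.card κ : ℝ))⁻¹ N G

theorem sq_inv_sqrt_card : ((√(Fintype.card κ : ℝ))⁻¹) ^ 2 = (Fintype.card κ : ℝ)⁻¹ := by
  rw [inv_pow, Real.sq_sqrt (Nat.cast_nonneg _)]

/-- The normalized trace of the resolvent. -/
noncomputable def stieltjes (lam : ℝ) (X : Matrix ι κ ℝ) : ℝ :=
  (resolvent lam X).trace / Fintype.card κ

/-- The normalized trace of the squared resolvent. -/
noncomputable def stieltjesSq (lam : ℝ) (X : Matrix ι κ ℝ) : ℝ :=
  (resolvent lam X * resolvent lam X).trace / Fintype.card κ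

theorem isBddCont_stieltjes (hlam : 0 < lam) :
    IsBddCont (fun G => stieltjes lam (design N G)) := by
  simp only [stieltjes, design, div_eq_inv_mul]
  exact (isBddCont_trace_resolvent hlam _ N).const_mul _

theorem isBddCont_stieltjesSq (hlam : 0 < lam) :
    IsBddCont (fun G => stieltjesSq lam (design N G)) := by
  simp only [stieltjesSq, design, div_eq_inv_mul]
  exact (isBddCont_trace_resolvent_sq hlam _ N).const_mul _

/-- The scalar inequality behind concentration of the normalized trace `m`. Without the terms in
`q`, `r` and `t`, the right side is `(m - ms)` times a quadratic vanishing at the root `ms`, hence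
coercive in `m - ms`. The remaining terms are `O(1 / √d)` relative to `(m - ms)² + 1`. -/
theorem trace_deviation_aux {d a c lam m ms q r t K B : ℝ} (hd : 1 ≤ d) (hc : c ≤ a - 1)
    (hlam : 0 < lam) (hm : 0 ≤ m) (hms : 0 ≤ ms) (hB : ms ≤ B) (hK : 0 ≤ K)
    (hroot : lam * ms ^ 2 + (a - 1 + lam) * ms = 1) (hq0 : 0 ≤ q) (hq : q ≤ m)
    (hr : r ≤ m ^ 2) (ht : |t| ≤ K * (√m / √d)) :
    c * (m - ms) ^ 2 - (1 + B + K * (2 + B) + 4 + 4 * B ^ 2) / √d * ((m - ms) ^ 2 + 1) ≤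
      (m - ms) * (a * m - q / d - (1 - lam * m) * m - (1 - lam * m)) + (m - ms) * t -
        2 * r / d := by
  set φ := m - ms with hφ
  have hs : 1 ≤ √d := by rw [Real.one_le_sqrt]; exact hd
  have hsd : √d ≤ d := by
    nlinarith [Real.mul_self_sqrt (show (0 : ℝ) ≤ d by linarith)]
  have hB0 : 0 ≤ B := hms.trans hB
  have hmB : m ≤ |φ| + B := by
    have := le_abs_self φ
    linarith
  have habs : |φ| ≤ φ ^ 2 + 1 := by
    nlinarith [sq_abs φ, sq_nonneg (|φ| - 1), abs_nonneg φ]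
  have e1 : |φ| * m ≤ (1 + B) * (φ ^ 2 + 1) := by
    calc |φ| * m ≤ |φ| * (|φ| + B) := by gcongr
      _ = φ ^ 2 + B * |φ| := by rw [mul_add, ← pow_two, sq_abs]; ring
      _ ≤ φ ^ 2 + B * (φ ^ 2 + 1) := by gcongr
      _ ≤ _ := by nlinarith
  have e2 : |φ| * √m ≤ (2 + B) * (φ ^ 2 + 1) := by
    have h1 : √m ≤ 1 + m := by
      nlinarith [Real.sq_sqrt hm, Real.sqrt_nonneg m, sq_nonneg (√m - 1)]
    calc |φ| * √m ≤ |φ| * (1 + m) := by gcongr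
      _ = |φ| + |φ| * m := by ring
      _ ≤ (φ ^ 2 + 1) + (1 + B) * (φ ^ 2 + 1) := add_le_add habs e1
      _ = _ := by ring
  have e3 : 2 * m ^ 2 ≤ (4 + 4 * B ^ 2) * (φ ^ 2 + 1) := by
    have : m = φ + ms := by rw [hφ]; ring
    have h2 : ms ^ 2 ≤ B ^ 2 := by gcongr
    have h3 : 2 * m ^ 2 ≤ 4 * φ ^ 2 + 4 * B ^ 2 := by
      rw [this]; nlinarith [sq_nonneg (φ - ms)]
    nlinarith [mul_nonneg (sq_nonneg B) (sq_nonneg φ)]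
  -- Subtracting the equation for the root `ms` factors out `m - ms` and leaves `a - 1 + lam + lam
  -- (m + ms)`, which is at least `a - 1 ≥ c` for every positive `lam`.
  have hmain : c * φ ^ 2 ≤ φ * (a * m - (1 - lam * m) * m - (1 - lam * m)) := by
    have : φ * (a * m - (1 - lam * m) * m - (1 - lam * m)) =
        φ ^ 2 * (a - 1 + lam + lam * (m + ms)) := by
      have : a * m - (1 - lam * m) * m - (1 - lam * m) =
          φ * (a - 1 + lam + lam * (m + ms)) := by
        rw [hφ]; linear_combination hroot
      rw [this]; ring
    rw [this, mul_comm]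
    have : 0 ≤ lam * (m + ms) := by positivity
    gcongr
    linarith
  have f1 : φ * (q / d) ≤ |φ| * m / √d := by
    calc φ * (q / d) ≤ |φ| * (m / √d) := by
          refine mul_le_mul (le_abs_self φ) ?_ (by positivity) (abs_nonneg _)
          exact div_le_div₀ hm hq (by positivity) hsd
      _ = _ := by ring
  have f2 : -(φ * t) ≤ K * (|φ| * √m) / √d := by
    calc -(φ * t) ≤ |φ * t| := neg_le_abs _
      _ = |φ| * |t| := abs_mul _ _
      _ ≤ |φ| * (K * (√m / √d)) := by gcongr
      _ = _ := by ring
  have f3 : 2 * r / d ≤ 2 * m ^ 2 / √d :=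
    div_le_div₀ (by positivity) (by linarith) (by positivity) hsd
  have g : |φ| * m / √d + K * (|φ| * √m) / √d + 2 * m ^ 2 / √d ≤
      (1 + B + K * (2 + B) + 4 + 4 * B ^ 2) / √d * (φ ^ 2 + 1) := by
    rw [← add_div, ← add_div, div_mul_eq_mul_div]
    gcongr
    calc |φ| * m + K * (|φ| * √m) + 2 * m ^ 2
        ≤ (1 + B) * (φ ^ 2 + 1) + K * ((2 + B) * (φ ^ 2 + 1)) + (4 + 4 * B ^ 2) * (φ ^ 2 + 1) := by
          gcongr
      _ = _ := by ring
  have : φ * (a * m - q / d - (1 - lam * m) * m - (1 - lam * m)) =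
      φ * (a * m - (1 - lam * m) * m - (1 - lam * m)) - φ * (q / d) := by ring
  rw [this]
  linarith

include hlam hK hN

/-- Dividing the Stein identity weighted by the deviation by `d²` leaves a coercive quadratic term
plus errors of order `1 / √d`. For large `d` half of the coercivity absorbs the quadratic part of
the errors. The constants do not involve `lam`. -/
theorem integral_sq_stieltjes_sub_le [Nonempty κ] {c B ms : ℝ}
    (hc0 : 0 < c) (hc : c ≤ (Fintype.card ι : ℝ) / Fintype.card κ - 1) (hms : 0 ≤ ms)
    (hB : ms ≤ B)
    (hroot : lam * ms ^ 2 + ((Fintype.card ι : ℝ) / Fintype.card κ - 1 + lam) * ms = 1)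
    (hlarge : (1 + B + K * (2 + B) + 4 + 4 * B ^ 2) / √(Fintype.card κ : ℝ) ≤ c / 2) :
    ∫ G, (stieltjes lam (design N G) - ms) ^ 2 ∂(gaussianPi (ι × κ) 1) ≤
      2 / c * ((1 + B + K * (2 + B) + 4 + 4 * B ^ 2) / √(Fintype.card κ : ℝ)) := by
  set σ : ℝ := (√(Fintype.card κ : ℝ))⁻¹ with hσ
  set d : ℝ := (Fintype.card κ : ℝ) with hd
  set C := (1 + B + K * (2 + B) + 4 + 4 * B ^ 2) / √d with hC
  have hd1 : 1 ≤ d := by rw [hd]; exact_mod_cast Fintype.card_pos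
  have hσ2 : σ ^ 2 = d⁻¹ := sq_inv_sqrt_card
  have h := integral_trace_stein hlam σ N (d * ms)
  set φ := fun G => stieltjes lam (design N G) - ms with hφ
  have hφb : IsBddCont φ := (isBddCont_stieltjes N hlam).sub (IsBddCont.const _)
  have hT1 := isBddCont_trace_resolvent hlam σ N
  have hT2 := isBddCont_trace_resolvent_sq hlam σ N
  have hT3 := isBddCont_trace_resolvent_cube hlam σ N
  have hTN := isBddCont_trace_transpose_mul_mul_resolvent hlam σ N
  rw [← sub_eq_zero, ← integral_sub] at h
  rotate_left
  · exact ((hT1.sub (.const _)).mul ((IsBddCont.const _).sub (hT1.const_mul _))).integrable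
  · exact (((((hT1.sub (.const _)).mul (((hT1.const_mul _).sub (hT1.sub (hT2.const_mul _))).sub
      (((IsBddCont.const _).sub (hT1.const_mul _)).mul hT1))).const_mul _).add
      ((hT1.sub (.const _)).mul hTN)).sub ((hT2.sub (hT3.const_mul _)).const_mul _)).integrable
  have hpt : ∀ G, _ ≤ _ := fun G => trace_deviation_aux (d := d)
    (a := (Fintype.card ι : ℝ) / d) (c := c) (m := stieltjes lam (design N G)) (ms := ms)
    (q := ((resolvent lam (design N G)).trace - lam * (resolvent lam (design N G) *
      resolvent lam (design N G)).trace) / d)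
    (r := ((resolvent lam (design N G) * resolvent lam (design N G)).trace -
      lam * (resolvent lam (design N G) * resolvent lam (design N G) *
        resolvent lam (design N G)).trace) / d ^ 2)
    (t := (Nᵀ * (design N G * resolvent lam (design N G))).trace / d) (K := K) (B := B) hd1 hc
    hlam (div_nonneg (trace_resolvent_nonneg hlam _) (by positivity)) hms hB hK hroot
    (div_nonneg (sub_nonneg.2 (lam_mul_trace_resolvent_sq_le hlam _)) (by positivity))
    (by
      rw [stieltjes]
      gcongr
      have := mul_nonneg hlam.le (trace_resolvent_sq_nonneg hlam (design N G))
      linarith)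
    (by
      rw [stieltjes, div_pow]
      gcongr
      have := mul_nonneg hlam.le (trace_resolvent_cube_nonneg hlam (design N G))
      have := trace_resolvent_sq_le hlam (design N G)
      linarith)
    (by
      have hd0 : 0 < d := by linarith
      rw [abs_div, abs_of_pos hd0, stieltjes, ← hd, Real.sqrt_div (trace_resolvent_nonneg hlam _),
        div_div, Real.mul_self_sqrt hd0.le, ← mul_div_assoc]
      gcongr
      exact abs_trace_transpose_mul_mul_resolvent_le hlam _ N hK hN)
  have hint : ∫ G, (c * φ G ^ 2 - C * (φ G ^ 2 + 1)) ∂(gaussianPi (ι × κ) 1) ≤ 0 := by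
    have h0 : ∫ G, (d ^ 2)⁻¹ * (((resolvent lam (signalPlusNoise σ N G)).trace - d * ms) *
        (Fintype.card κ - lam * (resolvent lam (signalPlusNoise σ N G)).trace) -
      (σ ^ 2 * (((resolvent lam (signalPlusNoise σ N G)).trace - d * ms) *
          (Fintype.card ι * (resolvent lam (signalPlusNoise σ N G)).trace -
          ((resolvent lam (signalPlusNoise σ N G)).trace -
            lam * (resolvent lam (signalPlusNoise σ N G) *
              resolvent lam (signalPlusNoise σ N G)).trace) -
          (Fintype.card κ - lam * (resolvent lam (signalPlusNoise σ N G)).trace) *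
            (resolvent lam (signalPlusNoise σ N G)).trace)) +
        ((resolvent lam (signalPlusNoise σ N G)).trace - d * ms) *
          (Nᵀ * (signalPlusNoise σ N G * resolvent lam (signalPlusNoise σ N G))).trace -
        2 * σ ^ 2 * ((resolvent lam (signalPlusNoise σ N G) *
          resolvent lam (signalPlusNoise σ N G)).trace -
          lam * (resolvent lam (signalPlusNoise σ N G) *
            resolvent lam (signalPlusNoise σ N G) *
              resolvent lam (signalPlusNoise σ N G)).trace)))
          ∂(gaussianPi (ι × κ) 1) = 0 := by
      rw [integral_const_mul, h, mul_zero]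
    rw [← neg_zero, ← h0, ← integral_neg]
    refine integral_mono (((hφb.pow 2).const_mul c).sub
      (((hφb.pow 2).add (.const 1)).const_mul C)).integrable ?_ fun G => ?_
    · exact ((((hT1.sub (.const _)).mul ((IsBddCont.const _).sub (hT1.const_mul _))).sub
        (((((hT1.sub (.const _)).mul (((hT1.const_mul _).sub (hT1.sub (hT2.const_mul _))).sub
      (((IsBddCont.const _).sub (hT1.const_mul _)).mul hT1))).const_mul _).add
      ((hT1.sub (.const _)).mul hTN)).sub
        ((hT2.sub (hT3.const_mul _)).const_mul _))).const_mul _).neg.integrable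
    · refine (hpt G).trans (le_of_eq ?_)
      simp only [stieltjes, design, ← hd, ← hσ, hσ2]
      field_simp
      ring
  -- What remains is `(c - C) E φ² ≤ C`, and `hlarge` says `C ≤ c / 2`.
  have hP : ∫ G, (c * φ G ^ 2 - C * (φ G ^ 2 + 1)) ∂(gaussianPi (ι × κ) 1) =
      (c - C) * ∫ G, φ G ^ 2 ∂(gaussianPi (ι × κ) 1) - C := by
    rw [← integral_const_mul]
    have : C = ∫ _ : ι × κ → ℝ, C ∂(gaussianPi (ι × κ) 1) := by simp
    conv_rhs => rw [this]
    rw [← integral_sub ((hφb.pow 2).const_mul _).integrable (integrable_const _)]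
    congr 1; ext G
    simp
    ring
  rw [hP] at hint
  have hpos : 0 ≤ ∫ G, φ G ^ 2 ∂(gaussianPi (ι × κ) 1) := integral_nonneg fun _ => sq_nonneg _
  rw [div_mul_eq_mul_div, le_div_iff₀ hc0]
  nlinarith

/-- In the Stein identity for `tr R²` the coefficient `card ι / d - 1` is at least `c`. Of this, `c
/ 4` pays for the term `2 / d`, another `c / 4` for the mean matrix, and `c / 2` remains. The terms
with a factor `lam` have the favourable sign, so the bound is uniform as `lam → 0`. -/
theorem integral_stieltjesSq_le [Nonempty κ] {c : ℝ}
    (hc0 : 0 < c) (hc : c ≤ (Fintype.card ι : ℝ) / Fintype.card κ - 1)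
    (hlarge : 2 / (Fintype.card κ : ℝ) ≤ c / 4) :
    ∫ G, stieltjesSq lam (design N G) ∂(gaussianPi (ι × κ) 1) ≤
      2 / c * (1 + K ^ 2 / c + (2 + K ^ 2 / c) *
        ∫ G, stieltjes lam (design N G) ^ 2 ∂(gaussianPi (ι × κ) 1)) := by
  set σ : ℝ := (√(Fintype.card κ : ℝ))⁻¹ with hσ
  set d : ℝ := (Fintype.card κ : ℝ) with hd
  have hd1 : 1 ≤ d := by rw [hd]; exact_mod_cast Fintype.card_pos
  have hd0 : 0 < d := by linarith
  have hσ2 : σ ^ 2 = d⁻¹ := sq_inv_sqrt_card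
  have h := integral_trace_sq_stein hlam σ N
  have hmb := isBddCont_stieltjes N hlam
  have hkb := isBddCont_stieltjesSq N hlam
  have hT1 := isBddCont_trace_resolvent hlam σ N
  have hT2 := isBddCont_trace_resolvent_sq hlam σ N
  have hT3 := isBddCont_trace_resolvent_cube hlam σ N
  have hTN := isBddCont_trace_transpose_mul_mul_resolvent_sq hlam σ N
  have hb1 : IsBddCont (fun G => (resolvent lam (signalPlusNoise σ N G)).trace -
        lam * (resolvent lam (signalPlusNoise σ N G) *
          resolvent lam (signalPlusNoise σ N G)).trace) := hT1.sub (hT2.const_mul _)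
  have hb2 := (((((hT2.const_mul (Fintype.card ι)).sub
    ((hT2.sub (hT3.const_mul lam)).const_mul 2)).sub
      (((IsBddCont.const d).sub (hT1.const_mul lam)).mul hT2)).sub (hT1.mul hb1)).const_mul
        (σ ^ 2)).add hTN
  have hpt : ∀ G, c / 2 * stieltjesSq lam (design N G) -
      (1 + K ^ 2 / c + (2 + K ^ 2 / c) * stieltjes lam (design N G) ^ 2) ≤
      d⁻¹ * ((σ ^ 2 * (Fintype.card ι * (resolvent lam (signalPlusNoise σ N G) *
            resolvent lam (signalPlusNoise σ N G)).trace -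
          2 * ((resolvent lam (signalPlusNoise σ N G) *
            resolvent lam (signalPlusNoise σ N G)).trace -
            lam * (resolvent lam (signalPlusNoise σ N G) * resolvent lam (signalPlusNoise σ N G) *
              resolvent lam (signalPlusNoise σ N G)).trace) -
          (d - lam * (resolvent lam (signalPlusNoise σ N G)).trace) *
            (resolvent lam (signalPlusNoise σ N G) *
              resolvent lam (signalPlusNoise σ N G)).trace -
          (resolvent lam (signalPlusNoise σ N G)).trace *
            ((resolvent lam (signalPlusNoise σ N G)).trace -
              lam * (resolvent lam (signalPlusNoise σ N G) *
                resolvent lam (signalPlusNoise σ N G)).trace)) +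
          (Nᵀ * (signalPlusNoise σ N G * (resolvent lam (signalPlusNoise σ N G) *
            resolvent lam (signalPlusNoise σ N G)))).trace) -
        ((resolvent lam (signalPlusNoise σ N G)).trace -
        lam * (resolvent lam (signalPlusNoise σ N G) *
          resolvent lam (signalPlusNoise σ N G)).trace)) := by
    intro G
    rw [hσ2]
    change c / 2 * stieltjesSq lam (signalPlusNoise σ N G) -
      (1 + K ^ 2 / c + (2 + K ^ 2 / c) * stieltjes lam (signalPlusNoise σ N G) ^ 2) ≤ _
    set X := signalPlusNoise σ N G
    have hm : (resolvent lam X).trace = d * stieltjes lam X := by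
      rw [stieltjes, mul_div_cancel₀ _ hd0.ne']
    have hk : (resolvent lam X * resolvent lam X).trace = d * stieltjesSq lam X := by
      rw [stieltjesSq, mul_div_cancel₀ _ hd0.ne']
    have hm0 : 0 ≤ stieltjes lam X := div_nonneg (trace_resolvent_nonneg hlam _) hd0.le
    have hk0 : 0 ≤ stieltjesSq lam X := div_nonneg (trace_resolvent_sq_nonneg hlam _) hd0.le
    have hT := mul_nonneg hlam.le (trace_resolvent_cube_nonneg hlam X)
    have ht := abs_trace_transpose_mul_mul_resolvent_sq_le hlam X N hK hN
    rw [hm, hk] at ht ⊢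
    set m := stieltjes lam X
    set k := stieltjesSq lam X
    set t := (Nᵀ * (X * (resolvent lam X * resolvent lam X))).trace
    set T3 := (resolvent lam X * resolvent lam X * resolvent lam X).trace
    -- Young's inequality for `K √(m k)`, with the weights chosen so that the `k` part uses only a
    -- quarter of the coercivity.
    have ht' : -(t / d) ≤ c / 4 * k + K ^ 2 / c * m := by
      have h1 : √(d * m * (d * k)) = d * √(m * k) := by
        rw [show d * m * (d * k) = d ^ 2 * (m * k) by ring, Real.sqrt_mul (by positivity),
          Real.sqrt_sq hd0.le]
      rw [h1] at ht
      have h2 : -(t / d) ≤ K * √(m * k) := by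
        rw [← neg_div, div_le_iff₀ hd0]
        have := neg_le_abs t
        linarith
      refine h2.trans ?_
      have h3 : K * √(m * k) = √(K ^ 2 * (m * k)) := by
        rw [Real.sqrt_mul (sq_nonneg K), Real.sqrt_sq hK]
      rw [h3, Real.sqrt_le_left (by positivity)]
      have h4 : (c / 4 * k + K ^ 2 / c * m) ^ 2 - K ^ 2 * (m * k) =
          (c / 4 * k - K ^ 2 / c * m) ^ 2 := by field_simp; ring
      nlinarith [sq_nonneg (c / 4 * k - K ^ 2 / c * m)]
    have e : d⁻¹ * (d⁻¹ * (Fintype.card ι * (d * k) - 2 * (d * k - lam * T3) -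
        (d - lam * (d * m)) * (d * k) - d * m * (d * m - lam * (d * k))) + t -
        (d * m - lam * (d * k))) =
        (Fintype.card ι / d - 1) * k + 2 * (lam * m * k) + lam * k - 2 / d * k
          + 2 * (lam * T3) / d ^ 2 - m ^ 2 - m + t / d := by
      field_simp
      ring
    rw [e]
    have g1 : c * k ≤ (Fintype.card ι / d - 1) * k := by gcongr
    have g2 : 2 / d * k ≤ c / 4 * k := by gcongr
    have g3 : 0 ≤ lam * m * k := by positivity
    have g4 : 0 ≤ lam * k := by positivity
    have g5 : 0 ≤ 2 * (lam * T3) / d ^ 2 := by positivity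
    have g6 : m ≤ 1 + m ^ 2 := by nlinarith [sq_nonneg (m - 1)]
    have g7 : K ^ 2 / c * m ≤ K ^ 2 / c * (1 + m ^ 2) := by gcongr
    linarith
  have hI : ∫ G, (c / 2 * stieltjesSq lam (design N G) -
      (1 + K ^ 2 / c + (2 + K ^ 2 / c) * stieltjes lam (design N G) ^ 2))
        ∂(gaussianPi (ι × κ) 1) ≤ 0 := by
    refine (integral_mono ?_ ?_ hpt).trans (le_of_eq ?_)
    · exact ((hkb.const_mul _).sub ((IsBddCont.const _).add ((hmb.pow 2).const_mul _))).integrable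
    · exact ((hb2.sub hb1).const_mul _).integrable
    · rw [integral_const_mul, integral_sub hb2.integrable hb1.integrable, h]
      simp [hd]
  rw [integral_sub (hkb.const_mul _).integrable
    ((IsBddCont.const _).add ((hmb.pow 2).const_mul _)).integrable, integral_add
    (integrable_const _) ((hmb.pow 2).const_mul _).integrable, integral_const_mul,
    integral_const_mul] at hI
  simp only [integral_const, probReal_univ, one_smul] at hI
  rw [div_mul_eq_mul_div, le_div_iff₀ hc0]
  linarith

/-- Each moment is bounded by a multiple of the previous one through the Stein identity. Terms of
relative size `(1 + 2 p) / d` are subtracted from the coercive coefficient, hence the condition on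
`c` with a maximal order `P`. -/
theorem integral_quadForm_pow_le [Nonempty κ] {c : ℝ} (hc0 : 0 < c) (P : ℕ)
    (hc : c ≤ (Fintype.card ι : ℝ) / Fintype.card κ - 1 - (1 + 2 * P) / Fintype.card κ)
    (u : κ → ℝ) {p : ℕ} (hp : p ≤ P) :
    ∫ G, (u ⬝ᵥ (resolvent lam (design N G) *ᵥ u)) ^ p ∂(gaussianPi (ι × κ) 1) ≤
      (2 / c * (1 + K ^ 2 / (2 * c)) * (u ⬝ᵥ u)) ^ p := by
  set σ : ℝ := (√(Fintype.card κ : ℝ))⁻¹ with hσ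
  set d : ℝ := (Fintype.card κ : ℝ) with hd
  have hd1 : 1 ≤ d := by rw [hd]; exact_mod_cast Fintype.card_pos
  have hd0 : 0 < d := by linarith
  have hσ2 : σ ^ 2 = d⁻¹ := sq_inv_sqrt_card
  have huu : 0 ≤ u ⬝ᵥ u := by
    simpa [dotProduct] using Finset.sum_nonneg fun i _ => mul_self_nonneg _
  induction p with
  | zero => simp
  | succ p ih =>
    have ih := ih (by omega)
    have h := integral_quadForm_stein hlam σ N u p
    have hhb : IsBddCont (fun G => u ⬝ᵥ (resolvent lam (signalPlusNoise σ N G) *ᵥ u)) := by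
      simp only [dotProduct, mulVec]
      exact IsBddCont.sum _ fun i _ => (IsBddCont.sum _ fun j _ =>
        (isBddCont_resolvent hlam σ N i j).mul (IsBddCont.const _)).const_mul _
    have hvb : ∀ ν, IsBddCont (fun G => ((signalPlusNoise σ N G *
        resolvent lam (signalPlusNoise σ N G)) *ᵥ u) ν) := by
      intro ν
      simp only [dotProduct, mulVec]
      exact IsBddCont.sum _ fun j _ =>
        (isBddCont_mul_resolvent hlam σ N ν j).mul (IsBddCont.const _)
    have hsb : IsBddCont (fun G => ((signalPlusNoise σ N G * resolvent lam (signalPlusNoise σ N G))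
        *ᵥ u) ⬝ᵥ ((signalPlusNoise σ N G * resolvent lam (signalPlusNoise σ N G)) *ᵥ u)) :=
      IsBddCont.sum _ fun ν _ => (hvb ν).mul (hvb ν)
    have htb : IsBddCont (fun G => (N *ᵥ u) ⬝ᵥ
        ((signalPlusNoise σ N G * resolvent lam (signalPlusNoise σ N G)) *ᵥ u)) :=
      IsBddCont.sum _ fun ν _ => (hvb ν).const_mul _
    have hT1 := isBddCont_trace_resolvent hlam σ N
    have hL := (hhb.pow p).mul ((IsBddCont.const (u ⬝ᵥ u)).sub (hhb.const_mul lam))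
    have hRt := ((((hhb.pow p).mul (((hhb.const_mul (Fintype.card ι)).sub hsb).sub
      (((IsBddCont.const d).sub (hT1.const_mul lam)).mul hhb))).const_mul (σ ^ 2)).add
      ((hhb.pow p).mul htb)).sub (((hhb.pow p).mul hsb).const_mul (2 * σ ^ 2 * p))
    have h0 := integral_sub (μ := gaussianPi (ι × κ) 1) hRt.integrable hL.integrable
    rw [h, sub_eq_zero.2 rfl] at h0
    have hI : ∫ G, (c / 2 * (u ⬝ᵥ (resolvent lam (signalPlusNoise σ N G) *ᵥ u)) ^ (p + 1) -
        (1 + K ^ 2 / (2 * c)) * (u ⬝ᵥ u) * (u ⬝ᵥ (resolvent lam (signalPlusNoise σ N G) *ᵥ u)) ^ p)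
        ∂(gaussianPi (ι × κ) 1) ≤ 0 := by
      rw [← h0]
      refine integral_mono (((hhb.pow (p + 1)).const_mul _).sub
        ((hhb.pow p).const_mul _)).integrable (hRt.sub hL).integrable fun G => ?_
      simp only
      rw [hσ2]
      set X := signalPlusNoise σ N G
      have hw0 := quadForm_resolvent_nonneg hlam X u
      have hs := mulVec_mul_resolvent_dotProduct_self_le hlam X u
      have hs0 : 0 ≤ ((X * resolvent lam X) *ᵥ u) ⬝ᵥ ((X * resolvent lam X) *ᵥ u) := by
        simpa [dotProduct] using Finset.sum_nonneg fun i _ => mul_self_nonneg _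
      have ht := sq_mulVec_dotProduct_mul_resolvent_le hlam X N hK hN u
      have hT := mul_nonneg hlam.le (trace_resolvent_nonneg hlam X)
      set w := u ⬝ᵥ (resolvent lam X *ᵥ u)
      set s := ((X * resolvent lam X) *ᵥ u) ⬝ᵥ ((X * resolvent lam X) *ᵥ u)
      set t := (N *ᵥ u) ⬝ᵥ ((X * resolvent lam X) *ᵥ u)
      set v := u ⬝ᵥ u
      have ht' : -t ≤ c / 2 * w + K ^ 2 / (2 * c) * v := by
        have h1 : t ^ 2 ≤ (c / 2 * w + K ^ 2 / (2 * c) * v) ^ 2 := by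
          refine ht.trans ?_
          have h4 : (c / 2 * w + K ^ 2 / (2 * c) * v) ^ 2 - K ^ 2 * v * w =
            (c / 2 * w - K ^ 2 / (2 * c) * v) ^ 2 := by field_simp; ring
          nlinarith [sq_nonneg (c / 2 * w - K ^ 2 / (2 * c) * v)]
        have := abs_le_of_sq_le_sq h1 (by positivity)
        linarith [neg_le_abs t]
      -- A pointwise inequality at first order; multiplying it by `w ^ p ≥ 0` and integrating yields
      -- the recursion.
      have key : c / 2 * w - (1 + K ^ 2 / (2 * c)) * v ≤
          d⁻¹ * (Fintype.card ι * w - s - (d - lam * (resolvent lam X).trace) * w) + t -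
            2 * d⁻¹ * p * s - (v - lam * w) := by
        have hp' : (p : ℝ) ≤ P := by exact_mod_cast (by omega : p ≤ P)
        have e : d⁻¹ * (Fintype.card ι * w - s - (d - lam * (resolvent lam X).trace) * w) + t -
            2 * d⁻¹ * p * s - (v - lam * w) = (Fintype.card ι / d - 1) * w -
            (1 + 2 * p) / d * s + lam * (resolvent lam X).trace * w / d + lam * w + t - v := by
          field_simp
          ring
        rw [e]
        have g1 : (1 + 2 * p) / d * s ≤ (1 + 2 * P) / d * w := by gcongr
        have g2 : 0 ≤ lam * (resolvent lam X).trace * w / d := by positivity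
        have g3 : 0 ≤ lam * w := by positivity
        have g4 : c * w ≤ ((Fintype.card ι : ℝ) / d - 1 - (1 + 2 * P) / d) * w := by gcongr
        linarith
      have hwp : 0 ≤ w ^ p := by positivity
      have := mul_le_mul_of_nonneg_left key hwp
      rw [pow_succ]
      linarith
    rw [integral_sub ((hhb.pow (p + 1)).const_mul _).integrable
      ((hhb.pow p).const_mul _).integrable, integral_const_mul, integral_const_mul] at hI
    change ∫ G, (u ⬝ᵥ (resolvent lam (signalPlusNoise σ N G) *ᵥ u)) ^ p
      ∂(gaussianPi (ι × κ) 1) ≤ _ at ih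
    change ∫ G, (u ⬝ᵥ (resolvent lam (signalPlusNoise σ N G) *ᵥ u)) ^ (p + 1)
      ∂(gaussianPi (ι × κ) 1) ≤ _
    set J := ∫ G, (u ⬝ᵥ (resolvent lam (signalPlusNoise σ N G) *ᵥ u)) ^ (p + 1)
      ∂(gaussianPi (ι × κ) 1)
    set I := ∫ G, (u ⬝ᵥ (resolvent lam (signalPlusNoise σ N G) *ᵥ u)) ^ p
      ∂(gaussianPi (ι × κ) 1)
    have h1 : J ≤ 2 / c * (1 + K ^ 2 / (2 * c)) * (u ⬝ᵥ u) * I := by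
      have : J = 2 / c * (c / 2 * J) := by field_simp
      calc J = 2 / c * (c / 2 * J) := this
        _ ≤ 2 / c * ((1 + K ^ 2 / (2 * c)) * (u ⬝ᵥ u) * I) :=
          mul_le_mul_of_nonneg_left (by linarith) (by positivity)
        _ = _ := by ring
    refine h1.trans ((mul_le_mul_of_nonneg_left ih (by positivity)).trans (le_of_eq ?_))
    exact (pow_succ' _ p).symm

end GaussianMoments

end IsotropicGMM

namespace IsotropicGMM

open Matrix

/-! ### Gaussian quadratic forms -/

/-- `f` is continuous and grows at most polynomially. -/
def IsPolyCont {E : Type*} [NormedAddCommGroup E] (f : E → ℝ) : Prop :=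
  Continuous f ∧ ∃ (C : ℝ) (k : ℕ), 0 ≤ C ∧ ∀ x, |f x| ≤ C * (1 + ‖x‖) ^ k

namespace IsPolyCont

variable {E : Type*} [NormedAddCommGroup E] {f g : E → ℝ}

theorem const (c : ℝ) : IsPolyCont (fun _ : E => c) :=
  ⟨continuous_const, |c|, 0, abs_nonneg c, fun _ => by simp⟩

theorem add (hf : IsPolyCont f) (hg : IsPolyCont g) : IsPolyCont (fun x => f x + g x) := by
  obtain ⟨hf, C, k, hC0, hC⟩ := hf
  obtain ⟨hg, D, l, hD0, hD⟩ := hg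
  refine ⟨hf.add hg, C + D, k + l, by positivity, fun x => (abs_add_le _ _).trans ?_⟩
  have h1 : 1 ≤ 1 + ‖x‖ := by linarith [norm_nonneg x]
  rw [add_mul]
  refine add_le_add ((hC x).trans ?_) ((hD x).trans ?_)
  · exact mul_le_mul_of_nonneg_left (pow_le_pow_right₀ h1 (by omega)) (by assumption)
  · exact mul_le_mul_of_nonneg_left (pow_le_pow_right₀ h1 (by omega)) (by assumption)

theorem mul (hf : IsPolyCont f) (hg : IsPolyCont g) : IsPolyCont (fun x => f x * g x) := by
  obtain ⟨hf, C, k, hC0, hC⟩ := hf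
  obtain ⟨hg, D, l, hD0, hD⟩ := hg
  refine ⟨hf.mul hg, C * D, k + l, by positivity, fun x => ?_⟩
  rw [abs_mul, pow_add, mul_mul_mul_comm]
  exact mul_le_mul (hC x) (hD x) (abs_nonneg _) (by positivity)

theorem const_mul (c : ℝ) (hf : IsPolyCont f) : IsPolyCont (fun x => c * f x) := (const c).mul hf

theorem sum {α : Type*} (s : Finset α) {F : α → E → ℝ} (h : ∀ a ∈ s, IsPolyCont (F a)) :
    IsPolyCont (fun x => ∑ a ∈ s, F a x) := by
  classical
  induction s using Finset.induction_on with
  | empty => simpa using const 0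
  | insert a s ha ih =>
    simp only [Finset.sum_insert ha]
    exact (h a (Finset.mem_insert_self _ _)).add
      (ih fun b hb => h b (Finset.mem_insert_of_mem hb))

theorem eval {ι : Type*} [Fintype ι] (i : ι) : IsPolyCont (fun x : ι → ℝ => x i) :=
  ⟨continuous_apply i, 1, 1, zero_le_one, fun x => by
    have : |x i| ≤ ‖x‖ := norm_le_pi_norm x i
    simp only [pow_one, one_mul]; linarith⟩

theorem integrable {ι : Type*} [Fintype ι] {f : (ι → ℝ) → ℝ} (hf : IsPolyCont f) (v : ℝ≥0) :
    Integrable f (gaussianPi ι v) := by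
  obtain ⟨hf, C, k, hC0, hC⟩ := hf
  refine integrable_gaussianPi_of_le v hf (C * 2 ^ (k - 1)) k fun x => (hC x).trans ?_
  rw [mul_assoc]
  gcongr
  have := add_pow_le (zero_le_one' ℝ) (norm_nonneg x) k
  simpa using this

end IsPolyCont

set_option linter.unusedSectionVars false

variable {ι : Type*} [Fintype ι] [DecidableEq ι]

theorem IsPolyCont.mulVec (B : Matrix ι ι ℝ) (i : ι) : IsPolyCont (fun x : ι → ℝ => (B *ᵥ x) i) :=
  IsPolyCont.sum _ fun j _ => (IsPolyCont.eval j).const_mul _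

theorem IsPolyCont.quadForm (B : Matrix ι ι ℝ) : IsPolyCont (fun x : ι → ℝ => x ⬝ᵥ (B *ᵥ x)) :=
  IsPolyCont.sum _ fun i _ => (IsPolyCont.eval i).mul (IsPolyCont.mulVec B i)

theorem hasDerivAt_update_apply (x : ι → ℝ) (i j : ι) (t : ℝ) :
    HasDerivAt (fun s => Function.update x i s j) ((1 : Matrix ι ι ℝ) i j) t := by
  by_cases h : j = i
  · subst h
    simpa using hasDerivAt_id' t
  · simp only [Function.update_of_ne h, one_apply_ne (Ne.symm h)]
    exact hasDerivAt_const _ _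

theorem hasDerivAt_update_mulVec (B : Matrix ι ι ℝ) (x : ι → ℝ) (i k : ι) (t : ℝ) :
    HasDerivAt (fun s => (B *ᵥ Function.update x i s) k) (B k i) t := by
  have h : HasDerivAt (fun s => ∑ j, B k j * Function.update x i s j)
      (∑ j, B k j * (1 : Matrix ι ι ℝ) i j) t :=
    HasDerivAt.fun_sum fun j _ => (hasDerivAt_update_apply x i j t).const_mul _
  refine h.congr_deriv ?_
  simp [one_apply]

theorem hasDerivAt_update_quadForm {B : Matrix ι ι ℝ} (hB : Bᵀ = B) (x : ι → ℝ) (i : ι) (t : ℝ) :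
    HasDerivAt (fun s => Function.update x i s ⬝ᵥ (B *ᵥ Function.update x i s))
      (2 * (B *ᵥ Function.update x i t) i) t := by
  have h : HasDerivAt (fun s => ∑ k, Function.update x i s k * (B *ᵥ Function.update x i s) k)
      (∑ k, ((1 : Matrix ι ι ℝ) i k * (B *ᵥ Function.update x i t) k +
        Function.update x i t k * B k i)) t :=
    HasDerivAt.fun_sum fun k _ =>
      (hasDerivAt_update_apply x i k t).fun_mul (hasDerivAt_update_mulVec B x i k t)
  refine h.congr_deriv ?_
  rw [Finset.sum_add_distrib]
  have h1 : ∑ k, (1 : Matrix ι ι ℝ) i k * (B *ᵥ Function.update x i t) k =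
      (B *ᵥ Function.update x i t) i := by simp [one_apply]
  have h2 : ∑ k, Function.update x i t k * B k i = (B *ᵥ Function.update x i t) i := by
    refine Finset.sum_congr rfl fun k _ => ?_
    rw [mul_comm, ← transpose_apply B, hB]
  rw [h1, h2]
  ring

theorem integral_quadForm_gaussianPi (v : ℝ≥0) (B : Matrix ι ι ℝ) :
    ∫ x, x ⬝ᵥ (B *ᵥ x) ∂(gaussianPi ι v) = v * B.trace := by
  simp only [dotProduct]
  rw [integral_finsetSum _ fun i _ => ((IsPolyCont.eval i).mul (IsPolyCont.mulVec B i)).integrable v,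
    trace, Finset.mul_sum]
  refine Finset.sum_congr rfl fun i _ => ?_
  rw [integral_eval_mul_gaussianPi v i (f' := fun _ => B i i)
    (fun x t => hasDerivAt_update_mulVec B x i i t) ((IsPolyCont.mulVec B i).integrable v)
    (((IsPolyCont.eval i).mul (IsPolyCont.mulVec B i)).integrable v) (integrable_const _)]
  simp

/-- One factor `xᵀ B x` is written as the sum of `x i (B x) i` and integrated by parts. Symmetry of
`B` makes `2 B x` the gradient of the other factor, which leads back to the mean of quadratic forms
in `B` and `B²`. -/
theorem integral_quadForm_sq_gaussianPi (v : ℝ≥0) {B : Matrix ι ι ℝ} (hB : Bᵀ = B) :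
    ∫ x, (x ⬝ᵥ (B *ᵥ x)) ^ 2 ∂(gaussianPi ι v) =
      v ^ 2 * (B.trace ^ 2 + 2 * (B * B).trace) := by
  have hq := IsPolyCont.quadForm B
  have hm := fun i => IsPolyCont.mulVec B i
  have he : ∀ x : ι → ℝ, (x ⬝ᵥ (B *ᵥ x)) ^ 2 = ∑ i, x i * ((B *ᵥ x) i * (x ⬝ᵥ (B *ᵥ x))) := by
    intro x
    rw [pow_two]
    conv_lhs => rw [dotProduct, Finset.sum_mul]
    exact Finset.sum_congr rfl fun i _ => by rw [dotProduct]; ring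
  simp only [he]
  rw [integral_finsetSum _ fun i _ => ((IsPolyCont.eval i).mul ((hm i).mul hq)).integrable v]
  have h : ∀ i, ∫ x, x i * ((B *ᵥ x) i * (x ⬝ᵥ (B *ᵥ x))) ∂(gaussianPi ι v) =
      v * ∫ x, (B i i * (x ⬝ᵥ (B *ᵥ x)) + (B *ᵥ x) i * (2 * (B *ᵥ x) i)) ∂(gaussianPi ι v) := by
    intro i
    exact integral_eval_mul_gaussianPi v i
      (fun x t => (hasDerivAt_update_mulVec B x i i t).fun_mul (hasDerivAt_update_quadForm hB x i t))
      (((hm i).mul hq).integrable v) (((IsPolyCont.eval i).mul ((hm i).mul hq)).integrable v)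
      (((hq.const_mul _).add ((hm i).mul ((hm i).const_mul 2))).integrable v)
  simp only [h]
  rw [← Finset.mul_sum, ← integral_finsetSum _ fun i _ =>
    ((hq.const_mul _).add ((hm i).mul ((hm i).const_mul 2))).integrable v]
  have h2 : ∀ x : ι → ℝ, ∑ i, (B i i * (x ⬝ᵥ (B *ᵥ x)) + (B *ᵥ x) i * (2 * (B *ᵥ x) i)) =
      B.trace * (x ⬝ᵥ (B *ᵥ x)) + 2 * (x ⬝ᵥ ((B * B) *ᵥ x)) := by
    intro x
    have : x ⬝ᵥ ((B * B) *ᵥ x) = (B *ᵥ x) ⬝ᵥ (B *ᵥ x) := by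
      rw [← mulVec_mulVec, dotProduct_mulVec, ← mulVec_transpose, hB]
    rw [this, Finset.sum_add_distrib, ← Finset.sum_mul]
    congr 1
    rw [dotProduct, Finset.mul_sum]
    exact Finset.sum_congr rfl fun i _ => by ring
  simp only [h2]
  rw [integral_add ((hq.const_mul _).integrable v)
    (((IsPolyCont.quadForm (B * B)).const_mul 2).integrable v), integral_const_mul,
    integral_const_mul, integral_quadForm_gaussianPi, integral_quadForm_gaussianPi]
  ring

theorem integral_quadForm_sub_sq_gaussianPi (v : ℝ≥0) {B : Matrix ι ι ℝ} (hB : Bᵀ = B) :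
    ∫ x, (x ⬝ᵥ (B *ᵥ x) - v * B.trace) ^ 2 ∂(gaussianPi ι v) = 2 * v ^ 2 * (B * B).trace := by
  have hq := IsPolyCont.quadForm B
  have h : ∀ x : ι → ℝ, (x ⬝ᵥ (B *ᵥ x) - v * B.trace) ^ 2 =
      (x ⬝ᵥ (B *ᵥ x)) ^ 2 + (-(2 * (v * B.trace)) * (x ⬝ᵥ (B *ᵥ x)) + (v * B.trace) ^ 2) := by
    intro x; ring
  have hq2 : IsPolyCont (fun x : ι → ℝ => (x ⬝ᵥ (B *ᵥ x)) ^ 2) := by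
    simpa only [pow_two] using hq.mul hq
  simp only [h]
  rw [integral_add (hq2.integrable v) (((hq.const_mul _).add (IsPolyCont.const _)).integrable v),
    integral_add ((hq.const_mul _).integrable v) (integrable_const _), integral_const_mul,
    integral_quadForm_sq_gaussianPi v hB, integral_quadForm_gaussianPi]
  simp
  ring

end IsotropicGMM

namespace IsotropicGMM

open Matrix

section Ridge

set_option linter.unusedSectionVars false

variable {ι κ : Type*} [Fintype ι] [Fintype κ] [DecidableEq ι] [DecidableEq κ]

/-! ### Functions of the Gram matrix, seen from the row space -/

/-- The matrix `X f(Xᵀ X) Xᵀ`. -/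
noncomputable def rowFn (X : Matrix ι κ ℝ) (f : ℝ → ℝ) : Matrix ι ι ℝ := X * gramFn X f * Xᵀ

theorem rowFn_transpose (X : Matrix ι κ ℝ) (f : ℝ → ℝ) : (rowFn X f)ᵀ = rowFn X f := by
  rw [rowFn, transpose_mul, transpose_mul, transpose_transpose, gramFn_transpose, Matrix.mul_assoc]

theorem rowFn_mul (X : Matrix ι κ ℝ) (f g : ℝ → ℝ) :
    rowFn X f * rowFn X g = rowFn X (fun a => f a * a * g a) := by
  simp only [rowFn]
  calc X * gramFn X f * Xᵀ * (X * gramFn X g * Xᵀ)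
      = X * (gramFn X f * (Xᵀ * X) * gramFn X g) * Xᵀ := by simp only [Matrix.mul_assoc]
    _ = _ := by rw [← gramFn_id, gramFn_mul, gramFn_mul]

theorem trace_rowFn (X : Matrix ι κ ℝ) (f : ℝ → ℝ) :
    (rowFn X f).trace = (gramFn X (fun a => a * f a)).trace := by
  rw [rowFn, trace_mul_comm, ← Matrix.mul_assoc, ← gramFn_id, gramFn_mul]

theorem gramFn_mulVec_dotProduct_self (X : Matrix ι κ ℝ) (f : ℝ → ℝ) (v : κ → ℝ) :
    (gramFn X f *ᵥ v) ⬝ᵥ (gramFn X f *ᵥ v) = v ⬝ᵥ (gramFn X (fun a => f a * f a) *ᵥ v) := by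
  rw [← gramFn_mul, ← mulVec_mulVec v, dotProduct_mulVec v, ← mulVec_transpose, gramFn_transpose]

theorem dotProduct_rowFn (X : Matrix ι κ ℝ) (f : ℝ → ℝ) (ξ : ι → ℝ) :
    ξ ⬝ᵥ (rowFn X f *ᵥ ξ) = (Xᵀ *ᵥ ξ) ⬝ᵥ (gramFn X f *ᵥ (Xᵀ *ᵥ ξ)) := by
  rw [rowFn, ← mulVec_mulVec, ← mulVec_mulVec, dotProduct_mulVec ξ, ← mulVec_transpose]

theorem mulVec_gramFn_dotProduct_self (X : Matrix ι κ ℝ) (f : ℝ → ℝ) (v : κ → ℝ) :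
    (X *ᵥ (gramFn X f *ᵥ v)) ⬝ᵥ (X *ᵥ (gramFn X f *ᵥ v)) =
      v ⬝ᵥ (gramFn X (fun a => f a * a * f a) *ᵥ v) := by
  rw [← mul_gramFn_transpose_mul, ← mulVec_mulVec v, dotProduct_mulVec v, ← mulVec_transpose,
    transpose_transpose, mulVec_mulVec]

theorem one_sub_rowFn_mul_self (X : Matrix ι κ ℝ) (f : ℝ → ℝ) :
    (1 - rowFn X f) * (1 - rowFn X f) = 1 - rowFn X (fun a => 2 * f a - f a * a * f a) := by
  have h : rowFn X (fun a => 2 * f a - f a * a * f a) = (2 : ℝ) • rowFn X f - rowFn X f * rowFn X f := by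
    rw [rowFn_mul]
    simp only [rowFn]
    rw [← gramFn_sub, ← gramFn_smul, Matrix.mul_sub, Matrix.sub_mul, Matrix.mul_smul,
      Matrix.smul_mul]
  rw [h, Matrix.mul_sub, Matrix.mul_one, Matrix.sub_mul, Matrix.one_mul, two_smul]
  abel

/-! ### The ridge solution -/

/-- The ridge solution `(Xᵀ X + lam)⁻¹ Xᵀ y`. -/
noncomputable def ridgeSol (lam : ℝ) (X : Matrix ι κ ℝ) (y : ι → ℝ) : κ → ℝ :=
  resolvent lam X *ᵥ (Xᵀ *ᵥ y)

/-- The residual sum of squares. -/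
def rss (X : Matrix ι κ ℝ) (y : ι → ℝ) (θ : κ → ℝ) : ℝ := (y - X *ᵥ θ) ⬝ᵥ (y - X *ᵥ θ)

theorem dotProduct_self_nonneg' {α : Type*} [Fintype α] (v : α → ℝ) : 0 ≤ v ⬝ᵥ v :=
  Finset.sum_nonneg fun i _ => mul_self_nonneg (v i)

theorem add_dotProduct_self {α : Type*} [Fintype α] (v w : α → ℝ) :
    (v + w) ⬝ᵥ (v + w) = v ⬝ᵥ v + 2 * (v ⬝ᵥ w) + w ⬝ᵥ w := by
  rw [add_dotProduct, dotProduct_add, dotProduct_add, dotProduct_comm w v]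
  ring

theorem add_dotProduct_self_le {α : Type*} [Fintype α] (v w : α → ℝ) :
    (v + w) ⬝ᵥ (v + w) ≤ 2 * (v ⬝ᵥ v) + 2 * (w ⬝ᵥ w) := by
  have h := dotProduct_self_nonneg' (v - w)
  have e : (v - w) ⬝ᵥ (v - w) = v ⬝ᵥ v - 2 * (v ⬝ᵥ w) + w ⬝ᵥ w := by
    rw [sub_dotProduct, dotProduct_sub, dotProduct_sub, dotProduct_comm w v]
    ring
  rw [add_dotProduct_self]
  linarith

/-- Cauchy-Schwarz with Young's inequality. When `w ⬝ᵥ w` is of order `ε²`, both terms on the right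
are of order `ε`. -/
theorem abs_add_dotProduct_self_sub_le {α : Type*} [Fintype α] (v w : α → ℝ) {ε : ℝ} (hε : 0 < ε) :
    |(v + w) ⬝ᵥ (v + w) - v ⬝ᵥ v| ≤ ε * (v ⬝ᵥ v) + (1 / ε + 1) * (w ⬝ᵥ w) := by
  classical
  have hw := dotProduct_self_nonneg' w
  have hv := dotProduct_self_nonneg' v
  have h1 : 2 * |v ⬝ᵥ w| ≤ ε * (v ⬝ᵥ v) + 1 / ε * (w ⬝ᵥ w) := by
    have : (2 * |v ⬝ᵥ w|) ^ 2 ≤ (ε * (v ⬝ᵥ v) + 1 / ε * (w ⬝ᵥ w)) ^ 2 := by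
      have h2 := dotProduct_sq_le v w
      have h3 : (ε * (v ⬝ᵥ v) + 1 / ε * (w ⬝ᵥ w)) ^ 2 - 4 * ((v ⬝ᵥ v) * (w ⬝ᵥ w)) =
          (ε * (v ⬝ᵥ v) - 1 / ε * (w ⬝ᵥ w)) ^ 2 := by
        field_simp; ring
      rw [mul_pow, sq_abs]
      nlinarith [sq_nonneg (ε * (v ⬝ᵥ v) - 1 / ε * (w ⬝ᵥ w))]
    exact (pow_le_pow_iff_left₀ (by positivity) (by positivity) two_ne_zero).1 this
  rw [add_dotProduct_self]
  have e : v ⬝ᵥ v + 2 * (v ⬝ᵥ w) + w ⬝ᵥ w - v ⬝ᵥ v = 2 * (v ⬝ᵥ w) + w ⬝ᵥ w := by ring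
  rw [e]
  calc |2 * (v ⬝ᵥ w) + w ⬝ᵥ w| ≤ |2 * (v ⬝ᵥ w)| + |w ⬝ᵥ w| := abs_add_le _ _
    _ = 2 * |v ⬝ᵥ w| + w ⬝ᵥ w := by rw [abs_mul, abs_two, abs_of_nonneg hw]
    _ ≤ _ := by linarith

theorem rss_add_ridge (lam : ℝ) (hlam : 0 < lam) (X : Matrix ι κ ℝ) (y : ι → ℝ) (θ : κ → ℝ) :
    rss X y (ridgeSol lam X y) + lam * (ridgeSol lam X y ⬝ᵥ ridgeSol lam X y) ≤
      rss X y θ + lam * (θ ⬝ᵥ θ) := by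
  set s := ridgeSol lam X y with hs
  obtain ⟨e, rfl⟩ : ∃ e, θ = s + e := ⟨θ - s, by abel⟩
  -- The normal equation, which cancels the part linear in `e` of the increment of the objective.
  have hnormal : Xᵀ *ᵥ (y - X *ᵥ s) = lam • s := by
    have h1 : (Xᵀ * X + lam • (1 : Matrix κ κ ℝ)) * resolvent lam X = 1 :=
      mul_nonsing_inv _ (isUnit_det_gram_add hlam _)
    have h2 : (Xᵀ * X + lam • (1 : Matrix κ κ ℝ)) *ᵥ s = Xᵀ *ᵥ y := by
      rw [hs, ridgeSol, mulVec_mulVec, h1, one_mulVec]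
    rw [mulVec_sub, ← h2, add_mulVec, mulVec_mulVec, smul_mulVec, one_mulVec]
    abel
  have h3 : rss X y (s + e) = rss X y s - 2 * (lam * (s ⬝ᵥ e)) + (X *ᵥ e) ⬝ᵥ (X *ᵥ e) := by
    have : y - X *ᵥ (s + e) = (y - X *ᵥ s) + -(X *ᵥ e) := by rw [mulVec_add]; abel
    rw [rss, this, add_dotProduct_self, rss, dotProduct_neg, neg_dotProduct, dotProduct_neg,
      dotProduct_mulVec (y - X *ᵥ s), ← mulVec_transpose, hnormal, smul_dotProduct, smul_eq_mul]
    ring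
  rw [h3, add_dotProduct_self]
  have := dotProduct_self_nonneg' (X *ᵥ e)
  have := mul_nonneg hlam.le (dotProduct_self_nonneg' e)
  linarith

theorem rss_ridgeSol_mono {lam lam' : ℝ} (hlam : 0 < lam) (h : lam ≤ lam') (X : Matrix ι κ ℝ)
    (y : ι → ℝ) : rss X y (ridgeSol lam X y) ≤ rss X y (ridgeSol lam' X y) := by
  have h1 := rss_add_ridge lam hlam X y (ridgeSol lam' X y)
  have h2 := rss_add_ridge lam' (hlam.trans_le h) X y (ridgeSol lam X y)
  rcases h.eq_or_lt with rfl | h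
  · exact le_rfl
  · set a := ridgeSol lam X y ⬝ᵥ ridgeSol lam X y
    set b := ridgeSol lam' X y ⬝ᵥ ridgeSol lam' X y
    -- Adding the two minimality inequalities gives `(lam' - lam) (b - a) ≤ 0`: stronger
    -- regularization shrinks the solution. Minimality at `lam` then orders the residuals.
    have hba : b ≤ a := by
      by_contra hc
      push Not at hc
      nlinarith
    nlinarith

theorem le_rss_ridgeSol {lam lam' : ℝ} (hlam : 0 < lam) (h : lam ≤ lam') (X : Matrix ι κ ℝ)
    (y : ι → ℝ) : rss X y (ridgeSol lam' X y) - lam' * (ridgeSol lam X y ⬝ᵥ ridgeSol lam X y) ≤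
      rss X y (ridgeSol lam X y) := by
  have h2 := rss_add_ridge lam' (hlam.trans_le h) X y (ridgeSol lam X y)
  have := mul_nonneg (hlam.trans_le h).le (dotProduct_self_nonneg' (ridgeSol lam' X y))
  linarith

/-! ### Spectral bounds for the ridge path, its bias and its noise -/

/-- The matrix of the squared distance of two ridge solutions as a quadratic form in the noise. -/
noncomputable def pathForm (lam lam' : ℝ) (X : Matrix ι κ ℝ) : Matrix ι ι ℝ :=
  X * ((resolvent lam X - resolvent lam' X) * (resolvent lam X - resolvent lam' X)) * Xᵀ

/-- The matrix of the squared norm of the noise part of the ridge solution. -/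
noncomputable def noiseForm (lam : ℝ) (X : Matrix ι κ ℝ) : Matrix ι ι ℝ :=
  X * (resolvent lam X * resolvent lam X) * Xᵀ

/-- The matrix of the noise part of the residual sum of squares. -/
noncomputable def residualForm (lam : ℝ) (X : Matrix ι κ ℝ) : Matrix ι ι ℝ :=
  (1 - X * resolvent lam X * Xᵀ) * (1 - X * resolvent lam X * Xᵀ)

variable {lam lam' : ℝ} (hlam : 0 < lam) (X : Matrix ι κ ℝ)

include hlam

theorem noiseForm_eq : noiseForm lam X = rowFn X (fun a => (a + lam)⁻¹ * (a + lam)⁻¹) := by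
  rw [noiseForm, resolvent_sq_eq_gramFn hlam, rowFn]

theorem residualForm_eq : residualForm lam X =
    1 - rowFn X (fun a => 2 * (a + lam)⁻¹ - (a + lam)⁻¹ * a * (a + lam)⁻¹) := by
  rw [← one_sub_rowFn_mul_self, residualForm, resolvent_eq_gramFn hlam, rowFn]

theorem pathForm_eq (h : lam ≤ lam') : pathForm lam lam' X =
    rowFn X (fun a => ((a + lam)⁻¹ - (a + lam')⁻¹) * ((a + lam)⁻¹ - (a + lam')⁻¹)) := by
  rw [pathForm, resolvent_eq_gramFn hlam, resolvent_eq_gramFn (hlam.trans_le h), gramFn_sub,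
    gramFn_mul, rowFn]

theorem trace_noiseForm : (noiseForm lam X).trace =
    (resolvent lam X).trace - lam * (resolvent lam X * resolvent lam X).trace := by
  rw [noiseForm_eq hlam, trace_rowFn, resolvent_sq_eq_gramFn hlam, resolvent_eq_gramFn hlam,
    ← smul_eq_mul, ← trace_smul, ← trace_sub, gramFn_smul, gramFn_sub]
  congr 1
  refine gramFn_congr X fun a ha => ?_
  have : a + lam ≠ 0 := by positivity
  field_simp
  ring

theorem trace_noiseForm_sq_le : (noiseForm lam X * noiseForm lam X).trace ≤
    (resolvent lam X * resolvent lam X).trace := by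
  rw [noiseForm_eq hlam, rowFn_mul, trace_rowFn, resolvent_sq_eq_gramFn hlam]
  refine trace_gramFn_mono X fun a ha => ?_
  have h1 : a * (a + lam)⁻¹ ≤ 1 := by
    rw [mul_inv_le_iff₀ (by positivity)]; linarith
  have h2 : 0 ≤ (a + lam)⁻¹ := by positivity
  calc a * ((a + lam)⁻¹ * (a + lam)⁻¹ * a * ((a + lam)⁻¹ * (a + lam)⁻¹))
      = ((a * (a + lam)⁻¹) * (a * (a + lam)⁻¹)) * ((a + lam)⁻¹ * (a + lam)⁻¹) := by ring
    _ ≤ (1 * 1) * ((a + lam)⁻¹ * (a + lam)⁻¹) := by gcongr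
    _ = _ := by ring

theorem trace_residualForm : (residualForm lam X).trace =
    Fintype.card ι - Fintype.card κ + lam ^ 2 * (resolvent lam X * resolvent lam X).trace := by
  rw [residualForm_eq hlam, trace_sub, trace_one, trace_rowFn, resolvent_sq_eq_gramFn hlam]
  have : (gramFn X fun a => a * (2 * (a + lam)⁻¹ - (a + lam)⁻¹ * a * (a + lam)⁻¹)) =
      1 - lam ^ 2 • gramFn X (fun a => (a + lam)⁻¹ * (a + lam)⁻¹) := by
    rw [← gramFn_one X, gramFn_smul, gramFn_sub]
    refine gramFn_congr X fun a ha => ?_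
    have : a + lam ≠ 0 := by positivity
    field_simp
    ring
  rw [this, trace_sub, trace_one, trace_smul, smul_eq_mul]
  ring

/-- The eigenvalues of the residual form lie in `[0, 1]`. With `r = a / (a + lam)` they are `(1 -
r)²` on the row space and `1` on its complement; the proof shows that the deficit of the trace of
the square is nonnegative. -/
theorem trace_residualForm_sq_le : (residualForm lam X * residualForm lam X).trace ≤
    Fintype.card ι := by
  rw [residualForm_eq hlam, one_sub_rowFn_mul_self, trace_sub, trace_one, trace_rowFn, trace_gramFn]
  have : ∀ i, 0 ≤ gramEigenvalues X i := gramEigenvalues_nonneg X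
  have h : 0 ≤ ∑ i, (fun a => a * (2 * (2 * (a + lam)⁻¹ - (a + lam)⁻¹ * a * (a + lam)⁻¹) -
      (2 * (a + lam)⁻¹ - (a + lam)⁻¹ * a * (a + lam)⁻¹) * a *
        (2 * (a + lam)⁻¹ - (a + lam)⁻¹ * a * (a + lam)⁻¹))) (gramEigenvalues X i) := by
    refine Finset.sum_nonneg fun i _ => ?_
    simp only
    set a := gramEigenvalues X i
    have ha : 0 ≤ a := gramEigenvalues_nonneg X i
    have h0 : 0 ≤ a * (a + lam)⁻¹ := by positivity
    have h1 : a * (a + lam)⁻¹ ≤ 1 := by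
      rw [mul_inv_le_iff₀ (by positivity)]; linarith
    set r := a * (a + lam)⁻¹
    have e : a * (2 * (2 * (a + lam)⁻¹ - (a + lam)⁻¹ * a * (a + lam)⁻¹) -
      (2 * (a + lam)⁻¹ - (a + lam)⁻¹ * a * (a + lam)⁻¹) * a *
        (2 * (a + lam)⁻¹ - (a + lam)⁻¹ * a * (a + lam)⁻¹)) =
        (2 * r - r ^ 2) * (2 - (2 * r - r ^ 2)) := by
      simp only [r]; ring
    rw [e]
    refine mul_nonneg ?_ ?_ <;> nlinarith
  linarith

/-- With `g` the difference of the two spectral functions, `a g ≤ 1` gives `a g² ≤ g`. The noise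
part of the path is thus controlled by the drop of `tr R` between its ends. -/
theorem trace_pathForm_le (h : lam ≤ lam') : (pathForm lam lam' X).trace ≤
    (resolvent lam X).trace - (resolvent lam' X).trace := by
  have hlam' := hlam.trans_le h
  rw [pathForm_eq hlam X h, trace_rowFn, resolvent_eq_gramFn hlam, resolvent_eq_gramFn hlam',
    ← trace_sub, gramFn_sub]
  refine trace_gramFn_mono X fun a ha => ?_
  have h1 : a * (a + lam)⁻¹ ≤ 1 := by
    rw [mul_inv_le_iff₀ (by positivity)]; linarith
  have h2 : (a + lam')⁻¹ ≤ (a + lam)⁻¹ := by gcongr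
  have h3 : 0 ≤ (a + lam')⁻¹ := by positivity
  have h4 : a * ((a + lam)⁻¹ - (a + lam')⁻¹) ≤ 1 := by
    have := mul_nonneg ha h3
    linarith
  calc a * (((a + lam)⁻¹ - (a + lam')⁻¹) * ((a + lam)⁻¹ - (a + lam')⁻¹))
      = (a * ((a + lam)⁻¹ - (a + lam')⁻¹)) * ((a + lam)⁻¹ - (a + lam')⁻¹) := by ring
    _ ≤ 1 * ((a + lam)⁻¹ - (a + lam')⁻¹) := by
        have : 0 ≤ (a + lam)⁻¹ - (a + lam')⁻¹ := by linarith
        gcongr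
    _ = _ := one_mul _

theorem trace_pathForm_sq_le (h : lam ≤ lam') :
    (pathForm lam lam' X * pathForm lam lam' X).trace ≤
      (resolvent lam X * resolvent lam X).trace := by
  rw [pathForm_eq hlam X h, rowFn_mul, trace_rowFn, resolvent_sq_eq_gramFn hlam]
  refine trace_gramFn_mono X fun a ha => ?_
  have h1 : a * (a + lam)⁻¹ ≤ 1 := by
    rw [mul_inv_le_iff₀ (by positivity)]; linarith
  have h2 : (a + lam')⁻¹ ≤ (a + lam)⁻¹ := by gcongr
  have h3 : 0 ≤ (a + lam')⁻¹ := by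
    have := hlam.trans_le h
    positivity
  have h4 : 0 ≤ (a + lam)⁻¹ - (a + lam')⁻¹ := by linarith
  have h5 : (a + lam)⁻¹ - (a + lam')⁻¹ ≤ (a + lam)⁻¹ := by linarith
  set g := (a + lam)⁻¹ - (a + lam')⁻¹
  have h6 : a * g ≤ 1 := (mul_le_mul_of_nonneg_left h5 ha).trans h1
  calc a * (g * g * a * (g * g)) = ((a * g) * (a * g)) * (g * g) := by ring
    _ ≤ (1 * 1) * ((a + lam)⁻¹ * (a + lam)⁻¹) := by
        have : 0 ≤ a * g := by positivity
        gcongr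
    _ = _ := by ring

/-- By the resolvent identity the difference of the traces is `(lam' - lam) tr (R_lam R_lam')`, and
`lam' - lam ≥ lam' / 2`. The correction `lam' tr R²` to the noise norm is therefore small as soon as
both traces are near the same limit; no separate limit for `tr R²` is required. -/
theorem lam_mul_trace_resolvent_sq_le_sub (h : lam ≤ lam' / 2) :
    lam' * (resolvent lam' X * resolvent lam' X).trace ≤
      2 * ((resolvent lam X).trace - (resolvent lam' X).trace) := by
  have hlam' : 0 < lam' := by linarith
  rw [resolvent_sq_eq_gramFn hlam', resolvent_eq_gramFn hlam, resolvent_eq_gramFn hlam',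
    ← trace_sub, gramFn_sub, ← smul_eq_mul, ← trace_smul, gramFn_smul, ← smul_eq_mul (a := (2 : ℝ)),
    ← trace_smul, gramFn_smul]
  refine trace_gramFn_mono X fun a ha => ?_
  have e : (a + lam)⁻¹ - (a + lam')⁻¹ = (lam' - lam) * ((a + lam)⁻¹ * (a + lam')⁻¹) := by
    have : a + lam ≠ 0 := by positivity
    have : a + lam' ≠ 0 := by positivity
    field_simp
    ring
  rw [e]
  have h2 : (a + lam')⁻¹ ≤ (a + lam)⁻¹ := by gcongr; linarith
  have h3 : 0 ≤ (a + lam')⁻¹ := by positivity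
  calc lam' * ((a + lam')⁻¹ * (a + lam')⁻¹) ≤ (2 * (lam' - lam)) * ((a + lam)⁻¹ * (a + lam')⁻¹) :=
        mul_le_mul (by linarith) (mul_le_mul_of_nonneg_right h2 h3) (by positivity) (by linarith)
    _ = _ := by ring

/-- `(a + t)⁻¹` decreases in `t`, so along every eigenvector the distance to the solution at `lam₀`
grows as `t` decreases. The smallest regularization dominates the whole path. -/
theorem ridgeSol_path_le {lam₀ : ℝ} (h : lam ≤ lam') (h' : lam' ≤ lam₀) (y : ι → ℝ) :
    (ridgeSol lam' X y - ridgeSol lam₀ X y) ⬝ᵥ (ridgeSol lam' X y - ridgeSol lam₀ X y) ≤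
      (ridgeSol lam X y - ridgeSol lam₀ X y) ⬝ᵥ (ridgeSol lam X y - ridgeSol lam₀ X y) := by
  have hlam' := hlam.trans_le h
  have hlam₀ := hlam'.trans_le h'
  simp only [ridgeSol, ← sub_mulVec]
  rw [resolvent_eq_gramFn hlam, resolvent_eq_gramFn hlam', resolvent_eq_gramFn hlam₀, gramFn_sub,
    gramFn_sub, gramFn_mulVec_dotProduct_self, gramFn_mulVec_dotProduct_self]
  refine dotProduct_gramFn_mono X (fun a ha => ?_) _
  have h2 : (a + lam')⁻¹ ≤ (a + lam)⁻¹ := by gcongr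
  have h3 : (a + lam₀)⁻¹ ≤ (a + lam')⁻¹ := by gcongr
  have h4 : 0 ≤ (a + lam')⁻¹ - (a + lam₀)⁻¹ := by linarith
  exact mul_le_mul (by linarith) (by linarith) h4 (by linarith)

theorem ridgeSol_sub_le (h : lam ≤ lam') (θ₀ : κ → ℝ) (ξ : ι → ℝ) :
    (ridgeSol lam X (X *ᵥ θ₀ + ξ) - ridgeSol lam' X (X *ᵥ θ₀ + ξ)) ⬝ᵥ
      (ridgeSol lam X (X *ᵥ θ₀ + ξ) - ridgeSol lam' X (X *ᵥ θ₀ + ξ)) ≤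
      2 * (lam' * (θ₀ ⬝ᵥ (resolvent lam' X *ᵥ θ₀))) + 2 * (ξ ⬝ᵥ (pathForm lam lam' X *ᵥ ξ)) := by
  have hlam' := hlam.trans_le h
  set g : ℝ → ℝ := fun a => (a + lam)⁻¹ - (a + lam')⁻¹ with hg
  have e : ridgeSol lam X (X *ᵥ θ₀ + ξ) - ridgeSol lam' X (X *ᵥ θ₀ + ξ) =
      gramFn X (fun a => g a * a) *ᵥ θ₀ + gramFn X g *ᵥ (Xᵀ *ᵥ ξ) := by
    rw [ridgeSol, ridgeSol, ← sub_mulVec, resolvent_eq_gramFn hlam, resolvent_eq_gramFn hlam',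
      gramFn_sub, mulVec_add, mulVec_add, mulVec_mulVec _ Xᵀ X, ← gramFn_id, mulVec_mulVec θ₀,
      gramFn_mul]
  rw [e]
  refine (add_dotProduct_self_le _ _).trans ?_
  rw [gramFn_mulVec_dotProduct_self, gramFn_mulVec_dotProduct_self, pathForm_eq hlam X h,
    dotProduct_rowFn, ← smul_eq_mul lam', ← dotProduct_smul, ← smul_mulVec,
    resolvent_eq_gramFn hlam', gramFn_smul]
  gcongr
  refine dotProduct_gramFn_mono X (fun a ha => ?_) _
  have h1 : a * (a + lam)⁻¹ ≤ 1 := by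
    rw [mul_inv_le_iff₀ (by positivity)]; linarith
  have h2 : (a + lam')⁻¹ ≤ (a + lam)⁻¹ := by gcongr
  have h3 : 0 ≤ (a + lam')⁻¹ := by positivity
  have h4 : 0 ≤ g a := by simp only [hg]; linarith
  -- As this is also at most `1`, the square of `g a * a` has the same bound, which is the spectral
  -- function of `lam' R_lam'`. The signal part of the path is thus no larger than the bias quantity
  -- at the upper end.
  have h5 : g a * a ≤ lam' * (a + lam')⁻¹ := by
    have e1 : g a * a = (a * (a + lam)⁻¹) * ((lam' - lam) * (a + lam')⁻¹) := by
      have : a + lam ≠ 0 := by positivity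
      have : a + lam' ≠ 0 := by positivity
      simp only [hg]
      field_simp
      ring
    rw [e1]
    calc (a * (a + lam)⁻¹) * ((lam' - lam) * (a + lam')⁻¹) ≤ 1 * ((lam' - lam) * (a + lam')⁻¹) := by
          have : 0 ≤ lam' - lam := by linarith
          gcongr
      _ ≤ lam' * (a + lam')⁻¹ := by rw [one_mul]; gcongr; linarith
  have h6 : lam' * (a + lam')⁻¹ ≤ 1 := by
    rw [mul_inv_le_iff₀ (by positivity)]; linarith
  have h7 : 0 ≤ g a * a := by positivity
  calc g a * a * (g a * a) ≤ 1 * (lam' * (a + lam')⁻¹) := by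
        gcongr
        exact h5.trans h6
    _ = _ := one_mul _

theorem ridgeSol_eq (θ₀ : κ → ℝ) (ξ : ι → ℝ) :
    ridgeSol lam X (X *ᵥ θ₀ + ξ) =
      θ₀ + (resolvent lam X *ᵥ (Xᵀ *ᵥ ξ) + -(lam • (resolvent lam X *ᵥ θ₀))) := by
  have h : resolvent lam X * (Xᵀ * X) = 1 - lam • resolvent lam X := by
    have h1 : resolvent lam X * (Xᵀ * X + lam • (1 : Matrix κ κ ℝ)) = 1 :=
      nonsing_inv_mul _ (isUnit_det_gram_add hlam _)
    rw [Matrix.mul_add, Matrix.mul_smul, Matrix.mul_one] at h1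
    exact eq_sub_of_add_eq h1
  rw [ridgeSol, mulVec_add, mulVec_add, mulVec_mulVec _ Xᵀ X, mulVec_mulVec θ₀, h, sub_mulVec,
    one_mulVec, smul_mulVec]
  abel

theorem resolvent_mulVec_noise_dotProduct_self (ξ : ι → ℝ) :
    (resolvent lam X *ᵥ (Xᵀ *ᵥ ξ)) ⬝ᵥ (resolvent lam X *ᵥ (Xᵀ *ᵥ ξ)) =
      ξ ⬝ᵥ (noiseForm lam X *ᵥ ξ) := by
  rw [noiseForm_eq hlam, dotProduct_rowFn, resolvent_eq_gramFn hlam, gramFn_mulVec_dotProduct_self]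

theorem bias_dotProduct_self_le (θ₀ : κ → ℝ) :
    (lam • (resolvent lam X *ᵥ θ₀)) ⬝ᵥ (lam • (resolvent lam X *ᵥ θ₀)) ≤
      lam * (θ₀ ⬝ᵥ (resolvent lam X *ᵥ θ₀)) := by
  rw [← smul_mulVec, resolvent_eq_gramFn hlam, gramFn_smul, gramFn_mulVec_dotProduct_self,
    ← smul_eq_mul lam, ← dotProduct_smul, ← smul_mulVec, gramFn_smul]
  refine dotProduct_gramFn_mono X (fun a ha => ?_) _
  have h6 : lam * (a + lam)⁻¹ ≤ 1 := by
    rw [mul_inv_le_iff₀ (by positivity)]; linarith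
  have h7 : 0 ≤ lam * (a + lam)⁻¹ := by positivity
  nlinarith

theorem ridge_residual_eq (θ₀ : κ → ℝ) (ξ : ι → ℝ) :
    X *ᵥ θ₀ + ξ - X *ᵥ ridgeSol lam X (X *ᵥ θ₀ + ξ) =
      (1 - X * resolvent lam X * Xᵀ) *ᵥ ξ + X *ᵥ (lam • (resolvent lam X *ᵥ θ₀)) := by
  rw [ridgeSol_eq hlam, mulVec_add, mulVec_add, mulVec_neg, sub_mulVec, one_mulVec,
    ← mulVec_mulVec ξ, ← mulVec_mulVec (Xᵀ *ᵥ ξ)]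
  abel

theorem residual_noise_dotProduct_self (ξ : ι → ℝ) :
    ((1 - X * resolvent lam X * Xᵀ) *ᵥ ξ) ⬝ᵥ ((1 - X * resolvent lam X * Xᵀ) *ᵥ ξ) =
      ξ ⬝ᵥ (residualForm lam X *ᵥ ξ) := by
  rw [residualForm, ← mulVec_mulVec ξ, dotProduct_mulVec ξ, ← mulVec_transpose, transpose_sub,
    transpose_one, hat_transpose hlam]

theorem mulVec_bias_dotProduct_self_le (θ₀ : κ → ℝ) :
    (X *ᵥ (lam • (resolvent lam X *ᵥ θ₀))) ⬝ᵥ (X *ᵥ (lam • (resolvent lam X *ᵥ θ₀))) ≤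
      lam * (θ₀ ⬝ᵥ θ₀) := by
  rw [← smul_mulVec, resolvent_eq_gramFn hlam, gramFn_smul, mulVec_gramFn_dotProduct_self]
  have : lam * (θ₀ ⬝ᵥ θ₀) = θ₀ ⬝ᵥ (gramFn X (fun _ => lam) *ᵥ θ₀) := by
    rw [gramFn_const, smul_mulVec, one_mulVec, dotProduct_smul, smul_eq_mul]
  rw [this]
  refine dotProduct_gramFn_mono X (fun a ha => ?_) _
  have h6 : lam * (a + lam)⁻¹ ≤ 1 := by
    rw [mul_inv_le_iff₀ (by positivity)]; linarith
  have h1 : a * (a + lam)⁻¹ ≤ 1 := by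
    rw [mul_inv_le_iff₀ (by positivity)]; linarith
  calc lam * (a + lam)⁻¹ * a * (lam * (a + lam)⁻¹)
      = lam * ((a * (a + lam)⁻¹) * (lam * (a + lam)⁻¹)) := by ring
    _ ≤ lam * (1 * 1) := by gcongr
    _ = lam := by ring

theorem quadForm_resolvent_le (u : κ → ℝ) :
    u ⬝ᵥ (resolvent lam X *ᵥ u) ≤ lam⁻¹ * (u ⬝ᵥ u) := by
  have : lam⁻¹ * (u ⬝ᵥ u) = u ⬝ᵥ (gramFn X (fun _ => lam⁻¹) *ᵥ u) := by
    rw [gramFn_const, smul_mulVec, one_mulVec, dotProduct_smul, smul_eq_mul]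
  rw [this, resolvent_eq_gramFn hlam]
  refine dotProduct_gramFn_mono X (fun a ha => ?_) _
  gcongr
  linarith

end Ridge

end IsotropicGMM

namespace IsotropicGMM

open Matrix

section Typical

set_option linter.unusedSectionVars false

variable {ι κ : Type*} [Fintype ι] [Fintype κ] [DecidableEq ι] [DecidableEq κ]

/-! ### Ridge regression on a typical sample -/

/-- A design `X` and a noise vector `ξ` that are typical up to an error `ε ^ 2`, for the ridge
solutions with regularization between `lam` and `lam'`. -/
structure IsTypical (lam lam' ε τ Δ : ℝ) (θ₀ μ : κ → ℝ) (X : Matrix ι κ ℝ) (ξ : ι → ℝ) : Prop where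
  trace_low : |stieltjes lam X - τ| ≤ ε ^ 2
  trace_high : |stieltjes lam' X - τ| ≤ ε ^ 2
  bias : lam' * (θ₀ ⬝ᵥ (resolvent lam' X *ᵥ θ₀)) ≤ ε ^ 2 * Fintype.card κ
  path : |ξ ⬝ᵥ (pathForm lam lam' X *ᵥ ξ) - Δ * (pathForm lam lam' X).trace| ≤
    ε ^ 2 * Fintype.card κ
  noise : |ξ ⬝ᵥ (noiseForm lam' X *ᵥ ξ) - Δ * (noiseForm lam' X).trace| ≤ ε ^ 2 * Fintype.card κ
  cross : (μ ⬝ᵥ (resolvent lam' X *ᵥ (Xᵀ *ᵥ ξ))) ^ 2 ≤ ε ^ 2 * (Fintype.card κ : ℝ) ^ 2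
  residual : |ξ ⬝ᵥ (residualForm lam' X *ᵥ ξ) - Δ * (residualForm lam' X).trace| ≤
    ε ^ 2 * Fintype.card ι

variable [Nonempty κ] {lam lam' ε τ Δ : ℝ} {θ₀ μ : κ → ℝ} {X : Matrix ι κ ℝ} {ξ : ι → ℝ}

/-- The constant that bounds the squared distance to the noise part of the ridge solution. -/
def deviationConst (Δ : ℝ) : ℝ := 10 + 8 * Δ

/-- The constant in the bound for the squared estimation error. -/
def errorConst (Δ τ : ℝ) : ℝ := 2 * (1 + 5 * Δ) + Δ * τ + 2 * deviationConst Δ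

/-- At every `t` in the interval the estimation error is the noise part at the fixed upper end
`lam'`, plus a remainder made of the bias at `lam'` and the path from `lam'` to `t`. -/
theorem IsTypical.exists_error_eq (h : IsTypical lam lam' ε τ Δ θ₀ μ X ξ) (hlam : 0 < lam)
    (hlam' : lam ≤ lam' / 2) (hΔ : 0 ≤ Δ) {t : ℝ} (ht : lam ≤ t) (ht' : t ≤ lam') :
    ∃ e, ridgeSol t X (X *ᵥ θ₀ + ξ) - θ₀ = resolvent lam' X *ᵥ (Xᵀ *ᵥ ξ) + e ∧
      e ⬝ᵥ e ≤ deviationConst Δ * ε ^ 2 * Fintype.card κ := by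
  have h0' : 0 < lam' := by linarith
  have hd : (0 : ℝ) < Fintype.card κ := by exact_mod_cast Fintype.card_pos
  refine ⟨-(lam' • (resolvent lam' X *ᵥ θ₀)) +
    (ridgeSol t X (X *ᵥ θ₀ + ξ) - ridgeSol lam' X (X *ᵥ θ₀ + ξ)), ?_, ?_⟩
  · rw [ridgeSol_eq h0']
    abel
  · refine (add_dotProduct_self_le _ _).trans ?_
    rw [neg_dotProduct, dotProduct_neg, neg_neg]
    have h1 := bias_dotProduct_self_le h0' X θ₀
    have h2 := ridgeSol_path_le hlam X ht ht' (X *ᵥ θ₀ + ξ)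
    have h3 := ridgeSol_sub_le hlam X (by linarith : lam ≤ lam') θ₀ ξ
    have h4 := trace_pathForm_le hlam X (by linarith : lam ≤ lam')
    have h5 := (abs_le.1 h.path).2
    have h6 := (abs_le.1 h.trace_low).2
    have h7 := (abs_le.1 h.trace_high).1
    have h8 : (resolvent lam X).trace - (resolvent lam' X).trace ≤ 2 * ε ^ 2 * Fintype.card κ := by
      have e1 : (resolvent lam X).trace = stieltjes lam X * Fintype.card κ := by
        rw [stieltjes, div_mul_cancel₀ _ hd.ne']
      have e2 : (resolvent lam' X).trace = stieltjes lam' X * Fintype.card κ := by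
        rw [stieltjes, div_mul_cancel₀ _ hd.ne']
      rw [e1, e2, ← sub_mul]
      gcongr
      linarith
    have h9 : Δ * (pathForm lam lam' X).trace ≤ Δ * (2 * ε ^ 2 * Fintype.card κ) :=
      mul_le_mul_of_nonneg_left (h4.trans h8) hΔ
    have h10 := h.bias
    -- In units of `ε² d`: `2` from the bias, `4 + 4` from the signal and the fluctuation along the
    -- path, and `8 Δ` from the trace of the path form.
    rw [deviationConst]
    linarith

theorem IsTypical.abs_noise_sub_le (h : IsTypical lam lam' ε τ Δ θ₀ μ X ξ) (hlam : 0 < lam)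
    (hlam' : lam ≤ lam' / 2) (hΔ : 0 ≤ Δ) :
    |(resolvent lam' X *ᵥ (Xᵀ *ᵥ ξ)) ⬝ᵥ (resolvent lam' X *ᵥ (Xᵀ *ᵥ ξ)) / Fintype.card κ - Δ * τ| ≤
      (1 + 5 * Δ) * ε ^ 2 := by
  have h0' : 0 < lam' := by linarith
  have hd : (0 : ℝ) < Fintype.card κ := by exact_mod_cast Fintype.card_pos
  rw [resolvent_mulVec_noise_dotProduct_self h0']
  have h1 := h.noise
  rw [trace_noiseForm h0'] at h1
  have h2 := lam_mul_trace_resolvent_sq_le_sub hlam X hlam'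
  have h3 := mul_nonneg h0'.le (trace_resolvent_sq_nonneg h0' X)
  have e1 : (resolvent lam X).trace = stieltjes lam X * Fintype.card κ := by
    rw [stieltjes, div_mul_cancel₀ _ hd.ne']
  have e2 : (resolvent lam' X).trace = stieltjes lam' X * Fintype.card κ := by
    rw [stieltjes, div_mul_cancel₀ _ hd.ne']
  rw [e1, e2] at h2
  rw [e2] at h1
  obtain ⟨k, hk⟩ : ∃ k, lam' * (resolvent lam' X * resolvent lam' X).trace = k * Fintype.card κ :=
    ⟨_, (div_mul_cancel₀ _ hd.ne').symm⟩
  obtain ⟨q, hq⟩ : ∃ q, ξ ⬝ᵥ (noiseForm lam' X *ᵥ ξ) = q * Fintype.card κ :=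
    ⟨_, (div_mul_cancel₀ _ hd.ne').symm⟩
  rw [hk] at h1 h2 h3
  rw [hq] at h1 ⊢
  have hk0 : 0 ≤ k := nonneg_of_mul_nonneg_left h3 hd
  have hk2 : k ≤ 2 * (stieltjes lam X - stieltjes lam' X) := by
    refine le_of_mul_le_mul_right ?_ hd
    linarith
  have h4 : |q - Δ * (stieltjes lam' X - k)| ≤ ε ^ 2 := by
    refine le_of_mul_le_mul_right ?_ hd
    refine le_trans (le_of_eq ?_) h1
    rw [← abs_of_pos hd, ← abs_mul, abs_of_pos hd]
    congr 1
    ring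
  rw [mul_div_cancel_right₀ _ hd.ne']
  have h5 := h.trace_low
  have h6 := h.trace_high
  rw [abs_le] at h4 h5 h6 ⊢
  -- The constant `5` is `1` for the deviation of the trace at `lam'` plus `4` for `k`, which is at
  -- most twice a difference of two traces each within `ε²` of `τ`.
  have h7 : Δ * (stieltjes lam' X - k - τ) ≤ Δ * (5 * ε ^ 2) :=
    mul_le_mul_of_nonneg_left (by linarith) hΔ
  have h8 : Δ * (-(5 * ε ^ 2)) ≤ Δ * (stieltjes lam' X - k - τ) :=
    mul_le_mul_of_nonneg_left (by linarith) hΔ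
  constructor <;> linarith

theorem IsTypical.abs_error_sub_le (h : IsTypical lam lam' ε τ Δ θ₀ μ X ξ) (hlam : 0 < lam)
    (hlam' : lam ≤ lam' / 2) (hΔ : 0 ≤ Δ) (hε : 0 < ε) (hε1 : ε ≤ 1) {t : ℝ}
    (ht : lam ≤ t) (ht' : t ≤ lam') :
    |(ridgeSol t X (X *ᵥ θ₀ + ξ) - θ₀) ⬝ᵥ (ridgeSol t X (X *ᵥ θ₀ + ξ) - θ₀) / Fintype.card κ -
      Δ * τ| ≤ errorConst Δ τ * ε := by
  have hd : (0 : ℝ) < Fintype.card κ := by exact_mod_cast Fintype.card_pos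
  obtain ⟨e, he, hee⟩ := h.exists_error_eq hlam hlam' hΔ ht ht'
  have hb := h.abs_noise_sub_le hlam hlam' hΔ
  rw [he]
  set b := resolvent lam' X *ᵥ (Xᵀ *ᵥ ξ)
  have h1 := abs_add_dotProduct_self_sub_le b e hε
  have hE : 0 ≤ deviationConst Δ := by rw [deviationConst]; positivity
  have h2 : (1 / ε + 1) * (e ⬝ᵥ e) ≤ 2 * deviationConst Δ * ε * Fintype.card κ := by
    calc (1 / ε + 1) * (e ⬝ᵥ e)
        ≤ (1 / ε + 1) * (deviationConst Δ * ε ^ 2 * Fintype.card κ) := by gcongr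
      _ = deviationConst Δ * (ε + ε ^ 2) * Fintype.card κ := by field_simp
      _ ≤ deviationConst Δ * (2 * ε) * Fintype.card κ := by
          gcongr
          nlinarith
      _ = _ := by ring
  have h3 : |(b + e) ⬝ᵥ (b + e) / Fintype.card κ - b ⬝ᵥ b / Fintype.card κ| ≤
      ε * (b ⬝ᵥ b / Fintype.card κ) + 2 * deviationConst Δ * ε := by
    rw [← sub_div, abs_div, abs_of_pos hd, div_le_iff₀ hd, add_mul, mul_assoc ε,
      div_mul_cancel₀ _ hd.ne']
    linarith
  have hε2 : ε ^ 2 ≤ ε := by nlinarith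
  have h5 : (1 + 5 * Δ) * ε ^ 2 ≤ (1 + 5 * Δ) * ε := by gcongr
  have h4 : ε * (b ⬝ᵥ b / Fintype.card κ) ≤ ε * (Δ * τ + (1 + 5 * Δ)) := by
    gcongr
    have := (abs_le.1 hb).2
    have : (1 + 5 * Δ) * ε ≤ (1 + 5 * Δ) * 1 := by gcongr
    linarith
  have h6 := abs_sub_le ((b + e) ⬝ᵥ (b + e) / Fintype.card κ) (b ⬝ᵥ b / Fintype.card κ) (Δ * τ)
  rw [errorConst]
  linarith

/-- The generalization error of the ridge solutions on a typical sample. -/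
theorem IsTypical.abs_genError_sub_le (h : IsTypical lam lam' ε τ Δ θ₀ μ X ξ) (hlam : 0 < lam)
    (hlam' : lam ≤ lam' / 2) (hΔ : 0 ≤ Δ) (hε : 0 < ε) (hε1 : ε ≤ 1) {Γ : ℝ}
    (hμ : μ ⬝ᵥ μ ≤ Γ * Fintype.card κ) {t : ℝ} (ht : lam ≤ t) (ht' : t ≤ lam') :
    |Δ + (ridgeSol t X (X *ᵥ θ₀ + ξ) - θ₀) ⬝ᵥ (ridgeSol t X (X *ᵥ θ₀ + ξ) - θ₀) / Fintype.card κ +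
      (μ ⬝ᵥ (ridgeSol t X (X *ᵥ θ₀ + ξ) - θ₀) / Fintype.card κ) ^ 2 - Δ * (1 + τ)| ≤
      (errorConst Δ τ + 2 + 2 * Γ * deviationConst Δ) * ε := by
  have hd : (0 : ℝ) < Fintype.card κ := by exact_mod_cast Fintype.card_pos
  have h1 := h.abs_error_sub_le hlam hlam' hΔ hε hε1 ht ht'
  have hE : 0 ≤ deviationConst Δ := by rw [deviationConst]; positivity
  have hΓ : 0 ≤ Γ := by
    have := (dotProduct_self_nonneg' μ).trans hμ
    exact nonneg_of_mul_nonneg_left this hd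
  have h2 : (μ ⬝ᵥ (ridgeSol t X (X *ᵥ θ₀ + ξ) - θ₀) / Fintype.card κ) ^ 2 ≤
      (2 + 2 * Γ * deviationConst Δ) * ε := by
    -- Against the noise part, `μ` is handled by the typicality condition `cross`; against the
    -- remainder, Cauchy-Schwarz with `μ ⬝ᵥ μ = O(d)` suffices.
    obtain ⟨e, he, hee⟩ := h.exists_error_eq hlam hlam' hΔ ht ht'
    rw [he, dotProduct_add, div_pow, div_le_iff₀ (by positivity)]
    have h3 := h.cross
    set a := μ ⬝ᵥ (resolvent lam' X *ᵥ (Xᵀ *ᵥ ξ))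
    have h4 : (μ ⬝ᵥ e) ^ 2 ≤
        (Γ * Fintype.card κ) * (deviationConst Δ * ε ^ 2 * Fintype.card κ) :=
      (dotProduct_sq_le μ e).trans (mul_le_mul hμ hee (dotProduct_self_nonneg' e) (by positivity))
    calc (a + μ ⬝ᵥ e) ^ 2 ≤ 2 * a ^ 2 + 2 * (μ ⬝ᵥ e) ^ 2 := by
          nlinarith [sq_nonneg (a - μ ⬝ᵥ e)]
      _ ≤ 2 * (ε ^ 2 * (Fintype.card κ : ℝ) ^ 2) +
          2 * ((Γ * Fintype.card κ) * (deviationConst Δ * ε ^ 2 * Fintype.card κ)) := by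
          linarith
      _ = (2 + 2 * Γ * deviationConst Δ) * ε ^ 2 * (Fintype.card κ : ℝ) ^ 2 := by ring
      _ ≤ (2 + 2 * Γ * deviationConst Δ) * ε * (Fintype.card κ : ℝ) ^ 2 := by
          gcongr
          nlinarith
  have h3 : 0 ≤ (μ ⬝ᵥ (ridgeSol t X (X *ᵥ θ₀ + ξ) - θ₀) / Fintype.card κ) ^ 2 := sq_nonneg _
  rw [abs_le] at h1 ⊢
  have h4 : 0 ≤ (2 + 2 * Γ * deviationConst Δ) * ε := by positivity
  constructor <;> linarith

/-- The training error of the ridge solutions on a typical sample. -/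
theorem IsTypical.abs_trainError_sub_le (h : IsTypical lam lam' ε τ Δ θ₀ μ X ξ) (hlam : 0 < lam)
    (hlam' : lam ≤ lam' / 2) (hΔ : 0 ≤ Δ) (hτ : 0 ≤ τ) (hε : 0 < ε) (hε1 : ε ≤ 1) {β : ℝ}
    (hβ0 : 0 ≤ β) (hβ : |(Fintype.card κ : ℝ) / Fintype.card ι - β| ≤ ε ^ 2)
    (hcard : Fintype.card κ ≤ Fintype.card ι)
    (hθ : lam' * (θ₀ ⬝ᵥ θ₀) ≤ ε ^ 2 * Fintype.card κ) (hl1 : lam' * (τ + 1) ≤ ε ^ 2)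
    (hl2 : lam' * (Δ * τ + errorConst Δ τ) ≤ ε ^ 2) {t : ℝ} (ht : lam ≤ t) (ht' : t ≤ lam') :
    |rss X (X *ᵥ θ₀ + ξ) (ridgeSol t X (X *ᵥ θ₀ + ξ)) / Fintype.card ι - Δ * (1 - β)| ≤
      (8 + 5 * Δ) * ε := by
  have h0' : 0 < lam' := by linarith
  have hd : (0 : ℝ) < Fintype.card κ := by exact_mod_cast Fintype.card_pos
  have hdn : (Fintype.card κ : ℝ) ≤ Fintype.card ι := by exact_mod_cast hcard
  have hn : (0 : ℝ) < Fintype.card ι := hd.trans_le hdn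
  have hε2 : ε ^ 2 ≤ ε := by nlinarith
  set y := X *ᵥ θ₀ + ξ with hy
  set q := (1 - X * resolvent lam' X * Xᵀ) *ᵥ ξ with hq
  have hqq : q ⬝ᵥ q = ξ ⬝ᵥ (residualForm lam' X *ᵥ ξ) := residual_noise_dotProduct_self h0' X ξ
  have hm1 : stieltjes lam' X ≤ τ + 1 := by
    have := (abs_le.1 h.trace_high).2
    linarith
  have hq1 : |q ⬝ᵥ q / Fintype.card ι - Δ * (1 - β)| ≤ (1 + 2 * Δ) * ε ^ 2 := by
    have h1 := h.residual
    rw [← hqq, trace_residualForm h0'] at h1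
    have h2 : lam' ^ 2 * (resolvent lam' X * resolvent lam' X).trace ≤
        ε ^ 2 * Fintype.card ι := by
      calc lam' ^ 2 * (resolvent lam' X * resolvent lam' X).trace
          = lam' * (lam' * (resolvent lam' X * resolvent lam' X).trace) := by ring
        _ ≤ lam' * (resolvent lam' X).trace := by
            gcongr
            exact lam_mul_trace_resolvent_sq_le h0' X
        _ = lam' * stieltjes lam' X * Fintype.card κ := by
            rw [stieltjes, mul_assoc, div_mul_cancel₀ _ hd.ne']
        _ ≤ lam' * (τ + 1) * Fintype.card ι := by gcongr
        _ ≤ _ := by gcongr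
    have h3 : 0 ≤ lam' ^ 2 * (resolvent lam' X * resolvent lam' X).trace :=
      mul_nonneg (by positivity) (trace_resolvent_sq_nonneg h0' X)
    set k := lam' ^ 2 * (resolvent lam' X * resolvent lam' X).trace
    have e : q ⬝ᵥ q / Fintype.card ι - Δ * (1 - β) =
        (q ⬝ᵥ q - Δ * (Fintype.card ι - Fintype.card κ + k)) / Fintype.card ι +
        Δ * (k / Fintype.card ι) - Δ * ((Fintype.card κ : ℝ) / Fintype.card ι - β) := by
      field_simp
      ring
    have h4 : |(q ⬝ᵥ q - Δ * (Fintype.card ι - Fintype.card κ + k)) / Fintype.card ι| ≤ ε ^ 2 := by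
      rwa [abs_div, abs_of_pos hn, div_le_iff₀ hn]
    have h5 : k / Fintype.card ι ≤ ε ^ 2 := by rwa [div_le_iff₀ hn]
    have h6 : 0 ≤ k / Fintype.card ι := by positivity
    rw [e]
    rw [abs_le] at h4 hβ ⊢
    have g1 : Δ * (k / Fintype.card ι) ≤ Δ * ε ^ 2 := by gcongr
    have g2 : 0 ≤ Δ * (k / Fintype.card ι) := by positivity
    have g3 := mul_le_mul_of_nonneg_left hβ.1 hΔ
    have g4 := mul_le_mul_of_nonneg_left hβ.2 hΔ
    constructor <;> linarith
  have hrss' : |rss X y (ridgeSol lam' X y) / Fintype.card ι - q ⬝ᵥ q / Fintype.card ι| ≤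
      (3 + 3 * Δ) * ε := by
    rw [rss, hy, ridge_residual_eq h0', ← hq, ← sub_div, abs_div, abs_of_pos hn, div_le_iff₀ hn]
    refine (abs_add_dotProduct_self_sub_le _ _ hε).trans ?_
    have h1 := mulVec_bias_dotProduct_self_le h0' X θ₀
    set p := X *ᵥ (lam' • (resolvent lam' X *ᵥ θ₀))
    have h2 : p ⬝ᵥ p ≤ ε ^ 2 * Fintype.card ι := h1.trans (hθ.trans (by gcongr))
    have h3 : q ⬝ᵥ q ≤ (1 + 3 * Δ) * Fintype.card ι := by
      rw [← div_le_iff₀ hn]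
      have := (abs_le.1 hq1).2
      have : (1 + 2 * Δ) * ε ^ 2 ≤ (1 + 2 * Δ) * 1 := by
        gcongr
        linarith
      have : 0 ≤ Δ * β := by positivity
      linarith
    calc ε * (q ⬝ᵥ q) + (1 / ε + 1) * (p ⬝ᵥ p)
        ≤ ε * ((1 + 3 * Δ) * Fintype.card ι) + (1 / ε + 1) * (ε ^ 2 * Fintype.card ι) := by gcongr
      _ = (ε * (1 + 3 * Δ) + (ε + ε ^ 2)) * Fintype.card ι := by field_simp
      _ ≤ (ε * (1 + 3 * Δ) + (ε + ε)) * Fintype.card ι := by gcongr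
      _ = _ := by ring
  have ht0 : 0 < t := hlam.trans_le ht
  have hup : rss X y (ridgeSol t X y) / Fintype.card ι ≤
      rss X y (ridgeSol lam' X y) / Fintype.card ι := by
    gcongr
    exact rss_ridgeSol_mono ht0 ht' X y
  -- The residual increases with the regularization, and minimality at `lam'` limits the drop to
  -- `lam'` times the squared norm of the solution at `t`. This sandwiches all `t` at once.
  have hlow : rss X y (ridgeSol lam' X y) / Fintype.card ι - 4 * ε ^ 2 ≤
      rss X y (ridgeSol t X y) / Fintype.card ι := by
    have h1 := le_rss_ridgeSol ht0 ht' X y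
    have h2 := (abs_le.1 (h.abs_error_sub_le hlam hlam' hΔ hε hε1 ht ht')).2
    rw [← hy] at h2
    set w := ridgeSol t X y - θ₀ with hw
    have h3 : ridgeSol t X y ⬝ᵥ ridgeSol t X y ≤ 2 * (θ₀ ⬝ᵥ θ₀) + 2 * (w ⬝ᵥ w) := by
      have : ridgeSol t X y = θ₀ + w := by rw [hw]; abel
      rw [this]
      exact add_dotProduct_self_le _ _
    have hE : 0 ≤ errorConst Δ τ := by rw [errorConst, deviationConst]; positivity
    have h4 : w ⬝ᵥ w ≤ (Δ * τ + errorConst Δ τ) * Fintype.card κ := by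
      rw [← div_le_iff₀ hd]
      have : errorConst Δ τ * ε ≤ errorConst Δ τ * 1 := by gcongr
      linarith
    have h5 : lam' * (ridgeSol t X y ⬝ᵥ ridgeSol t X y) ≤ 4 * ε ^ 2 * Fintype.card ι := by
      calc lam' * (ridgeSol t X y ⬝ᵥ ridgeSol t X y)
          ≤ lam' * (2 * (θ₀ ⬝ᵥ θ₀) + 2 * ((Δ * τ + errorConst Δ τ) * Fintype.card κ)) := by
            gcongr
            linarith
        _ = 2 * (lam' * (θ₀ ⬝ᵥ θ₀)) +
            2 * (lam' * (Δ * τ + errorConst Δ τ) * Fintype.card κ) := by ring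
        _ ≤ 2 * (ε ^ 2 * Fintype.card ι) + 2 * (ε ^ 2 * Fintype.card ι) := by
            have g1 := hθ.trans (mul_le_mul_of_nonneg_left hdn (sq_nonneg ε))
            have g2 := mul_le_mul hl2 hdn hd.le (sq_nonneg ε)
            linarith
        _ = _ := by ring
    rw [sub_le_iff_le_add, div_le_iff₀ hn, add_mul, div_mul_cancel₀ _ hn.ne']
    linarith
  have g1 : (1 + 2 * Δ) * ε ^ 2 ≤ (1 + 2 * Δ) * ε := by gcongr
  rw [abs_le] at hq1 hrss' ⊢
  constructor <;> linarith

end Typical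

end IsotropicGMM

namespace IsotropicGMM

open Matrix

set_option linter.unusedSectionVars false

/-! ### Deviation inequalities -/

theorem measure_ge_le_of_integral_le {E : Type*} [MeasurableSpace E] {P : Measure E}
    [IsFiniteMeasure P] {f : E → ℝ} (hf0 : ∀ x, 0 ≤ f x) (hf : Integrable f P) {a b : ℝ}
    (ha : 0 < a) (hb : ∫ x, f x ∂P ≤ b) : P {x | a ≤ f x} ≤ ENNReal.ofReal (b / a) := by
  have h := mul_meas_ge_le_integral_of_nonneg (ae_of_all P hf0) hf a
  have h1 : P.real {x | a ≤ f x} ≤ b / a := by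
    rw [le_div_iff₀ ha]; linarith
  rw [← ofReal_measureReal]
  exact ENNReal.ofReal_le_ofReal h1

/-- A bound for the probability of an event from bounds for its sections. -/
theorem prod_measure_le_of_section_le {E F : Type*} [MeasurableSpace E] [MeasurableSpace F]
    {P : Measure E} {Q : Measure F} [IsProbabilityMeasure P] [IsProbabilityMeasure Q]
    {s : Set (E × F)} (hs : MeasurableSet s) {t : E → ℝ} (ht : Integrable t P)
    (ht0 : ∀ x, 0 ≤ t x) (h : ∀ x, Q (Prod.mk x ⁻¹' s) ≤ ENNReal.ofReal (t x)) {b : ℝ}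
    (hb : ∫ x, t x ∂P ≤ b) : (P.prod Q) s ≤ ENNReal.ofReal b := by
  rw [Measure.prod_apply hs]
  refine (lintegral_mono h).trans ?_
  rw [← ofReal_integral_eq_lintegral_ofReal ht (ae_of_all _ ht0)]
  exact ENNReal.ofReal_le_ofReal hb

variable {ι κ : Type*} [Fintype ι] [Fintype κ] [DecidableEq ι] [DecidableEq κ]

theorem gaussianPi_quadForm_deviation_le (v : ℝ≥0) {B : Matrix ι ι ℝ} (hB : Bᵀ = B) {a : ℝ}
    (ha : 0 < a) : gaussianPi ι v {ξ | a ≤ |ξ ⬝ᵥ (B *ᵥ ξ) - v * B.trace|} ≤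
      ENNReal.ofReal (2 * v ^ 2 * (B * B).trace / a ^ 2) := by
  have hp : IsPolyCont (fun x : ι → ℝ => (x ⬝ᵥ (B *ᵥ x) - v * B.trace) ^ 2) := by
    have h := (IsPolyCont.quadForm B).add (IsPolyCont.const (-(v * B.trace)))
    have e : (fun x : ι → ℝ => (x ⬝ᵥ (B *ᵥ x) - v * B.trace) ^ 2) =
        fun x => (x ⬝ᵥ (B *ᵥ x) + -(v * B.trace)) * (x ⬝ᵥ (B *ᵥ x) + -(v * B.trace)) := by
      funext x; ring
    rw [e]
    exact h.mul h
  refine (measure_mono fun ξ hξ => ?_).trans (measure_ge_le_of_integral_le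
    (f := fun x : ι → ℝ => (x ⬝ᵥ (B *ᵥ x) - v * B.trace) ^ 2) (fun _ => sq_nonneg _)
    (hp.integrable v) (by positivity : 0 < a ^ 2) (integral_quadForm_sub_sq_gaussianPi v hB).le)
  simp only [Set.mem_ofPred_eq] at hξ ⊢
  rw [← sq_abs (_ - _)]
  gcongr

theorem gaussianPi_linearForm_sq_ge_le (v : ℝ≥0) (w : ι → ℝ) {a : ℝ} (ha : 0 < a) :
    gaussianPi ι v {ξ | a ≤ (w ⬝ᵥ ξ) ^ 2} ≤ ENNReal.ofReal (v * (w ⬝ᵥ w) / a) := by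
  have e : ∀ ξ : ι → ℝ, (w ⬝ᵥ ξ) ^ 2 = ξ ⬝ᵥ (vecMulVec w w *ᵥ ξ) := by
    intro ξ
    rw [vecMulVec_mulVec, dotProduct_comm ξ]
    simp [sq]
  have h := integral_quadForm_gaussianPi v (vecMulVec w w)
  rw [trace_vecMulVec] at h
  simp only [e]
  exact measure_ge_le_of_integral_le (fun x => by rw [← e]; positivity)
    ((IsPolyCont.quadForm _).integrable v) ha h.le

/-- Concentration of a quadratic form of the noise with a matrix that depends on the design. -/
theorem prod_gaussianPi_quadForm_deviation_le {v : ℝ≥0} {B : (ι × κ → ℝ) → Matrix ι ι ℝ}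
    (hBc : Continuous B) (hB : ∀ G, (B G)ᵀ = B G) {t : (ι × κ → ℝ) → ℝ} (ht : IsBddCont t)
    (hBt : ∀ G, (B G * B G).trace ≤ t G) (ht0 : ∀ G, 0 ≤ t G) {T : ℝ}
    (hT : ∫ G, t G ∂(gaussianPi (ι × κ) 1) ≤ T) {a : ℝ} (ha : 0 < a) :
    ((gaussianPi (ι × κ) 1).prod (gaussianPi ι v))
      {z | a ≤ |z.2 ⬝ᵥ (B z.1 *ᵥ z.2) - v * (B z.1).trace|} ≤
      ENNReal.ofReal (2 * v ^ 2 * T / a ^ 2) := by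
  have hc : Continuous fun z : (ι × κ → ℝ) × (ι → ℝ) =>
      |z.2 ⬝ᵥ (B z.1 *ᵥ z.2) - v * (B z.1).trace| := by
    have h1 : Continuous fun z : (ι × κ → ℝ) × (ι → ℝ) => B z.1 := hBc.comp continuous_fst
    exact ((continuous_snd.dotProduct (h1.matrix_mulVec continuous_snd)).sub
      (continuous_const.mul h1.matrix_trace)).abs
  have hk : 0 ≤ 2 * (v : ℝ) ^ 2 / a ^ 2 := by positivity
  refine prod_measure_le_of_section_le (t := fun G => 2 * (v : ℝ) ^ 2 / a ^ 2 * t G)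
    (measurableSet_le measurable_const hc.measurable) (ht.const_mul _).integrable
    (fun G => mul_nonneg hk (ht0 G)) (fun G => ?_) ?_
  · refine (gaussianPi_quadForm_deviation_le v (hB G) ha).trans (ENNReal.ofReal_le_ofReal ?_)
    rw [mul_div_right_comm]
    exact mul_le_mul_of_nonneg_left (hBt G) hk
  · rw [integral_const_mul, mul_div_right_comm (2 * (v : ℝ) ^ 2)]
    exact mul_le_mul_of_nonneg_left hT hk

theorem measure_union_le_of_le {E : Type*} [MeasurableSpace E] {P : Measure E} {s t : Set E}
    {a b : ℝ≥0∞} (hs : P s ≤ a) (ht : P t ≤ b) : P (s ∪ t) ≤ a + b :=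
  (measure_union_le s t).trans (add_le_add hs ht)

/-! ### Probability bounds for the trace, the bias and the cross term -/

section Design

variable [Nonempty κ] {lam K c : ℝ} (hlam : 0 < lam) (N : Matrix ι κ ℝ) (hK : 0 ≤ K)
  (hN : (Nᵀ * N).trace ≤ K ^ 2) (hc0 : 0 < c)

theorem continuous_design (N : Matrix ι κ ℝ) : Continuous (design N) :=
  continuous_signalPlusNoise _ N

theorem continuous_resolvent_design (hlam : 0 < lam) :
    Continuous fun G => resolvent lam (design N G) :=
  (continuous_resolvent hlam).comp (continuous_design N)

include hlam hK hN hc0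

theorem gaussianPi_stieltjes_deviation_le {B m τ η : ℝ}
    (hc : c ≤ (Fintype.card ι : ℝ) / Fintype.card κ - 1) (hm : 0 ≤ m) (hB : m ≤ B)
    (hroot : lam * m ^ 2 + ((Fintype.card ι : ℝ) / Fintype.card κ - 1 + lam) * m = 1)
    (hlarge : (1 + B + K * (2 + B) + 4 + 4 * B ^ 2) / √(Fintype.card κ : ℝ) ≤ c / 2)
    (hη : 0 < η) (hτ : |m - τ| ≤ η / 2) :
    gaussianPi (ι × κ) 1 {G | η ≤ |stieltjes lam (design N G) - τ|} ≤
      ENNReal.ofReal (2 / c * ((1 + B + K * (2 + B) + 4 + 4 * B ^ 2) / √(Fintype.card κ : ℝ)) /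
        (η / 2) ^ 2) := by
  refine (measure_mono fun G hG => ?_).trans (measure_ge_le_of_integral_le
    (f := fun G => (stieltjes lam (design N G) - m) ^ 2) (fun _ => sq_nonneg _)
    (((isBddCont_stieltjes N hlam).sub (IsBddCont.const m)).pow 2).integrable
    (by positivity : 0 < (η / 2) ^ 2)
    (integral_sq_stieltjes_sub_le hlam N hK hN hc0 hc hm hB hroot hlarge))
  -- Half of the tolerance `η` is reserved for the distance of the finite-size root `m` from the
  -- limit `τ`, the other half for the fluctuation.
  simp only [Set.mem_ofPred_eq] at hG ⊢
  rw [← sq_abs (_ - _)]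
  have := abs_sub_le (stieltjes lam (design N G)) m τ
  gcongr
  linarith

theorem integral_stieltjesSq_le_const {B m : ℝ}
    (hc : c ≤ (Fintype.card ι : ℝ) / Fintype.card κ - 1) (hm : 0 ≤ m) (hB : m ≤ B)
    (hroot : lam * m ^ 2 + ((Fintype.card ι : ℝ) / Fintype.card κ - 1 + lam) * m = 1)
    (hlarge : (1 + B + K * (2 + B) + 4 + 4 * B ^ 2) / √(Fintype.card κ : ℝ) ≤ c / 2)
    (hlarge' : 2 / (Fintype.card κ : ℝ) ≤ c / 4) :
    ∫ G, stieltjesSq lam (design N G) ∂(gaussianPi (ι × κ) 1) ≤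
      2 / c * (1 + K ^ 2 / c + (2 + K ^ 2 / c) * (2 + 2 * B ^ 2)) := by
  refine (integral_stieltjesSq_le hlam N hK hN hc0 hc hlarge').trans ?_
  have h1 := integral_sq_stieltjes_sub_le hlam N hK hN hc0 hc hm hB hroot hlarge
  have hs := isBddCont_stieltjes N hlam
  have hi := ((hs.sub (IsBddCont.const m)).pow 2).integrable (P := gaussianPi (ι × κ) 1)
  have h2 : ∫ G, stieltjes lam (design N G) ^ 2 ∂(gaussianPi (ι × κ) 1) ≤
      ∫ G, (2 * (stieltjes lam (design N G) - m) ^ 2 + 2 * B ^ 2) ∂(gaussianPi (ι × κ) 1) := by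
    refine integral_mono (hs.pow 2).integrable ((hi.const_mul 2).add (integrable_const _))
      fun G => ?_
    have : m ^ 2 ≤ B ^ 2 := by gcongr
    dsimp only
    nlinarith [sq_nonneg (stieltjes lam (design N G) - 2 * m)]
  rw [integral_add (hi.const_mul 2) (integrable_const _), integral_const_mul] at h2
  simp only [integral_const, probReal_univ, one_smul] at h2
  have h3 : 2 / c * ((1 + B + K * (2 + B) + 4 + 4 * B ^ 2) / √(Fintype.card κ : ℝ)) ≤ 1 := by
    calc _ ≤ 2 / c * (c / 2) := by gcongr
      _ = 1 := by field_simp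
  gcongr
  linarith

/-- Markov's inequality at order `P`. A first moment would only give a probability proportional to
`lam`, whereas it has to vanish with `lam` fixed. Once `lam` is small enough for the moment constant
to lie below half the threshold, raising `P` makes the probability as small as desired. -/
theorem gaussianPi_bias_ge_le (P : ℕ) {η : ℝ}
    (hc : c ≤ (Fintype.card ι : ℝ) / Fintype.card κ - 1 - (1 + 2 * P) / Fintype.card κ)
    (u : κ → ℝ) (hη : 0 < η) (hu : lam * (2 * (2 / c * (1 + K ^ 2 / (2 * c)) * (u ⬝ᵥ u))) ≤ η) :
    gaussianPi (ι × κ) 1 {G | η ≤ lam * (u ⬝ᵥ (resolvent lam (design N G) *ᵥ u))} ≤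
      ENNReal.ofReal ((1 / 2) ^ P) := by
  have hb : IsBddCont (fun G => u ⬝ᵥ (resolvent lam (design N G) *ᵥ u)) := by
    simp only [dotProduct, mulVec]
    exact IsBddCont.sum _ fun i _ => (IsBddCont.sum _ fun j _ =>
      (isBddCont_resolvent hlam _ N i j).mul (IsBddCont.const _)).const_mul _
  have huu := dotProduct_self_nonneg' u
  set C := 2 / c * (1 + K ^ 2 / (2 * c)) * (u ⬝ᵥ u) with hC
  have hC0 : 0 ≤ C := by positivity
  refine (measure_mono fun G hG => ?_).trans ((measure_ge_le_of_integral_le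
    (f := fun G => (u ⬝ᵥ (resolvent lam (design N G) *ᵥ u)) ^ P)
    (fun G => pow_nonneg (quadForm_resolvent_nonneg hlam _ u) P) (hb.pow P).integrable
    (by positivity : 0 < (η / lam) ^ P)
    (integral_quadForm_pow_le hlam N hK hN hc0 P hc u le_rfl)).trans
      (ENNReal.ofReal_le_ofReal ?_))
  · simp only [Set.mem_ofPred_eq] at hG ⊢
    gcongr
    rw [div_le_iff₀ hlam]
    linarith
  · rw [← div_pow]
    refine pow_le_pow_left₀ (div_nonneg hC0 (by positivity)) ?_ P
    rw [div_le_iff₀ (by positivity)]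
    have h : 2 * C ≤ η / lam := by
      rw [le_div_iff₀ hlam]
      linarith
    linarith

omit hK hN hc0 in
-- Given the design this is a linear form in the noise, with variance `v |X R μ|² ≤ v lam⁻¹ |μ|²`.
-- The factor `lam⁻¹` is harmless because the bound is applied at the fixed upper end of the
-- regularization interval.
theorem prod_gaussianPi_cross_ge_le (v : ℝ≥0) (μ : κ → ℝ) {a : ℝ} (ha : 0 < a) :
    ((gaussianPi (ι × κ) 1).prod (gaussianPi ι v))
      {z | a ≤ (μ ⬝ᵥ (resolvent lam (design N z.1) *ᵥ ((design N z.1)ᵀ *ᵥ z.2))) ^ 2} ≤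
      ENNReal.ofReal (v * (lam⁻¹ * (μ ⬝ᵥ μ)) / a) := by
  have hc : Continuous fun z : (ι × κ → ℝ) × (ι → ℝ) =>
      (μ ⬝ᵥ (resolvent lam (design N z.1) *ᵥ ((design N z.1)ᵀ *ᵥ z.2))) ^ 2 := by
    have h1 := (continuous_resolvent_design N hlam).comp
      (continuous_fst : Continuous fun z : (ι × κ → ℝ) × (ι → ℝ) => z.1)
    have h2 := (continuous_design N).comp
      (continuous_fst : Continuous fun z : (ι × κ → ℝ) × (ι → ℝ) => z.1)
    exact (continuous_const.dotProduct (h1.matrix_mulVec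
      (h2.matrix_transpose.matrix_mulVec continuous_snd))).pow 2
  have hμ := dotProduct_self_nonneg' μ
  have hk : 0 ≤ v * (lam⁻¹ * (μ ⬝ᵥ μ)) / a := by positivity
  refine prod_measure_le_of_section_le (t := fun _ => v * (lam⁻¹ * (μ ⬝ᵥ μ)) / a)
    (measurableSet_le measurable_const hc.measurable) (integrable_const _)
    (fun _ => hk) (fun G => ?_) (by simp)
  set X := design N G with hX
  have e : ∀ ξ : ι → ℝ, μ ⬝ᵥ (resolvent lam X *ᵥ (Xᵀ *ᵥ ξ)) =
      ((X * resolvent lam X) *ᵥ μ) ⬝ᵥ ξ := by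
    intro ξ
    rw [← mulVec_mulVec, mulVec_mulVec, dotProduct_mulVec, ← mulVec_transpose,
      transpose_mul, transpose_transpose, resolvent_transpose hlam, mulVec_mulVec]
  have h := gaussianPi_linearForm_sq_ge_le v ((X * resolvent lam X) *ᵥ μ) ha
  refine le_trans (le_of_eq ?_) (h.trans (ENNReal.ofReal_le_ofReal ?_))
  · congr 1
    ext ξ
    simp only [Set.preimage_ofPred_eq, Set.mem_ofPred_eq, ← hX, e]
  · gcongr
    exact (mulVec_mul_resolvent_dotProduct_self_le hlam X μ).trans (quadForm_resolvent_le hlam X μ)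

end Design

/-! ### Union bound for the exceptional samples -/

/-- The numerator of the bound for the variance of the normalized trace of the resolvent. -/
noncomputable def stieltjesConst (B K : ℝ) : ℝ := 1 + B + K * (2 + B) + 4 + 4 * B ^ 2

/-- The bound for the mean normalized trace of the squared resolvent. -/
noncomputable def stieltjesSqConst (c K B : ℝ) : ℝ :=
  2 / c * (1 + K ^ 2 / c + (2 + K ^ 2 / c) * (2 + 2 * B ^ 2))

/-- The constant in the bound for the probability that a sample is not typical. -/
noncomputable def atypicalConst (c K B Γ lam' ε Δ : ℝ) : ℝ :=
  2 * (2 / c * stieltjesConst B K / (ε ^ 2 / 2) ^ 2) +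
    2 * (2 * Δ ^ 2 * stieltjesSqConst c K B / ε ^ 4) + Δ * (lam'⁻¹ * Γ) / ε ^ 2 +
    2 * Δ ^ 2 / ε ^ 4

/-- A union bound. Every event but the bias is of probability `O(1 / √d)`, and the bias contributes
`2⁻ᴾ`. The final bound involves `lam'` but not `lam`, which permits `lam → 0` at fixed dimension. -/
theorem measure_not_isTypical_le [Nonempty κ] {lam lam' ε τ B K c Γ m m' : ℝ} {Δ : ℝ≥0}
    (hlam : 0 < lam) (hll : lam ≤ lam') (hε : 0 < ε) (N : Matrix ι κ ℝ) (hK : 0 ≤ K)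
    (hN : (Nᵀ * N).trace ≤ K ^ 2) (hc0 : 0 < c) (P : ℕ)
    (hc : c ≤ (Fintype.card ι : ℝ) / Fintype.card κ - 1 - (1 + 2 * P) / Fintype.card κ)
    (hm : 0 ≤ m) (hB : m ≤ B)
    (hroot : lam * m ^ 2 + ((Fintype.card ι : ℝ) / Fintype.card κ - 1 + lam) * m = 1)
    (hm' : 0 ≤ m') (hB' : m' ≤ B)
    (hroot' : lam' * m' ^ 2 + ((Fintype.card ι : ℝ) / Fintype.card κ - 1 + lam') * m' = 1)
    (hlarge : stieltjesConst B K / √(Fintype.card κ : ℝ) ≤ c / 2)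
    (hlarge' : 2 / (Fintype.card κ : ℝ) ≤ c / 4)
    (hτ : |m - τ| ≤ ε ^ 2 / 2) (hτ' : |m' - τ| ≤ ε ^ 2 / 2) (θ₀ μ : κ → ℝ)
    (hθ : lam' * (2 * (2 / c * (1 + K ^ 2 / (2 * c)) * (θ₀ ⬝ᵥ θ₀))) ≤ ε ^ 2 * Fintype.card κ)
    (hμ : μ ⬝ᵥ μ ≤ Γ * Fintype.card κ) :
    ((gaussianPi (ι × κ) 1).prod (gaussianPi ι Δ))
      {z | ¬ IsTypical lam lam' ε τ Δ θ₀ μ (design N z.1) z.2} ≤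
      ENNReal.ofReal ((1 / 2) ^ P + atypicalConst c K B Γ lam' ε Δ / √(Fintype.card κ : ℝ)) := by
  have hlam' := hlam.trans_le hll
  have hB0 : 0 ≤ B := hm.trans hB
  set d : ℝ := (Fintype.card κ : ℝ) with hd
  set n : ℝ := (Fintype.card ι : ℝ) with hn
  have hd1 : 1 ≤ d := by rw [hd]; exact_mod_cast Fintype.card_pos
  have hd0 : 0 < d := by linarith
  have hc' : c ≤ n / d - 1 := by
    have : 0 ≤ (1 + 2 * (P : ℝ)) / d := by positivity
    linarith
  have hdn : d ≤ n := by
    have : 1 ≤ n / d := by linarith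
    rwa [le_div_iff₀ hd0, one_mul] at this
  have hn0 : 0 < n := hd0.trans_le hdn
  have hΓ : 0 ≤ Γ := nonneg_of_mul_nonneg_left ((dotProduct_self_nonneg' μ).trans hμ) hd0
  have hsd : 0 < √d := Real.sqrt_pos.2 hd0
  have hsd' : √d ≤ d := by
    rw [Real.sqrt_le_left hd0.le]
    nlinarith
  set Pr := (gaussianPi (ι × κ) 1).prod (gaussianPi ι Δ)
  have hfst : ∀ s : Set (ι × κ → ℝ), MeasurableSet s →
      Pr {z | z.1 ∈ s} = gaussianPi (ι × κ) 1 s := fun s hs =>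
    (measurePreserving_fst (μ := gaussianPi (ι × κ) 1)
      (ν := gaussianPi ι Δ)).measure_preimage hs.nullMeasurableSet
  have hAs : 0 ≤ stieltjesConst B K := by rw [stieltjesConst]; positivity
  have hTs : 0 ≤ stieltjesSqConst c K B := by rw [stieltjesSqConst]; positivity
  have hstm : ∀ {t : ℝ}, 0 < t →
      MeasurableSet {G : ι × κ → ℝ | ε ^ 2 ≤ |stieltjes t (design N G) - τ|} := fun ht =>
    measurableSet_le measurable_const
      (((isBddCont_stieltjes N ht).1.sub continuous_const).abs.measurable)
  -- the seven exceptional events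
  have e1 : Pr {z | ε ^ 2 ≤ |stieltjes lam (design N z.1) - τ|} ≤
      ENNReal.ofReal (2 / c * stieltjesConst B K / (ε ^ 2 / 2) ^ 2 / √d) := by
    refine ((hfst _ (hstm hlam)).trans_le (gaussianPi_stieltjes_deviation_le hlam N hK hN hc0 hc'
      hm hB hroot hlarge (by positivity : 0 < ε ^ 2) hτ)).trans (ENNReal.ofReal_le_ofReal ?_)
    rw [← hd, stieltjesConst]
    exact le_of_eq (by ring)
  have e2 : Pr {z | ε ^ 2 ≤ |stieltjes lam' (design N z.1) - τ|} ≤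
      ENNReal.ofReal (2 / c * stieltjesConst B K / (ε ^ 2 / 2) ^ 2 / √d) := by
    refine ((hfst _ (hstm hlam')).trans_le (gaussianPi_stieltjes_deviation_le hlam' N hK hN hc0 hc'
      hm' hB' hroot' hlarge (by positivity : 0 < ε ^ 2) hτ')).trans (ENNReal.ofReal_le_ofReal ?_)
    rw [← hd, stieltjesConst]
    exact le_of_eq (by ring)
  have e3 : Pr {z | ε ^ 2 * d ≤ lam' * (θ₀ ⬝ᵥ (resolvent lam' (design N z.1) *ᵥ θ₀))} ≤
      ENNReal.ofReal ((1 / 2) ^ P) := by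
    refine (hfst _ ?_).trans_le (gaussianPi_bias_ge_le hlam' N hK hN hc0 P hc θ₀
      (by positivity : 0 < ε ^ 2 * d) hθ)
    exact measurableSet_le measurable_const (continuous_const.mul (continuous_const.dotProduct
      ((continuous_resolvent_design N hlam').matrix_mulVec continuous_const))).measurable
  -- Path and noise forms share this estimate: `tr Q²` is at most `tr R²`, of mean `O(d)`, so by
  -- Chebyshev a deviation of size `ε² d` has probability `O(1 / d)`.
  have hquad : ∀ {t : ℝ} (ht : 0 < t), ∀ {m : ℝ}, 0 ≤ m → m ≤ B →
      t * m ^ 2 + (n / d - 1 + t) * m = 1 → ∀ (Q : (ι × κ → ℝ) → Matrix ι ι ℝ), Continuous Q →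
      (∀ G, (Q G)ᵀ = Q G) → (∀ G, (Q G * Q G).trace ≤
        (resolvent t (design N G) * resolvent t (design N G)).trace) →
      Pr {z | ε ^ 2 * d ≤ |z.2 ⬝ᵥ (Q z.1 *ᵥ z.2) - Δ * (Q z.1).trace|} ≤
        ENNReal.ofReal (2 * Δ ^ 2 * stieltjesSqConst c K B / ε ^ 4 / √d) := by
    intro t ht m hm hB hroot Q hQ hQt hQR
    have hT : ∫ G, d * stieltjesSq t (design N G) ∂(gaussianPi (ι × κ) 1) ≤
        d * stieltjesSqConst c K B := by
      rw [integral_const_mul]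
      exact mul_le_mul_of_nonneg_left
        (integral_stieltjesSq_le_const ht N hK hN hc0 hc' hm hB hroot hlarge hlarge') hd0.le
    refine (prod_gaussianPi_quadForm_deviation_le (v := Δ) hQ hQt
      ((isBddCont_stieltjesSq N ht).const_mul d) (fun G => ?_) (fun G => ?_) hT
      (by positivity : 0 < ε ^ 2 * d)).trans (ENNReal.ofReal_le_ofReal ?_)
    · rw [stieltjesSq, mul_div_cancel₀ _ hd0.ne']
      exact hQR G
    · exact mul_nonneg hd0.le (div_nonneg (trace_resolvent_sq_nonneg ht _) hd0.le)
    · calc 2 * (Δ : ℝ) ^ 2 * (d * stieltjesSqConst c K B) / (ε ^ 2 * d) ^ 2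
          = 2 * Δ ^ 2 * stieltjesSqConst c K B / ε ^ 4 / d := by field_simp
        _ ≤ _ := by gcongr
  have hRc : ∀ {t : ℝ}, 0 < t → Continuous fun G => resolvent t (design N G) :=
    fun ht => continuous_resolvent_design N ht
  have hXc := continuous_design N
  have e4 := hquad hlam hm hB hroot (fun G => pathForm lam lam' (design N G))
    ((hXc.matrix_mul (((hRc hlam).sub (hRc hlam')).matrix_mul
      ((hRc hlam).sub (hRc hlam')))).matrix_mul hXc.matrix_transpose)
    (fun G => by rw [pathForm_eq hlam _ hll, rowFn_transpose])
    (fun G => trace_pathForm_sq_le hlam _ hll)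
  have e5 := hquad hlam' hm' hB' hroot' (fun G => noiseForm lam' (design N G))
    ((hXc.matrix_mul ((hRc hlam').matrix_mul (hRc hlam'))).matrix_mul hXc.matrix_transpose)
    (fun G => by rw [noiseForm_eq hlam', rowFn_transpose])
    (fun G => trace_noiseForm_sq_le hlam' _)
  have e6 : Pr {z | ε ^ 2 * d ^ 2 ≤ (μ ⬝ᵥ (resolvent lam' (design N z.1) *ᵥ
      ((design N z.1)ᵀ *ᵥ z.2))) ^ 2} ≤ ENNReal.ofReal (Δ * (lam'⁻¹ * Γ) / ε ^ 2 / √d) := by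
    refine (prod_gaussianPi_cross_ge_le hlam' N Δ μ (by positivity : 0 < ε ^ 2 * d ^ 2)).trans
      (ENNReal.ofReal_le_ofReal ?_)
    calc Δ * (lam'⁻¹ * (μ ⬝ᵥ μ)) / (ε ^ 2 * d ^ 2)
        ≤ Δ * (lam'⁻¹ * (Γ * d)) / (ε ^ 2 * d ^ 2) := by gcongr
      _ = Δ * (lam'⁻¹ * Γ) / ε ^ 2 / d := by field_simp
      _ ≤ _ := by gcongr
  have e7 : Pr {z | ε ^ 2 * n ≤ |z.2 ⬝ᵥ (residualForm lam' (design N z.1) *ᵥ z.2) -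
      Δ * (residualForm lam' (design N z.1)).trace|} ≤
      ENNReal.ofReal (2 * Δ ^ 2 / ε ^ 4 / √d) := by
    have hH := (continuous_const (y := (1 : Matrix ι ι ℝ))).sub
      ((hXc.matrix_mul (hRc hlam')).matrix_mul hXc.matrix_transpose)
    refine (prod_gaussianPi_quadForm_deviation_le (v := Δ)
      (B := fun G => residualForm lam' (design N G)) (hH.matrix_mul hH) (fun G => ?_)
      (IsBddCont.const n) (fun G => trace_residualForm_sq_le hlam' _) (fun _ => hn0.le)
      (T := n) (by simp) (by positivity : 0 < ε ^ 2 * n)).trans (ENNReal.ofReal_le_ofReal ?_)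
    · rw [residualForm_eq hlam', transpose_sub, transpose_one, rowFn_transpose]
    · calc 2 * (Δ : ℝ) ^ 2 * n / (ε ^ 2 * n) ^ 2 = 2 * Δ ^ 2 / ε ^ 4 / n := by field_simp
        _ ≤ _ := by
          gcongr
          exact hsd'.trans hdn
  refine (measure_mono fun z hz => ?_).trans ((measure_union_le_of_le (measure_union_le_of_le
    (measure_union_le_of_le (measure_union_le_of_le (measure_union_le_of_le
      (measure_union_le_of_le e1 e2) e3) e4) e5) e6) e7).trans ?_)
  · by_contra h
    simp only [Set.mem_union, not_or, Set.mem_ofPred_eq, not_le] at h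
    obtain ⟨⟨⟨⟨⟨⟨h1, h2⟩, h3⟩, h4⟩, h5⟩, h6⟩, h7⟩ := h
    exact hz ⟨h1.le, h2.le, h3.le, h4.le, h5.le, h6.le, h7.le⟩
  have p1 : 0 ≤ 2 / c * stieltjesConst B K / (ε ^ 2 / 2) ^ 2 / √d := by positivity
  have p3 : (0 : ℝ) ≤ (1 / 2) ^ P := by positivity
  have p4 : 0 ≤ 2 * (Δ : ℝ) ^ 2 * stieltjesSqConst c K B / ε ^ 4 / √d := by positivity
  have p6 : 0 ≤ Δ * (lam'⁻¹ * Γ) / ε ^ 2 / √d := by positivity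
  have p7 : 0 ≤ 2 * (Δ : ℝ) ^ 2 / ε ^ 4 / √d := by positivity
  rw [← ENNReal.ofReal_add (by positivity) (by positivity),
    ← ENNReal.ofReal_add (by positivity) (by positivity),
    ← ENNReal.ofReal_add (by positivity) (by positivity),
    ← ENNReal.ofReal_add (by positivity) (by positivity),
    ← ENNReal.ofReal_add (by positivity) (by positivity),
    ← ENNReal.ofReal_add (by positivity) (by positivity)]
  refine ENNReal.ofReal_le_ofReal (le_of_eq ?_)
  rw [atypicalConst]
  ring

end IsotropicGMM

namespace IsotropicGMM

/-! ### Product measures of mixtures and of Gaussian laws -/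

/-- On boxes this is the distributive law: drawing from a mixture independently amounts to drawing
all component labels first. -/
theorem pi_sum_smul {ι β E : Type*} [Fintype ι] [DecidableEq ι] [Fintype β]
    [MeasurableSpace E] (w : β → ℝ≥0∞) (hw : ∀ b, w b ≠ ∞) (P : β → Measure E) [∀ b, IsProbabilityMeasure (P b)] :
    Measure.pi (fun _ : ι => ∑ b, w b • P b) =
      ∑ σ : ι → β, (∏ i, w (σ i)) • Measure.pi (fun i => P (σ i)) := by
  have : ∀ b, IsFiniteMeasure (w b • P b) := fun b =>
    ⟨by simpa using (hw b).lt_top⟩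
  refine Measure.pi_eq fun s hs => ?_
  simp only [Measure.coe_finsetSum, Finset.sum_apply, Measure.smul_apply, Measure.pi_pi,
    smul_eq_mul, ← Finset.prod_mul_distrib]
  rw [Finset.prod_univ_sum]
  simp

/-- An event has small probability under independent draws from a mixture when it has small
probability for every choice of the components. -/
theorem pi_mixture_le {ι β E : Type*} [Fintype ι] [Fintype β] [MeasurableSpace E]
    {w : β → ℝ≥0∞} (hw : ∑ b, w b = 1) (P : β → Measure E) [∀ b, IsProbabilityMeasure (P b)]
    {s : Set (ι → E)} {M : ℝ≥0∞} (h : ∀ σ : ι → β, Measure.pi (fun i => P (σ i)) s ≤ M) :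
    Measure.pi (fun _ : ι => ∑ b, w b • P b) s ≤ M := by
  classical
  have hw' : ∀ b, w b ≠ ∞ := fun b => by
    have : w b ≤ 1 := hw ▸ Finset.single_le_sum (fun _ _ => zero_le) (Finset.mem_univ b)
    exact (this.trans_lt ENNReal.one_lt_top).ne
  rw [pi_sum_smul w hw' P]
  simp only [Measure.coe_finsetSum, Finset.sum_apply, Measure.smul_apply, smul_eq_mul]
  calc ∑ σ : ι → β, (∏ i, w (σ i)) * Measure.pi (fun i => P (σ i)) s
      ≤ ∑ σ : ι → β, (∏ i, w (σ i)) * M := by gcongr with σ; exact h σ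
    _ = (∏ _i : ι, ∑ b, w b) * M := by
        rw [← Finset.sum_mul, Finset.prod_univ_sum]
        simp
    _ = M := by simp [hw]

theorem measurePreserving_curry_gaussianPi (ι κ : Type*) [Fintype ι] [Fintype κ] (v : ℝ≥0) :
    MeasurePreserving (fun (G : ι × κ → ℝ) (i : ι) (j : κ) => G (i, j)) (gaussianPi (ι × κ) v)
      (Measure.pi fun _ : ι => gaussianPi κ v) := by
  have hm : Measurable (fun (G : ι × κ → ℝ) (i : ι) (j : κ) => G (i, j)) := by fun_prop
  refine ⟨hm, ?_⟩
  have h : gaussianPi (ι × κ) v =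
      (Measure.pi fun _ : ι => gaussianPi κ v).map (fun g (z : ι × κ) => g z.1 z.2) := by
    refine Measure.pi_eq fun s hs => ?_
    rw [Measure.map_apply (by fun_prop) (MeasurableSet.univ_pi hs)]
    have : (fun (g : ι → κ → ℝ) (z : ι × κ) => g z.1 z.2) ⁻¹' Set.univ.pi s =
        Set.univ.pi fun i => Set.univ.pi fun j => s (i, j) := by
      ext g
      simp [Set.mem_pi]
    rw [this, Measure.pi_pi]
    simp only [Measure.pi_pi]
    rw [Fintype.prod_prod_type]
  rw [h, Measure.map_map hm (by fun_prop)]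
  exact Measure.map_id

theorem multivariateGaussian_one_eq_map {d : ℕ} (a : EuclideanSpace ℝ (Fin d)) :
    multivariateGaussian a 1 =
      (gaussianPi (Fin d) 1).map (fun g => a + WithLp.toLp 2 g) := by
  have h : (fun g : Fin d → ℝ => a + WithLp.toLp 2 g) = (fun x => a + x) ∘ WithLp.toLp 2 := rfl
  rw [h, ← Measure.map_map (by fun_prop) (by fun_prop), map_pi_eq_stdGaussian, multivariateGaussian]
  simp

/-- The training pair with input `a + g` and label noise `t`. -/
noncomputable def shiftedPair {d : ℕ} (a θ₀ : EuclideanSpace ℝ (Fin d)) (z : (Fin d → ℝ) × ℝ) :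
    EuclideanSpace ℝ (Fin d) × ℝ :=
  (a + WithLp.toLp 2 z.1, predict θ₀ (a + WithLp.toLp 2 z.1) + z.2)

theorem continuous_predict_right {d : ℕ} (θ : EuclideanSpace ℝ (Fin d)) :
    Continuous (predict θ) := by
  unfold predict
  fun_prop

theorem measurePreserving_shiftedPair {d : ℕ} (a θ₀ : EuclideanSpace ℝ (Fin d)) (Δ : ℝ≥0) :
    MeasurePreserving (shiftedPair a θ₀) ((gaussianPi (Fin d) 1).prod (gaussianReal 0 Δ))
      (teacherLaw (multivariateGaussian a 1) θ₀ Δ) := by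
  have hc := continuous_predict_right θ₀
  have h1 : Continuous fun z : EuclideanSpace ℝ (Fin d) × ℝ => (z.1, predict θ₀ z.1 + z.2) := by
    fun_prop
  have h2 : MeasurePreserving (fun g : Fin d → ℝ => a + WithLp.toLp 2 g) (gaussianPi (Fin d) 1)
      (multivariateGaussian a 1) := ⟨by fun_prop, (multivariateGaussian_one_eq_map a).symm⟩
  have h3 := h2.prod (MeasurePreserving.id (gaussianReal 0 Δ))
  exact (MeasurePreserving.mk h1.measurable rfl :
    MeasurePreserving _ ((multivariateGaussian a 1).prod (gaussianReal 0 Δ)) _).comp h3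

/-- The sample with inputs `a i + G i` and label noise `ξ`. -/
noncomputable def shiftedSample {n d : ℕ} (a : Fin n → EuclideanSpace ℝ (Fin d))
    (θ₀ : EuclideanSpace ℝ (Fin d)) (z : (Fin n × Fin d → ℝ) × (Fin n → ℝ)) : Sample n d :=
  fun i => shiftedPair (a i) θ₀ (fun j => z.1 (i, j), z.2 i)

/-- With the component means fixed, the sample is an explicit image of independent Gaussian entries
and noise, so the bounds for `G / √d + N` apply to it. -/
theorem measurePreserving_shiftedSample {n d : ℕ} (a : Fin n → EuclideanSpace ℝ (Fin d))
    (θ₀ : EuclideanSpace ℝ (Fin d)) (Δ : ℝ≥0) :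
    MeasurePreserving (shiftedSample a θ₀)
      ((gaussianPi (Fin n × Fin d) 1).prod (gaussianPi (Fin n) Δ))
      (Measure.pi fun i => teacherLaw (multivariateGaussian (a i) 1) θ₀ Δ) := by
  have h1 := (measurePreserving_curry_gaussianPi (Fin n) (Fin d) 1).prod
    (MeasurePreserving.id (gaussianPi (Fin n) Δ))
  have h2 := (measurePreserving_arrowProdEquivProdArrow (Fin d → ℝ) ℝ (Fin n)
    (fun _ => gaussianPi (Fin d) 1) (fun _ => gaussianReal 0 Δ)).symm
  have : ∀ i, IsProbabilityMeasure (teacherLaw (multivariateGaussian (a i) 1) θ₀ Δ) := fun i =>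
    (measurePreserving_shiftedPair (a i) θ₀ Δ).map_eq ▸ Measure.isProbabilityMeasure_map
      (measurePreserving_shiftedPair (a i) θ₀ Δ).aemeasurable
  have h3 := measurePreserving_pi (fun _ : Fin n => (gaussianPi (Fin d) 1).prod (gaussianReal 0 Δ))
    (fun i => teacherLaw (multivariateGaussian (a i) 1) θ₀ Δ)
    (fun i => measurePreserving_shiftedPair (a i) θ₀ Δ)
  exact h3.comp (h2.comp h1)

/-- The sign of a cluster. -/
def clusterSign (b : Bool) : ℝ := if b then 1 else -1

theorem clusterSign_sq (b : Bool) : clusterSign b ^ 2 = 1 := by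
  cases b <;> simp [clusterSign]

theorem teacherLaw_twoClusterLaw {d : ℕ} (p : ℝ) (μ θ₀ : EuclideanSpace ℝ (Fin d)) (Δ : ℝ≥0) :
    teacherLaw (twoClusterLaw p μ) θ₀ Δ =
      ∑ b : Bool, (if b then ENNReal.ofReal p else ENNReal.ofReal (1 - p)) •
        teacherLaw (multivariateGaussian (clusterSign b • (√(d : ℝ))⁻¹ • μ) 1) θ₀ Δ := by
  have hc := continuous_predict_right θ₀
  have h1 : Measurable fun z : EuclideanSpace ℝ (Fin d) × ℝ => (z.1, predict θ₀ z.1 + z.2) :=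
    (by fun_prop : Continuous fun z : EuclideanSpace ℝ (Fin d) × ℝ =>
      (z.1, predict θ₀ z.1 + z.2)).measurable
  simp only [Fintype.sum_bool, clusterSign, if_true, one_smul, Bool.false_eq_true, if_false, neg_smul,
    teacherLaw, twoClusterLaw]
  have : IsFiniteMeasure (ENNReal.ofReal p • multivariateGaussian ((√(d : ℝ))⁻¹ • μ) 1) :=
    ⟨by simp⟩
  have : IsFiniteMeasure (ENNReal.ofReal (1 - p) •
    multivariateGaussian (-((√(d : ℝ))⁻¹ • μ)) 1) := ⟨by simp⟩
  rw [Measure.add_prod, Measure.map_add _ _ h1, Measure.prod_smul_left,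
    Measure.prod_smul_left, Measure.map_smul, Measure.map_smul]

/-- For `μ = 0` both components coincide, so the Gaussian model is a special case of the mixture. -/
theorem gaussianLaw_eq_twoClusterLaw {d : ℕ} {p : ℝ} (hp₀ : 0 ≤ p) (hp₁ : p ≤ 1) :
    gaussianLaw d = twoClusterLaw p 0 := by
  rw [gaussianLaw, twoClusterLaw, smul_zero, neg_zero, ← add_smul,
    ← ENNReal.ofReal_add hp₀ (by linarith)]
  simp

end IsotropicGMM

namespace IsotropicGMM

open Matrix

/-! ### The generalization error -/

section GenError

variable {d : ℕ}

theorem predict_sub (θ θ' x : EuclideanSpace ℝ (Fin d)) :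
    predict (θ - θ') x = predict θ x - predict θ' x := by
  rw [predict, predict, predict, inner_sub_left, sub_div]

theorem memLp_predict_multivariateGaussian (a w : EuclideanSpace ℝ (Fin d)) :
    MemLp (predict w) 2 (multivariateGaussian a 1) := by
  have h : MemLp id 2 (multivariateGaussian a (1 : Matrix (Fin d) (Fin d) ℝ)) :=
    IsGaussian.memLp_two_id
  have h1 := ((innerSL ℝ w).comp_memLp' h).const_mul (√(d : ℝ))⁻¹
  convert h1 using 1
  funext x
  simp [predict, div_eq_inv_mul]

theorem integral_predict_sq_multivariateGaussian (a w : EuclideanSpace ℝ (Fin d)) :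
    ∫ x, predict w x ^ 2 ∂(multivariateGaussian a 1) = ‖w‖ ^ 2 / d + inner ℝ a w ^ 2 / d := by
  have h : MemLp id 2 (multivariateGaussian a (1 : Matrix (Fin d) (Fin d) ℝ)) :=
    IsGaussian.memLp_two_id
  have hL : MemLp (fun x => inner ℝ w x) 2
      (multivariateGaussian a (1 : Matrix (Fin d) (Fin d) ℝ)) := (innerSL ℝ w).comp_memLp' h
  have h1 := covarianceBilin_self h w
  rw [covarianceBilin_multivariateGaussian PosSemidef.one, one_mulVec, variance_eq_sub hL] at h1
  have h2 : ∫ x, inner ℝ w x ∂(multivariateGaussian a (1 : Matrix (Fin d) (Fin d) ℝ)) =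
      inner ℝ w a := by
    have := (innerSL ℝ w).integral_comp_id_comm (μ := multivariateGaussian a 1)
      IsGaussian.integrable_id
    simpa using this
  have h3 : w.ofLp ⬝ᵥ w.ofLp = ‖w‖ ^ 2 := by
    rw [EuclideanSpace.real_norm_sq_eq, dotProduct]
    exact Finset.sum_congr rfl fun i _ => (sq _).symm
  rw [h2, h3] at h1
  simp only [predict, div_pow, Real.sq_sqrt (Nat.cast_nonneg d), integral_div]
  simp only [Pi.pow_apply] at h1
  rw [← add_div, real_inner_comm w a, h1]
  ring

theorem genError_teacherLaw {Q : Measure (EuclideanSpace ℝ (Fin d))} [IsProbabilityMeasure Q]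
    (θ₀ θ : EuclideanSpace ℝ (Fin d)) (Δ : ℝ≥0)
    (hQ : Integrable (fun x => predict (θ - θ₀) x ^ 2) Q) :
    genError (teacherLaw Q θ₀ Δ) θ = Δ + ∫ x, predict (θ - θ₀) x ^ 2 ∂Q := by
  have hc := continuous_predict_right θ₀
  have hc' := continuous_predict_right θ
  have hcs := continuous_predict_right (θ - θ₀)
  rw [genError, teacherLaw, integral_map (by fun_prop) (by fun_prop)]
  have hm : MemLp (predict (θ - θ₀)) 2 Q :=
    (memLp_two_iff_integrable_sq hcs.aestronglyMeasurable).2 hQ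
  have hg : MemLp (id : ℝ → ℝ) 2 (gaussianReal 0 Δ) := memLp_id_gaussianReal 2
  have e : ∀ z : EuclideanSpace ℝ (Fin d) × ℝ,
      (predict θ₀ z.1 + z.2 - predict θ z.1) ^ 2 = (id z.2 - predict (θ - θ₀) z.1) ^ 2 := by
    intro z
    rw [predict_sub, id]
    ring
  simp only [e]
  have hi : Integrable (fun z : EuclideanSpace ℝ (Fin d) × ℝ =>
      (id z.2 - predict (θ - θ₀) z.1) ^ 2) (Q.prod (gaussianReal 0 Δ)) :=
    ((hg.comp_snd Q).sub (hm.comp_fst (gaussianReal 0 Δ))).integrable_sq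
  rw [integral_prod _ hi]
  have h1 : ∀ b : ℝ, ∫ t, (id t - b) ^ 2 ∂(gaussianReal 0 Δ) = Δ + b ^ 2 := by
    intro b
    have hv := variance_eq_sub hg
    rw [variance_id_gaussianReal] at hv
    have h0 : ∫ t, id t ∂(gaussianReal 0 Δ) = 0 := integral_id_gaussianReal
    rw [h0] at hv
    have hi1 : Integrable (fun t : ℝ => t ^ 2) (gaussianReal 0 Δ) := hg.integrable_sq
    have hi2 : Integrable (fun t : ℝ => t) (gaussianReal 0 Δ) := hg.integrable one_le_two
    have e : ∀ t : ℝ, (id t - b) ^ 2 = t ^ 2 + (-(2 * b) * t + b ^ 2) := by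
      intro t; rw [id]; ring
    simp only [e]
    have hi3 : Integrable (fun t : ℝ => -(2 * b) * t + b ^ 2) (gaussianReal 0 Δ) :=
      (hi2.const_mul _).add (integrable_const _)
    rw [integral_add hi1 hi3, integral_add (hi2.const_mul _) (integrable_const _),
      integral_const_mul]
    have h0' : ∫ t : ℝ, t ∂(gaussianReal 0 Δ) = 0 := h0
    have hv' : (Δ : ℝ) = ∫ t : ℝ, t ^ 2 ∂(gaussianReal 0 Δ) := by
      rw [hv]; simp
    rw [h0', ← hv']
    simp
  simp only [h1]
  rw [integral_add (integrable_const _) hQ]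
  simp

theorem isProbabilityMeasure_twoClusterLaw {p : ℝ} (hp₀ : 0 ≤ p) (hp₁ : p ≤ 1)
    (μ : EuclideanSpace ℝ (Fin d)) : IsProbabilityMeasure (twoClusterLaw p μ) := by
  refine ⟨?_⟩
  simp only [twoClusterLaw, Measure.add_apply, Measure.smul_apply, measure_univ, smul_eq_mul,
    mul_one]
  rw [← ENNReal.ofReal_add hp₀ (by linarith)]
  simp

/-- The two components have opposite means and the same second moment along `θ - θ₀`, so the weight
`p` drops out. -/
theorem genError_twoClusterLaw {p : ℝ} (hp₀ : 0 ≤ p) (hp₁ : p ≤ 1)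
    (μ θ₀ θ : EuclideanSpace ℝ (Fin d)) (Δ : ℝ≥0) :
    genError (teacherLaw (twoClusterLaw p μ) θ₀ Δ) θ =
      Δ + ‖θ - θ₀‖ ^ 2 / d + (inner ℝ μ (θ - θ₀) / d) ^ 2 := by
  have := isProbabilityMeasure_twoClusterLaw hp₀ hp₁ μ
  set w := θ - θ₀ with hw
  have hi : ∀ (a : EuclideanSpace ℝ (Fin d)) (q : ℝ), Integrable (fun x => predict w x ^ 2)
      (ENNReal.ofReal q • multivariateGaussian a 1) := fun a q =>
    (memLp_predict_multivariateGaussian a w).integrable_sq.smul_measure ENNReal.ofReal_ne_top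
  have hQ : Integrable (fun x => predict w x ^ 2) (twoClusterLaw p μ) :=
    (hi _ p).add_measure (hi _ (1 - p))
  rw [genError_teacherLaw θ₀ θ Δ hQ, ← hw, twoClusterLaw, integral_add_measure (hi _ _) (hi _ _),
    integral_smul_measure, integral_smul_measure, integral_predict_sq_multivariateGaussian,
    integral_predict_sq_multivariateGaussian, ENNReal.toReal_ofReal hp₀,
    ENNReal.toReal_ofReal (by linarith), inner_neg_left, real_inner_smul_left, neg_sq, mul_pow,
    inv_pow, Real.sq_sqrt (Nat.cast_nonneg d), smul_eq_mul, smul_eq_mul, div_pow]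
  ring

end GenError

/-! ### The design matrix of a sample -/

section Sample

variable {n d : ℕ}

/-- The design matrix of a sample. -/
noncomputable def designOf (S : Sample n d) : Matrix (Fin n) (Fin d) ℝ :=
  of fun i j => (S i).1 j / √(d : ℝ)

/-- The labels of a sample. -/
def labelsOf (S : Sample n d) : Fin n → ℝ := fun i => (S i).2

/-- The label noise of a sample. -/
noncomputable def noiseOf (θ₀ : EuclideanSpace ℝ (Fin d)) (S : Sample n d) : Fin n → ℝ :=
  labelsOf S - designOf S *ᵥ θ₀.ofLp

theorem labelsOf_eq (θ₀ : EuclideanSpace ℝ (Fin d)) (S : Sample n d) :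
    labelsOf S = designOf S *ᵥ θ₀.ofLp + noiseOf θ₀ S := by
  rw [noiseOf]
  abel

theorem predict_eq_designOf_mulVec (θ : EuclideanSpace ℝ (Fin d)) (S : Sample n d) (i : Fin n) :
    predict θ (S i).1 = (designOf S *ᵥ θ.ofLp) i := by
  rw [predict, PiLp.inner_apply, Finset.sum_div]
  simp only [designOf, mulVec, dotProduct, of_apply]
  refine Finset.sum_congr rfl fun j _ => ?_
  simp only [RCLike.inner_apply, conj_trivial]
  ring

theorem sum_residual_sq_eq_rss (S : Sample n d) (θ : EuclideanSpace ℝ (Fin d)) :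
    ∑ i, ((S i).2 - predict θ (S i).1) ^ 2 = rss (designOf S) (labelsOf S) θ.ofLp := by
  simp only [predict_eq_designOf_mulVec, rss, dotProduct, Pi.sub_apply, labelsOf, sq]

theorem dotProduct_ofLp (a b : EuclideanSpace ℝ (Fin d)) : a.ofLp ⬝ᵥ b.ofLp = inner ℝ a b := by
  rw [PiLp.inner_apply, dotProduct]
  refine Finset.sum_congr rfl fun j _ => ?_
  simp only [RCLike.inner_apply, conj_trivial]
  ring

theorem ridgeEstimator_eq_ridgeSol {lam : ℝ} (hlam : 0 < lam) (S : Sample n d) :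
    ridgeEstimator lam S = WithLp.toLp 2 (ridgeSol lam (designOf S) (labelsOf S)) := by
  refine (eq_ridgeEstimator hlam S _ fun θ => ?_).symm
  simp only [ridgeRisk, sum_residual_sq_eq_rss, ← real_inner_self_eq_norm_sq, ← dotProduct_ofLp]
  exact rss_add_ridge lam hlam (designOf S) (labelsOf S) θ.ofLp

theorem trainError_eq_rss (S : Sample n d) (θ : EuclideanSpace ℝ (Fin d)) :
    trainError S θ = rss (designOf S) (labelsOf S) θ.ofLp / n := by
  rw [trainError, sum_residual_sq_eq_rss]

theorem continuous_designOf : Continuous (designOf : Sample n d → Matrix (Fin n) (Fin d) ℝ) := by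
  refine continuous_matrix fun i j => ?_
  simp only [designOf, of_apply]
  fun_prop

theorem continuous_noiseOf (θ₀ : EuclideanSpace ℝ (Fin d)) :
    Continuous (noiseOf θ₀ : Sample n d → Fin n → ℝ) := by
  have h1 : Continuous (labelsOf : Sample n d → Fin n → ℝ) := by
    unfold labelsOf
    fun_prop
  exact h1.sub (continuous_designOf.matrix_mulVec continuous_const)

theorem designOf_shiftedSample (a : Fin n → EuclideanSpace ℝ (Fin d))
    (θ₀ : EuclideanSpace ℝ (Fin d)) (z : (Fin n × Fin d → ℝ) × (Fin n → ℝ)) :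
    designOf (shiftedSample a θ₀ z) = design (of fun i j => a i j / √(d : ℝ)) z.1 := by
  ext i j
  simp only [designOf, shiftedSample, shiftedPair, design, signalPlusNoise, of_apply,
    Fintype.card_fin, PiLp.add_apply]
  ring

theorem noiseOf_shiftedSample (a : Fin n → EuclideanSpace ℝ (Fin d))
    (θ₀ : EuclideanSpace ℝ (Fin d)) (z : (Fin n × Fin d → ℝ) × (Fin n → ℝ)) :
    noiseOf θ₀ (shiftedSample a θ₀ z) = z.2 := by
  funext i
  rw [noiseOf, Pi.sub_apply, ← predict_eq_designOf_mulVec]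
  simp [labelsOf, shiftedSample, shiftedPair]

/-- The samples that are typical form a closed set. -/
theorem isClosed_isTypical {lam lam' ε τ Δ : ℝ} (hlam : 0 < lam) (hlam' : 0 < lam')
    (θ₀ μ : EuclideanSpace ℝ (Fin d)) :
    IsClosed {S : Sample n d | IsTypical lam lam' ε τ Δ θ₀.ofLp μ.ofLp (designOf S)
      (noiseOf θ₀ S)} := by
  have hX : Continuous fun S : Sample n d => designOf S := continuous_designOf
  have hξ := continuous_noiseOf (n := n) θ₀
  have hR : ∀ {t : ℝ}, 0 < t → Continuous fun S : Sample n d => resolvent t (designOf S) :=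
    fun ht => (continuous_resolvent ht).comp hX
  have hs : ∀ {t : ℝ}, 0 < t → Continuous fun S : Sample n d => stieltjes t (designOf S) :=
    fun ht => (hR ht).matrix_trace.div_const _
  have hq : ∀ B : Sample n d → Matrix (Fin n) (Fin n) ℝ, Continuous B → Continuous fun S =>
      |noiseOf θ₀ S ⬝ᵥ (B S *ᵥ noiseOf θ₀ S) - Δ * (B S).trace| := fun B hB =>
    ((hξ.dotProduct (hB.matrix_mulVec hξ)).sub (continuous_const.mul hB.matrix_trace)).abs
  have hD := (hR hlam).sub (hR hlam')
  have hH := (continuous_const (y := (1 : Matrix (Fin n) (Fin n) ℝ))).sub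
    ((hX.matrix_mul (hR hlam')).matrix_mul hX.matrix_transpose)
  have c1 := isClosed_le ((hs hlam).sub (continuous_const (y := τ))).abs (continuous_const (y := ε ^ 2))
  have c2 := isClosed_le ((hs hlam').sub (continuous_const (y := τ))).abs
    (continuous_const (y := ε ^ 2))
  have c3 := isClosed_le ((continuous_const (y := lam')).mul
    ((continuous_const (y := θ₀.ofLp)).dotProduct ((hR hlam').matrix_mulVec
      (continuous_const (y := θ₀.ofLp))))) (continuous_const (y := ε ^ 2 * (Fintype.card (Fin d) : ℝ)))
  have c4 := isClosed_le (hq _ ((hX.matrix_mul (hD.matrix_mul hD)).matrix_mul hX.matrix_transpose))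
    (continuous_const (y := ε ^ 2 * (Fintype.card (Fin d) : ℝ)))
  have c5 := isClosed_le (hq _ ((hX.matrix_mul ((hR hlam').matrix_mul (hR hlam'))).matrix_mul
    hX.matrix_transpose)) (continuous_const (y := ε ^ 2 * (Fintype.card (Fin d) : ℝ)))
  have c6 := isClosed_le (((continuous_const (y := μ.ofLp)).dotProduct ((hR hlam').matrix_mulVec
    (hX.matrix_transpose.matrix_mulVec hξ))).pow 2)
    (continuous_const (y := ε ^ 2 * (Fintype.card (Fin d) : ℝ) ^ 2))
  have c7 := isClosed_le (hq _ (hH.matrix_mul hH))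
    (continuous_const (y := ε ^ 2 * (Fintype.card (Fin n) : ℝ)))
  convert c1.inter (c2.inter (c3.inter (c4.inter (c5.inter (c6.inter c7))))) using 1
  ext S
  exact ⟨fun h => ⟨h.1, h.2, h.3, h.4, h.5, h.6, h.7⟩,
    fun h => ⟨h.1, h.2.1, h.2.2.1, h.2.2.2.1, h.2.2.2.2.1, h.2.2.2.2.2.1, h.2.2.2.2.2.2⟩⟩

end Sample

end IsotropicGMM

namespace IsotropicGMM

open Matrix

/-! ### Typical samples of the two-cluster mixture -/

instance isProbabilityMeasure_teacherLaw_multivariateGaussian {d : ℕ}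
    (a θ₀ : EuclideanSpace ℝ (Fin d)) (Δ : ℝ≥0) :
    IsProbabilityMeasure (teacherLaw (multivariateGaussian a 1) θ₀ Δ) :=
  (measurePreserving_shiftedPair a θ₀ Δ).map_eq ▸ Measure.isProbabilityMeasure_map
    (measurePreserving_shiftedPair a θ₀ Δ).aemeasurable

/-- The signs square to one, so the Frobenius norm of the mean matrix is the same for all cluster
assignments. This makes the bounds uniform over assignments. -/
theorem trace_transpose_mul_clusterMean {n d : ℕ} (σ : Fin n → Bool) (μ : EuclideanSpace ℝ (Fin d)) :
    ((of fun i j => (clusterSign (σ i) • (√(d : ℝ))⁻¹ • μ) j / √(d : ℝ) :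
        Matrix (Fin n) (Fin d) ℝ)ᵀ *
      (of fun i j => (clusterSign (σ i) • (√(d : ℝ))⁻¹ • μ) j / √(d : ℝ))).trace =
      n / d * (‖μ‖ ^ 2 / d) := by
  simp only [trace, diag_apply, mul_apply, transpose_apply, of_apply, PiLp.smul_apply, smul_eq_mul]
  have e : ∀ (j : Fin d) (i : Fin n), clusterSign (σ i) * ((√(d : ℝ))⁻¹ * μ j) / √(d : ℝ) *
      (clusterSign (σ i) * ((√(d : ℝ))⁻¹ * μ j) / √(d : ℝ)) = (d : ℝ)⁻¹ * (d : ℝ)⁻¹ * μ j ^ 2 := by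
    intro j i
    have h1 : (√(d : ℝ))⁻¹ * (√(d : ℝ))⁻¹ = (d : ℝ)⁻¹ := by
      rw [← mul_inv, Real.mul_self_sqrt (Nat.cast_nonneg d)]
    calc _ = clusterSign (σ i) ^ 2 * ((√(d : ℝ))⁻¹ * (√(d : ℝ))⁻¹) *
          ((√(d : ℝ))⁻¹ * (√(d : ℝ))⁻¹) * μ j ^ 2 := by ring
      _ = _ := by rw [clusterSign_sq, h1, one_mul]
  simp only [e, Finset.sum_const, Finset.card_univ, Fintype.card_fin, nsmul_eq_mul]
  rw [← Finset.mul_sum, ← Finset.mul_sum, EuclideanSpace.real_norm_sq_eq]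
  ring

theorem sampleLaw_not_isTypical_le {n d : ℕ} [Nonempty (Fin d)]
    {p lam lam' ε τ B K c Γ m m' : ℝ} {Δ : ℝ≥0} (hp₀ : 0 ≤ p) (hp₁ : p ≤ 1)
    (hlam : 0 < lam) (hll : lam ≤ lam') (hε : 0 < ε) (hK : 0 ≤ K) (hc0 : 0 < c) (P : ℕ)
    (hc : c ≤ (n : ℝ) / d - 1 - (1 + 2 * P) / d)
    (hm : 0 ≤ m) (hB : m ≤ B) (hroot : lam * m ^ 2 + ((n : ℝ) / d - 1 + lam) * m = 1)
    (hm' : 0 ≤ m') (hB' : m' ≤ B) (hroot' : lam' * m' ^ 2 + ((n : ℝ) / d - 1 + lam') * m' = 1)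
    (hlarge : stieltjesConst B K / √(d : ℝ) ≤ c / 2) (hlarge' : 2 / (d : ℝ) ≤ c / 4)
    (hτ : |m - τ| ≤ ε ^ 2 / 2) (hτ' : |m' - τ| ≤ ε ^ 2 / 2) (θ₀ μ : EuclideanSpace ℝ (Fin d))
    (hN : (n : ℝ) / d * (‖μ‖ ^ 2 / d) ≤ K ^ 2)
    (hθ : lam' * (2 * (2 / c * (1 + K ^ 2 / (2 * c)) * ‖θ₀‖ ^ 2)) ≤ ε ^ 2 * d)
    (hμ : ‖μ‖ ^ 2 ≤ Γ * d) :
    sampleLaw n (teacherLaw (twoClusterLaw p μ) θ₀ Δ)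
      {S | ¬ IsTypical lam lam' ε τ Δ θ₀.ofLp μ.ofLp (designOf S) (noiseOf θ₀ S)} ≤
      ENNReal.ofReal ((1 / 2) ^ P + atypicalConst c K B Γ lam' ε Δ / √(d : ℝ)) := by
  rw [sampleLaw, teacherLaw_twoClusterLaw]
  refine pi_mixture_le ?_ _ fun σ => ?_
  · rw [Fintype.sum_bool, if_pos rfl, if_neg (by decide), ← ENNReal.ofReal_add hp₀ (by linarith)]
    simp
  · set a : Fin n → EuclideanSpace ℝ (Fin d) := fun i => clusterSign (σ i) • (√(d : ℝ))⁻¹ • μ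
      with ha
    have hS : MeasurableSet {S : Sample n d |
        ¬ IsTypical lam lam' ε τ Δ θ₀.ofLp μ.ofLp (designOf S) (noiseOf θ₀ S)} :=
      (isClosed_isTypical hlam (hlam.trans_le hll) θ₀ μ).measurableSet.compl
    rw [← (measurePreserving_shiftedSample a θ₀ Δ).measure_preimage hS.nullMeasurableSet]
    simp only [Set.preimage_ofPred_eq, designOf_shiftedSample, noiseOf_shiftedSample]
    have h := measure_not_isTypical_le (ι := Fin n) (κ := Fin d) (Δ := Δ) (τ := τ) (Γ := Γ) hlam hll
      hε (of fun i j => a i j / √(d : ℝ)) hK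
      ((trace_transpose_mul_clusterMean σ μ).trans_le hN) hc0 P
      (by simpa only [Fintype.card_fin] using hc) hm hB
      (by simpa only [Fintype.card_fin] using hroot) hm' hB'
      (by simpa only [Fintype.card_fin] using hroot')
      (by simpa only [Fintype.card_fin] using hlarge)
      (by simpa only [Fintype.card_fin] using hlarge') hτ hτ' θ₀.ofLp μ.ofLp
      (by rw [dotProduct_ofLp, real_inner_self_eq_norm_sq]
          simpa only [Fintype.card_fin] using hθ)
      (by rw [dotProduct_ofLp, real_inner_self_eq_norm_sq]
          simpa only [Fintype.card_fin] using hμ)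
    simpa only [Fintype.card_fin] using h

/-! ### The limit of the normalized trace -/

theorem exists_stieltjes_limit {b lam : ℝ} (hb : 0 < b) (hlam : 0 < lam) :
    ∃ m, 0 ≤ m ∧ lam * m ^ 2 + (b + lam) * m = 1 := by
  set s := b + lam with hs
  have hs0 : 0 < s := by positivity
  have hD : √(s ^ 2 + 4 * lam) ^ 2 = s ^ 2 + 4 * lam := Real.sq_sqrt (by positivity)
  have hDs : s ≤ √(s ^ 2 + 4 * lam) := Real.le_sqrt_of_sq_le (by linarith)
  generalize √(s ^ 2 + 4 * lam) = D at hD hDs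
  refine ⟨(D - s) / (2 * lam), div_nonneg (by linarith) (by positivity), ?_⟩
  field_simp
  linear_combination hD

/-- The equation gives `b m ≤ 1` and `m - 1 / b = -lam (m² + m) / b`, so the root is bounded
uniformly in `lam` and tends to `1 / b` linearly in `lam`. -/
theorem stieltjes_limit_bounds {b c lam m : ℝ} (hc : 0 < c) (hcb : c ≤ b) (hlam : 0 < lam)
    (hm : 0 ≤ m) (h : lam * m ^ 2 + (b + lam) * m = 1) :
    m ≤ 1 / c ∧ |m - 1 / b| ≤ lam * (((1 / c) ^ 2 + 1 / c) / c) := by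
  have hb : 0 < b := hc.trans_le hcb
  have h0 : 0 ≤ lam * (m ^ 2 + m) := by positivity
  have h1 : m ≤ 1 / c := by
    rw [le_div_iff₀ hc]
    nlinarith [mul_le_mul_of_nonneg_left hcb hm]
  refine ⟨h1, ?_⟩
  have e : m - 1 / b = -(lam * ((m ^ 2 + m) / b)) := by
    field_simp
    linear_combination h
  rw [e, abs_neg, abs_of_nonneg (by positivity)]
  gcongr

/-- A bound for the measure of an event indexed by the regularization, uniformly down to zero. -/
theorem measure_exists_reg_le {E : Type*} [MeasurableSpace E] {P : Measure E} {lam₀ : ℝ}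
    (h₀ : 0 < lam₀) {A bad : ℝ → Set E} {M : ℝ≥0∞}
    (hA : ∀ l, 0 < l → l ≤ lam₀ / 2 → P (A l) ≤ M)
    (hbad : ∀ l, 0 < l → l ≤ lam₀ / 2 → ∀ t, l ≤ t → t ≤ lam₀ → bad t ⊆ A l) :
    P {S | ∃ t, 0 < t ∧ t ≤ lam₀ ∧ S ∈ bad t} ≤ M := by
  -- The shift by `2` keeps every lower end at most `lam₀ / 2`.
  set l : ℕ → ℝ := fun j => lam₀ / (j + 2) with hl
  have hl0 : ∀ j, 0 < l j := fun j => by positivity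
  have hl2 : ∀ j, l j ≤ lam₀ / 2 := fun j => by
    simp only [hl]
    gcongr
    linarith [(Nat.cast_nonneg j : (0 : ℝ) ≤ j)]
  have hmono : Monotone fun j => {S | ∃ t, l j ≤ t ∧ t ≤ lam₀ ∧ S ∈ bad t} := by
    intro i j hij S ⟨t, ht, h⟩
    refine ⟨t, le_trans ?_ ht, h⟩
    simp only [hl]
    gcongr
  have hsub : {S | ∃ t, 0 < t ∧ t ≤ lam₀ ∧ S ∈ bad t} ⊆
      ⋃ j, {S | ∃ t, l j ≤ t ∧ t ≤ lam₀ ∧ S ∈ bad t} := by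
    intro S ⟨t, ht, ht', h⟩
    obtain ⟨j, hj⟩ := exists_nat_ge (lam₀ / t)
    refine Set.mem_iUnion.2 ⟨j, t, ?_, ht', h⟩
    simp only [hl]
    rw [div_le_iff₀ ht] at hj
    rw [div_le_iff₀ (by positivity)]
    nlinarith
  refine (measure_mono hsub).trans ?_
  -- Continuity from below holds for arbitrary increasing sets, so the uncountable unions over `t`
  -- need not be measurable.
  rw [hmono.measure_iUnion]
  refine iSup_le fun j => (measure_mono ?_).trans (hA (l j) (hl0 j) (hl2 j))
  intro S ⟨t, ht, ht', h⟩
  exact hbad (l j) (hl0 j) (hl2 j) t ht ht' h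

end IsotropicGMM

namespace IsotropicGMM

open Matrix

/-! ### The proportional limit -/

theorem div_sqrt_tendsto_zero {d : ℕ → ℕ} (hd : Tendsto d atTop atTop) (C : ℝ) :
    Tendsto (fun k => C / √(d k : ℝ)) atTop (𝓝 0) :=
  (Real.tendsto_sqrt_atTop.comp (tendsto_natCast_atTop_atTop.comp hd)).const_div_atTop C

theorem div_tendsto_zero {d : ℕ → ℕ} (hd : Tendsto d atTop atTop) (C : ℝ) :
    Tendsto (fun k => C / (d k : ℝ)) atTop (𝓝 0) :=
  (tendsto_natCast_atTop_atTop.comp hd).const_div_atTop C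

section Limit

variable {α : ℝ} (hα : 1 < α) (Δ : ℝ≥0) {p : ℝ} (hp₀ : 0 ≤ p) (hp₁ : p ≤ 1)
  {n d : ℕ → ℕ} (hd : Tendsto d atTop atTop)
  (hnd : Tendsto (fun k => (n k : ℝ) / (d k : ℝ)) atTop (𝓝 α))
  (θ₀ μ : ∀ k, EuclideanSpace ℝ (Fin (d k))) {ρ γ : ℝ}
  (hρ : Tendsto (fun k => ‖θ₀ k‖ ^ 2 / (d k : ℝ)) atTop (𝓝 ρ))
  (hγ : Tendsto (fun k => ‖μ k‖ ^ 2 / (d k : ℝ)) atTop (𝓝 γ))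

include hα hp₀ hp₁ hd hnd hρ hγ

/-- For a small regularization `lam₀` the sample is typical with probability tending to one. -/
theorem exists_reg_eventually_isTypical {ε : ℝ} (hε : 0 < ε) :
    ∃ lam₀, 0 < lam₀ ∧ lam₀ * (1 / (α - 1) + 1) ≤ ε ^ 2 ∧
      lam₀ * (Δ * (1 / (α - 1)) + errorConst Δ (1 / (α - 1))) ≤ ε ^ 2 ∧
      (∀ᶠ k in atTop, lam₀ * ‖θ₀ k‖ ^ 2 ≤ ε ^ 2 * d k) ∧
      ∀ η : ℝ, 0 < η → ∀ᶠ k in atTop, ∀ lam, 0 < lam → lam ≤ lam₀ / 2 →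
        sampleLaw (n k) (teacherLaw (twoClusterLaw p (μ k)) (θ₀ k) Δ)
          {S | ¬ IsTypical lam lam₀ ε (1 / (α - 1)) Δ (θ₀ k).ofLp (μ k).ofLp (designOf S)
            (noiseOf (θ₀ k) S)} ≤ ENNReal.ofReal η := by
  have hα1 : 0 < α - 1 := by linarith
  have hρ0 : 0 ≤ ρ := ge_of_tendsto' hρ fun k => by positivity
  have hγ0 : 0 ≤ γ := ge_of_tendsto' hγ fun k => by positivity
  set τ := 1 / (α - 1) with hτ
  -- Half of the limiting gap: the rest absorbs the convergence of `n / d` and the term `(1 + 2 P) /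
  -- d`.
  set c := (α - 1) / 2 with hc
  have hc0 : 0 < c := by positivity
  set B := 1 / c with hB
  have hB0 : 0 < B := by positivity
  set K := √(α * γ + 1) with hK
  have hK2 : K ^ 2 = α * γ + 1 := Real.sq_sqrt (by positivity)
  set L₁ := (B ^ 2 + B) / c with hL₁
  set L₂ := 2 / c * (1 + K ^ 2 / (2 * c)) with hL₂
  have hτ0 : 0 < τ := by positivity
  have hE : 0 ≤ errorConst Δ τ := by rw [errorConst, deviationConst]; positivity
  -- The sum of all the quantities whose product with `lam₀` must be at most `ε²`; the choice `lam₀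
  -- = ε² / L` meets all these conditions at once.
  set L := 4 * L₁ + 2 * L₂ * (ρ + 1) + (ρ + 1) + (τ + 1) + (Δ * τ + errorConst Δ τ) with hL
  have q1 : 0 ≤ L₁ := by positivity
  have q2 : 0 ≤ 2 * L₂ * (ρ + 1) := by positivity
  have q3 : 0 ≤ Δ * τ + errorConst Δ τ := by positivity
  have hL0 : 0 < L := by positivity
  have hle : ∀ {x : ℝ}, x ≤ L → ε ^ 2 / L * x ≤ ε ^ 2 := fun {x} hx => by
    rw [div_mul_eq_mul_div, div_le_iff₀ hL0]
    gcongr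
  have hl0 : 0 < ε ^ 2 / L := by positivity
  have hθd : ∀ᶠ k in atTop, ‖θ₀ k‖ ^ 2 ≤ (ρ + 1) * d k := by
    filter_upwards [hρ.eventually_le_const (by linarith : ρ < ρ + 1), hd.eventually_ge_atTop 1]
      with k hk hdk
    have : (0 : ℝ) < d k := by exact_mod_cast hdk
    rwa [div_le_iff₀ this] at hk
  refine ⟨ε ^ 2 / L, hl0, hle (by linarith), hle (by linarith), ?_, fun η hη => ?_⟩
  · filter_upwards [hθd] with k hk
    calc ε ^ 2 / L * ‖θ₀ k‖ ^ 2 ≤ ε ^ 2 / L * ((ρ + 1) * d k) := by gcongr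
      _ = ε ^ 2 / L * (ρ + 1) * d k := by ring
      _ ≤ _ := by
        gcongr
        exact hle (by linarith)
  -- The moment order depends on the target probability `η`, while `lam₀` is already fixed. This
  -- order of choices is what makes the probability tend to zero at fixed `lam₀`.
  · obtain ⟨P, hP⟩ := exists_pow_lt_of_lt_one (half_pos hη) (by norm_num : (1 / 2 : ℝ) < 1)
    set lam₀ := ε ^ 2 / L with hlam₀
    have hη' := (div_sqrt_tendsto_zero hd (atypicalConst c K B (γ + 1) lam₀ ε Δ)).eventually_le_const
      (half_pos hη)
    have hs := (div_sqrt_tendsto_zero hd (stieltjesConst B K)).eventually_le_const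
      (by positivity : 0 < c / 2)
    have hd2 := (div_tendsto_zero hd 2).eventually_le_const (by positivity : 0 < c / 4)
    have hn1 := ((hnd.sub_const 1).sub (div_tendsto_zero hd (1 + 2 * P))).eventually_const_le
      (by rw [hc]; linarith : c < α - 1 - 0)
    have hinv : Tendsto (fun k => 1 / ((n k : ℝ) / d k - 1)) atTop (𝓝 (1 / (α - 1))) :=
      tendsto_const_nhds.div (hnd.sub_const 1) hα1.ne'
    have hτk : ∀ᶠ k in atTop, |1 / ((n k : ℝ) / d k - 1) - τ| ≤ ε ^ 2 / 4 := by
      have h := (tendsto_iff_dist_tendsto_zero.1 hinv).eventually_le_const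
        (by positivity : 0 < ε ^ 2 / 4)
      simpa only [Real.dist_eq] using h
    have hNk : ∀ᶠ k in atTop, (n k : ℝ) / d k * (‖μ k‖ ^ 2 / d k) ≤ K ^ 2 := by
      rw [hK2]
      exact (hnd.mul hγ).eventually_le_const (by linarith)
    filter_upwards [hη', hs, hd2, hn1, hτk, hNk, hθd,
      hγ.eventually_le_const (by linarith : γ < γ + 1), hd.eventually_ge_atTop 1]
      with k h1 h2 h3 h4 h5 h6 h7 h8 h9 lam hlam hll
    have hd0 : (0 : ℝ) < d k := by exact_mod_cast h9
    have : Nonempty (Fin (d k)) := ⟨⟨0, h9⟩⟩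
    have hcb : c ≤ (n k : ℝ) / d k - 1 := by
      have : 0 ≤ (1 + 2 * (P : ℝ)) / d k := by positivity
      linarith
    have hb0 : 0 < (n k : ℝ) / d k - 1 := hc0.trans_le hcb
    have key : ∀ t, 0 < t → t ≤ lam₀ → ∃ m, 0 ≤ m ∧ m ≤ B ∧
        t * m ^ 2 + ((n k : ℝ) / d k - 1 + t) * m = 1 ∧ |m - τ| ≤ ε ^ 2 / 2 := by
      intro t ht ht'
      obtain ⟨m, hm, hroot⟩ := exists_stieltjes_limit hb0 ht
      obtain ⟨hmB, hmb⟩ := stieltjes_limit_bounds hc0 hcb ht hm hroot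
      refine ⟨m, hm, hmB, hroot, ?_⟩
      have g1 : t * L₁ ≤ ε ^ 2 / 4 := by
        have g2 : lam₀ * (4 * L₁) ≤ ε ^ 2 := hle (by linarith)
        have g3 : t * L₁ ≤ lam₀ * L₁ := by gcongr
        linarith
      have g4 := abs_sub_le m (1 / ((n k : ℝ) / d k - 1)) τ
      linarith
    obtain ⟨m, hm, hmB, hroot, hmτ⟩ := key lam hlam (by linarith)
    obtain ⟨m', hm', hmB', hroot', hmτ'⟩ := key lam₀ hl0 le_rfl
    refine (sampleLaw_not_isTypical_le hp₀ hp₁ hlam (by linarith) hε (Real.sqrt_nonneg _) hc0 P h4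
      hm hmB hroot hm' hmB' hroot' h2 h3 hmτ hmτ' (θ₀ k) (μ k) h6 ?_ (Γ := γ + 1) ?_).trans
      (ENNReal.ofReal_le_ofReal (by linarith))
    · calc lam₀ * (2 * (L₂ * ‖θ₀ k‖ ^ 2)) ≤ lam₀ * (2 * (L₂ * ((ρ + 1) * d k))) := by gcongr
        _ = lam₀ * (2 * L₂ * (ρ + 1)) * d k := by ring
        _ ≤ _ := by
          gcongr
          exact hle (by linarith)
    · rwa [div_le_iff₀ hd0] at h8

/-- A performance measure converges if it is close to its limit on typical samples. -/
theorem vanishingRegLimit_of_isTypical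
    {err : ∀ k, Sample (n k) (d k) → EuclideanSpace ℝ (Fin (d k)) → ℝ} {e : ℝ}
    (h : ∀ δ, 0 < δ → ∃ ε, 0 < ε ∧ ∀ lam₀, 0 < lam₀ → lam₀ * (1 / (α - 1) + 1) ≤ ε ^ 2 →
      lam₀ * (Δ * (1 / (α - 1)) + errorConst Δ (1 / (α - 1))) ≤ ε ^ 2 →
      ∀ᶠ k in atTop, lam₀ * ‖θ₀ k‖ ^ 2 ≤ ε ^ 2 * d k → ∀ lam, 0 < lam → lam ≤ lam₀ / 2 →
        ∀ S, IsTypical lam lam₀ ε (1 / (α - 1)) Δ (θ₀ k).ofLp (μ k).ofLp (designOf S)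
          (noiseOf (θ₀ k) S) → ∀ t, lam ≤ t → t ≤ lam₀ →
          |err k S (ridgeEstimator t S) - e| < δ) :
    VanishingRegLimit n d (fun k => teacherLaw (twoClusterLaw p (μ k)) (θ₀ k) Δ) err e := by
  intro δ hδ
  obtain ⟨ε, hε, hdet⟩ := h δ hδ
  obtain ⟨lam₀, h0, h1, h2, h3, h4⟩ :=
    exists_reg_eventually_isTypical hα Δ hp₀ hp₁ hd hnd θ₀ μ hρ hγ hε
  refine ⟨lam₀, h0, ENNReal.tendsto_nhds_zero.2 fun η hη => ?_⟩
  obtain ⟨η', hη', hle⟩ : ∃ η' : ℝ, 0 < η' ∧ ENNReal.ofReal η' ≤ η := by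
    obtain ⟨r, hr0, hr⟩ := ENNReal.lt_iff_exists_nnreal_btwn.1 hη
    exact ⟨r, by exact_mod_cast hr0, by rw [ENNReal.ofReal_coe_nnreal]; exact hr.le⟩
  filter_upwards [hdet lam₀ h0 h1 h2, h3, h4 η' hη'] with k k1 k2 k3
  refine (measure_exists_reg_le (A := fun lam => {S : Sample (n k) (d k) | ¬ IsTypical lam lam₀ ε
    (1 / (α - 1)) Δ (θ₀ k).ofLp (μ k).ofLp (designOf S) (noiseOf (θ₀ k) S)})
    (bad := fun t => {S | δ ≤ |err k S (ridgeEstimator t S) - e|}) h0 k3 ?_).trans hle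
  intro l hl hl' t ht ht' S hS hT
  exact absurd (k1 k2 l hl hl' S hT t ht ht') (not_lt.2 hS)

/-- Both errors of ridge regression on the two-cluster mixture converge, with vanishing
regularization, to the values of the centered isotropic Gaussian model. -/
theorem vanishingRegLimit_twoClusterLaw :
    VanishingRegLimit n d (fun k => teacherLaw (twoClusterLaw p (μ k)) (θ₀ k) Δ)
        (fun k _ θ => genError (teacherLaw (twoClusterLaw p (μ k)) (θ₀ k) Δ) θ)
        (Δ * α / (α - 1)) ∧
      VanishingRegLimit n d (fun k => teacherLaw (twoClusterLaw p (μ k)) (θ₀ k) Δ)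
        (fun _ S θ => trainError S θ) (Δ * (α - 1) / α) := by
  have hα1 : 0 < α - 1 := by linarith
  have hγ0 : 0 ≤ γ := ge_of_tendsto' hγ fun k => by positivity
  set τ := 1 / (α - 1) with hτ
  have hτ0 : 0 < τ := by positivity
  have hE : 0 ≤ errorConst Δ τ := by rw [errorConst, deviationConst]; positivity
  have hD : 0 ≤ deviationConst Δ := by rw [deviationConst]; positivity
  have hchoice : ∀ C δ : ℝ, 0 < C → 0 < δ → ∃ ε, 0 < ε ∧ ε ≤ 1 ∧ C * ε < δ := by
    intro C δ hC hδ
    refine ⟨min 1 (δ / (2 * C)), by positivity, min_le_left _ _, ?_⟩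
    calc C * min 1 (δ / (2 * C)) ≤ C * (δ / (2 * C)) := by
          gcongr
          exact min_le_right _ _
      _ = δ / 2 := by field_simp
      _ < δ := by linarith
  constructor
  · refine vanishingRegLimit_of_isTypical hα Δ hp₀ hp₁ hd hnd θ₀ μ hρ hγ fun δ hδ => ?_
    obtain ⟨ε, hε, hε1, hεδ⟩ := hchoice (errorConst Δ τ + 2 + 2 * (γ + 1) * deviationConst Δ) δ
      (by positivity) hδ
    refine ⟨ε, hε, fun lam₀ h0 _ _ => ?_⟩
    filter_upwards [hγ.eventually_le_const (by linarith : γ < γ + 1), hd.eventually_ge_atTop 1]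
      with k h1 h2 _ lam hlam hll S hS t ht ht'
    have hd0 : (0 : ℝ) < d k := by exact_mod_cast h2
    have : Nonempty (Fin (d k)) := ⟨⟨0, h2⟩⟩
    have hμ : (μ k).ofLp ⬝ᵥ (μ k).ofLp ≤ (γ + 1) * Fintype.card (Fin (d k)) := by
      rw [dotProduct_ofLp, real_inner_self_eq_norm_sq, Fintype.card_fin]
      rwa [div_le_iff₀ hd0] at h1
    have h := hS.abs_genError_sub_le hlam hll Δ.coe_nonneg hε hε1 hμ ht ht'
    rw [← labelsOf_eq, Fintype.card_fin] at h
    rw [genError_twoClusterLaw hp₀ hp₁, ridgeEstimator_eq_ridgeSol (hlam.trans_le ht),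
      ← real_inner_self_eq_norm_sq, ← dotProduct_ofLp, ← dotProduct_ofLp]
    have e : (Δ : ℝ) * α / (α - 1) = Δ * (1 + τ) := by
      rw [hτ]
      field_simp
      ring
    rw [e]
    exact h.trans_lt hεδ
  · refine vanishingRegLimit_of_isTypical hα Δ hp₀ hp₁ hd hnd θ₀ μ hρ hγ fun δ hδ => ?_
    obtain ⟨ε, hε, hε1, hεδ⟩ := hchoice (8 + 5 * Δ) δ (by positivity) hδ
    refine ⟨ε, hε, fun lam₀ h0 hl1 hl2 => ?_⟩
    have hinv : Tendsto (fun k => (d k : ℝ) / n k) atTop (𝓝 (1 / α)) := by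
      have := hnd.inv₀ (by positivity)
      simpa only [inv_div, one_div] using this
    have hinv' : ∀ᶠ k in atTop, |(d k : ℝ) / n k - 1 / α| ≤ ε ^ 2 := by
      have h := (tendsto_iff_dist_tendsto_zero.1 hinv).eventually_le_const
        (by positivity : 0 < ε ^ 2)
      simpa only [Real.dist_eq] using h
    filter_upwards [hinv', hnd.eventually_const_le hα, hd.eventually_ge_atTop 1]
      with k h1 h2 h3 hθ lam hlam hll S hS t ht ht'
    have hd0 : (0 : ℝ) < d k := by exact_mod_cast h3
    have : Nonempty (Fin (d k)) := ⟨⟨0, h3⟩⟩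
    have hcard : Fintype.card (Fin (d k)) ≤ Fintype.card (Fin (n k)) := by
      rw [Fintype.card_fin, Fintype.card_fin]
      rw [le_div_iff₀ hd0, one_mul] at h2
      exact_mod_cast h2
    have h := hS.abs_trainError_sub_le hlam hll Δ.coe_nonneg hτ0.le hε hε1 (β := 1 / α)
      (by positivity) (by simpa only [Fintype.card_fin] using h1) hcard
      (by rw [dotProduct_ofLp, real_inner_self_eq_norm_sq, Fintype.card_fin]; exact hθ) hl1 hl2 ht ht'
    rw [← labelsOf_eq, Fintype.card_fin] at h
    rw [trainError_eq_rss, ridgeEstimator_eq_ridgeSol (hlam.trans_le ht)]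
    have e : (Δ : ℝ) * (α - 1) / α = Δ * (1 - 1 / α) := by
      field_simp
    rw [e]
    exact h.trans_lt hεδ

end Limit

end IsotropicGMM

theorem mainTheorem7 (α : ℝ) (hα : 1 < α) (Δ : ℝ≥0) (p : ℝ) (hp₀ : 0 ≤ p) (hp₁ : p ≤ 1)
    (n d : ℕ → ℕ) (hd : Tendsto d atTop atTop)
    (hnd : Tendsto (fun k => (n k : ℝ) / (d k : ℝ)) atTop (𝓝 α))
    (θ₀ μ : ∀ k, EuclideanSpace ℝ (Fin (d k))) (ρ γ π : ℝ)
    (hρ : Tendsto (fun k => ‖θ₀ k‖ ^ 2 / (d k : ℝ)) atTop (𝓝 ρ))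
    (hγ : Tendsto (fun k => ‖μ k‖ ^ 2 / (d k : ℝ)) atTop (𝓝 γ))
    (hπ : Tendsto (fun k => inner ℝ (μ k) (θ₀ k) / (d k : ℝ)) atTop (𝓝 π)) :
    -- the two-cluster Gaussian mixture
    (IsotropicGMM.VanishingRegLimit n d
        (fun k => IsotropicGMM.teacherLaw (IsotropicGMM.twoClusterLaw p (μ k)) (θ₀ k) Δ)
        (fun k _ θ => IsotropicGMM.genError
          (IsotropicGMM.teacherLaw (IsotropicGMM.twoClusterLaw p (μ k)) (θ₀ k) Δ) θ)
        (Δ * α / (α - 1)) ∧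
      IsotropicGMM.VanishingRegLimit n d
        (fun k => IsotropicGMM.teacherLaw (IsotropicGMM.twoClusterLaw p (μ k)) (θ₀ k) Δ)
        (fun _ S θ => IsotropicGMM.trainError S θ)
        (Δ * (α - 1) / α)) ∧
    -- the centered isotropic Gaussian model with the same teacher
    (IsotropicGMM.VanishingRegLimit n d
        (fun k => IsotropicGMM.teacherLaw (IsotropicGMM.gaussianLaw (d k)) (θ₀ k) Δ)
        (fun k _ θ => IsotropicGMM.genError
          (IsotropicGMM.teacherLaw (IsotropicGMM.gaussianLaw (d k)) (θ₀ k) Δ) θ)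
        (Δ * α / (α - 1)) ∧
      IsotropicGMM.VanishingRegLimit n d
        (fun k => IsotropicGMM.teacherLaw (IsotropicGMM.gaussianLaw (d k)) (θ₀ k) Δ)
        (fun _ S θ => IsotropicGMM.trainError S θ)
        (Δ * (α - 1) / α)) := by
  refine ⟨IsotropicGMM.vanishingRegLimit_twoClusterLaw hα Δ hp₀ hp₁ hd hnd θ₀ μ hρ hγ, ?_⟩
  -- The Gaussian model is the mixture with zero means, for which `γ = 0`.
  simp only [IsotropicGMM.gaussianLaw_eq_twoClusterLaw hp₀ hp₁]
  exact IsotropicGMM.vanishingRegLimit_twoClusterLaw hα Δ hp₀ hp₁ hd hnd θ₀ (fun _ => 0) hρ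
    (γ := 0) (by simp)
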